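/- Let $n\ge 1$. Let $g$ be a smooth pseudo-Riemannian metric (of any signature) and $L$ a smooth $(1,1)$-tensor field on an open set $U$ of a smooth manifold $M$. We call $L$ *compatible* with $g$ if $L$ is $g$-selfadjoint, nondegenerate at every point, and $$\nabla_u L=\tfrac12\bigl(u\otimes d\,\mathrm{tr}\,L+(u\otimes d\,\mathrm{tr}\,L)^*\bigr)$$ for all tangent vectors $u$, where $\nabla$ is the Levi-Civita connection of $g$ and $*$ denotes the $g$-adjoint. **Notation.** For a holomorphic function $\lambda$ of one complex variable $z_n$ and $z=(z_1,\dots,z_n)\in\mathbb C^n$ put $$a_k=k\,\lambda'(z_n)\,z_k\quad(1\le k\le n-2),\qquad a_{n-1}=1+(n-1)\lambda'(z_n)\,z_{n-1}$$ (with $z_0=0$, so $a_0=1$ if $n=1$), and $$ L^{\mathbb C}=\begin{pmatrix}\lambda&1&&&a_1\\&\lambda&\ddots&&a_2\\&&\ddots&1&\vdots\\&&&\lambda&a_{n-1}\\&&&&\lambda\end{pmatrix},\qquad g^{\mathbb C}=-i\begin{pmatrix}&&&&a_{n-1}\\&&&1&a_{n-2}\\&&\iddots&&\vdots\\&1&&&a_1\\a_{n-1}&a_{n-2}&\cdots&a_1&\sum_{j=1}^{n-2}a_ja_{n-j-1}\end{pmatrix}\bigl(L^{\mathbb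 C}-\bar\lambda\cdot\mathbf 1\bigr)^n, $$ where $\lambda=\lambda(z_n)$, blank entries are $0$, the last column of $L^{\mathbb C}$ is $(a_1,\dots,a_{n-1},\lambda)^\top$, and for $n=1$ the matrices are $L^{\mathbb C}=(\lambda)$ and $g^{\mathbb C}=-i(\lambda-\bar\lambda)$. **Theorem.** (a) Let $L$ be compatible with $g$ on $U$, and let $\lambda:U\to\mathbb C$ be a continuous function with $\mathrm{Im}\,\lambda\neq0$ such that at every $x\in U$ the operator $L$ on $T_xM$ is conjugate to the $n\times n$ complex Jordan block with eigenvalue $\lambda(x)$ acting on $\mathbb C^n\cong\mathbb R^{2n}$ (that is, $\dim_{\mathbb R} T_xM=2n$ and over $\mathbb C$ the operator $L$ has exactly two Jordan blocks, of size $n$, with eigenvalues $\lambda(x)$ and $\bar\lambda(x)$). Then every $p\in U$ has an open neighbourhood in $U$ that carries a complex structure $J$ and complex coordinates $(z_1,\dots,z_n)$ for $J$ such that 1. the eigenvalue $\lambda$ is a holomorphic function of $z_n$; 2. $L$ is $J$-complex-linear and is given in these coordinates by the matrix $L^{\mathbb C}$; 3. $g$ is the real part of the complex bilinear form given in these coordinates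 by the matrix $g^{\mathbb C}$. In the real coordinates $x_1,y_1,\dots,x_n,y_n$, where $z_k=x_k+iy_k$, the $2n\times2n$ matrices of $L$ and $g$ are obtained by replacing each entry $a+ib$ of $L^{\mathbb C}$ by $\begin{pmatrix}a&-b\\b&a\end{pmatrix}$ and each entry $a+ib$ of $g^{\mathbb C}$ by $\begin{pmatrix}a&-b\\-b&-a\end{pmatrix}$. (b) Conversely, for every holomorphic function $\lambda(z_n)$ on an open set $D\subseteq\mathbb C$, the tensors $g$ and $L$ defined on $\{z\in\mathbb C^n: z_n\in D\}$ by these formulas are compatible on the domain where $\lambda(z_n)\neq0$ and $\det g\neq0$ (here $g$ is the real $2n\times 2n$ matrix). Moreover, for $z_n\in D$, one has $\det g\ne0$ if and only if $\mathrm{Im}\,\lambda(z_n)\ne0$ and $1+(n-1)\lambda'(z_n)z_{n-1}\neq0$. -/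

import Mathlib

open Set
open scoped Manifold ContDiff Matrix ComplexConjugate

noncomputable section

namespace GeodEquiv

/-! ### Pseudo-Riemannian geometry on an open subset of a vector space -/

section Local

variable {E : Type*} [NormedAddCommGroup E] [NormedSpace ℝ E]

/-- The Christoffel map of the Levi-Civita connection of a metric `G` given on an open subset of a
vector space: for constant vector fields `u`, `v`, `w`,
`G (∇_u v, w) = 1/2 (∂_u G(v, w) + ∂_v G(u, w) - ∂_w G(u, v))`.
`christoffel G y u` is the linear map `v ↦ ∇_u v` at the point `y`; `(G y).inverse` raises the
index. -/
def christoffel (G : E → E →L[ℝ] E →L[ℝ] ℝ) (y u : E) : E →L[ℝ] E :=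
  (G y).inverse ∘L ((1 / 2 : ℝ) • (fderiv ℝ G y u + (fderiv ℝ G y).flip u
    - ((fderiv ℝ G y).flip u).flip))

/-- The covariant derivative `∇_u A` of a field of endomorphisms `A` with respect to the Levi-Civita
connection of `G`. -/
def covDerivEnd (G : E → E →L[ℝ] E →L[ℝ] ℝ) (A : E → E →L[ℝ] E) (y u : E) : E →L[ℝ] E :=
  fderiv ℝ A y u + christoffel G y u ∘L A y - A y ∘L christoffel G y u

/-- The adjoint of an endomorphism `B` with respect to a nondegenerate symmetric bilinear form
`b`: `b (B* w, v) = b (w, B v)`. -/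
def formAdjoint (b : E →L[ℝ] E →L[ℝ] ℝ) (B : E →L[ℝ] E) : E →L[ℝ] E :=
  b.inverse ∘L (ContinuousLinearMap.precomp ℝ B ∘L b)

/-- The differential of the function `tr A`. -/
def dTrace (A : E → E →L[ℝ] E) (y : E) : E →L[ℝ] ℝ :=
  fderiv ℝ (fun y' => LinearMap.trace ℝ E (A y').toLinearMap) y

/-- The equation `∇_u A = 1/2 (u ⊗ d tr A + (u ⊗ d tr A)*)` at the point `y`, for all vectors `u`;
here `u ⊗ α` is the endomorphism `v ↦ α v • u`. -/
def CompatEqAt (G : E → E →L[ℝ] E →L[ℝ] ℝ) (A : E → E →L[ℝ] E) (y : E) : Prop :=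
  ∀ u : E, covDerivEnd G A y u =
    (1 / 2 : ℝ) • ((dTrace A y).smulRight u + formAdjoint (G y) ((dTrace A y).smulRight u))

end Local

/-! ### Tensor fields on a manifold -/

section Global

variable {E : Type*} [NormedAddCommGroup E] [NormedSpace ℝ E]
  {M : Type*} [TopologicalSpace M] [ChartedSpace E M]

/-- The components of a field of bilinear forms in the chart at `x₀`, as a function on the
target of the chart. -/
def formInChart (g : ∀ x : M, TangentSpace 𝓘(ℝ, E) x →L[ℝ] TangentSpace 𝓘(ℝ, E) x →L[ℝ] ℝ)
    (x₀ : M) (y : E) : E →L[ℝ] E →L[ℝ] ℝ :=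
  let x : M := (extChartAt 𝓘(ℝ, E) x₀).symm y
  let dψ : E →L[ℝ] E := mfderiv 𝓘(ℝ, E) 𝓘(ℝ, E) (extChartAt 𝓘(ℝ, E) x₀).symm y
  let gx : E →L[ℝ] E →L[ℝ] ℝ := g x
  gx.bilinearComp dψ dψ

/-- The components of a field of endomorphisms in the chart at `x₀`. -/
def endInChart (L : ∀ x : M, TangentSpace 𝓘(ℝ, E) x →L[ℝ] TangentSpace 𝓘(ℝ, E) x)
    (x₀ : M) (y : E) : E →L[ℝ] E :=
  let x : M := (extChartAt 𝓘(ℝ, E) x₀).symm y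
  let dψ : E →L[ℝ] E := mfderiv 𝓘(ℝ, E) 𝓘(ℝ, E) (extChartAt 𝓘(ℝ, E) x₀).symm y
  let dφ : E →L[ℝ] E := mfderiv 𝓘(ℝ, E) 𝓘(ℝ, E) (extChartAt 𝓘(ℝ, E) x₀) x
  let Lx : E →L[ℝ] E := L x
  dφ ∘L Lx ∘L dψ

/-- The part of the target of the chart at `x₀` that corresponds to the subset `U` of `M`. -/
def chartDomain (E : Type*) [NormedAddCommGroup E] [NormedSpace ℝ E]
    {M : Type*} [TopologicalSpace M] [ChartedSpace E M] (U : Set M) (x₀ : M) : Set E :=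
  (extChartAt 𝓘(ℝ, E) x₀).target ∩ (extChartAt 𝓘(ℝ, E) x₀).symm ⁻¹' U

/-- `g` is a smooth pseudo-Riemannian metric (of any signature) on the open set `U`. -/
structure IsPseudoRiemannianOn
    (g : ∀ x : M, TangentSpace 𝓘(ℝ, E) x →L[ℝ] TangentSpace 𝓘(ℝ, E) x →L[ℝ] ℝ)
    (U : Set M) : Prop where
  symm : ∀ x ∈ U, ∀ u v : TangentSpace 𝓘(ℝ, E) x, g x u v = g x v u
  nondegenerate : ∀ x ∈ U, ∀ u : TangentSpace 𝓘(ℝ, E) x, (∀ v, g x u v = 0) → u = 0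
  smooth : ∀ x₀ : M, ContDiffOn ℝ ∞ (formInChart g x₀) (chartDomain E U x₀)

/-- `g` is a pseudo-Riemannian metric on the open set `U` and the smooth (1,1)-tensor field `L` is
compatible with `g` there: `L` is `g`-selfadjoint, nondegenerate, and satisfies
`∇_u L = 1/2 (u ⊗ d tr L + (u ⊗ d tr L)*)` for all tangent vectors `u`, where `∇` is the
Levi-Civita connection of `g` and `*` is the `g`-adjoint. This tensorial equation is expressed in
the charts of the manifold. -/
structure IsCompatibleOn
    (g : ∀ x : M, TangentSpace 𝓘(ℝ, E) x →L[ℝ] TangentSpace 𝓘(ℝ, E) x →L[ℝ] ℝ)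
    (L : ∀ x : M, TangentSpace 𝓘(ℝ, E) x →L[ℝ] TangentSpace 𝓘(ℝ, E) x)
    (U : Set M) : Prop where
  metric : IsPseudoRiemannianOn g U
  smooth : ∀ x₀ : M, ContDiffOn ℝ ∞ (endInChart L x₀) (chartDomain E U x₀)
  selfadjoint : ∀ x ∈ U, ∀ u v : TangentSpace 𝓘(ℝ, E) x, g x (L x u) v = g x u (L x v)
  nondegenerate : ∀ x ∈ U, Function.Bijective (L x)
  equation : ∀ x₀ : M, ∀ y ∈ chartDomain E U x₀,
    CompatEqAt (formInChart g x₀) (endInChart L x₀) y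

/-- The `n × n` complex Jordan block with eigenvalue `μ`. -/
def jordanBlock (n : ℕ) (μ : ℂ) : Matrix (Fin n) (Fin n) ℂ :=
  Matrix.of fun i j => if i = j then μ else if (j : ℕ) = i + 1 then 1 else 0

/-- The real operator `L x` is conjugate to the complex Jordan block with eigenvalue `μ`, acting on
`ℂⁿ` regarded as a real vector space of dimension `2n`. When `Im μ ≠ 0` this is the real
Jordan form of a pair of `n × n` Jordan blocks with eigenvalues `μ` and `conj μ`. -/
def IsConjToJordanAt (L : ∀ x : M, TangentSpace 𝓘(ℝ, E) x →L[ℝ] TangentSpace 𝓘(ℝ, E) x)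
    (n : ℕ) (x : M) (μ : ℂ) : Prop :=
  ∃ T : TangentSpace 𝓘(ℝ, E) x ≃ₗ[ℝ] (Fin n → ℂ), ∀ v, T (L x v) = jordanBlock n μ *ᵥ T v

/-- The differential at `x` of a map to `ℂⁿ`, as a real linear map. -/
def dCoord {n : ℕ} (φ : M → (Fin n → ℂ)) (x : M) :
    TangentSpace 𝓘(ℝ, E) x →L[ℝ] (Fin n → ℂ) :=
  mfderiv 𝓘(ℝ, E) 𝓘(ℝ, Fin n → ℂ) φ x

/-- A local diffeomorphism `φ = (z₁, …, zₙ)` from the open set `φ.source` onto the open subset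
`φ.target` of `ℂⁿ`, smooth in the real sense, whose differential intertwines `J` with
multiplication by `i`: a system of complex coordinates for `J` on `φ.source`. -/
structure IsComplexCoordinates
    (J : ∀ x : M, TangentSpace 𝓘(ℝ, E) x →L[ℝ] TangentSpace 𝓘(ℝ, E) x)
    {n : ℕ} (φ : OpenPartialHomeomorph M (Fin n → ℂ)) : Prop where
  smooth : ContMDiffOn 𝓘(ℝ, E) 𝓘(ℝ, Fin n → ℂ) ∞ φ φ.source
  smooth_symm : ContMDiffOn 𝓘(ℝ, Fin n → ℂ) 𝓘(ℝ, E) ∞ φ.symm φ.target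
  map_J : ∀ x ∈ φ.source, ∀ v : TangentSpace 𝓘(ℝ, E) x,
    dCoord φ x (J x v) = Complex.I • dCoord φ x v

/-- `J` is a complex structure on the open set `V`: `J² = -1` and around every point of `V` there
are complex coordinates for `J` (so `J` is smooth and integrable). -/
structure IsComplexStructureOn (n : ℕ)
    (J : ∀ x : M, TangentSpace 𝓘(ℝ, E) x →L[ℝ] TangentSpace 𝓘(ℝ, E) x)
    (V : Set M) : Prop where
  sq : ∀ x ∈ V, ∀ v : TangentSpace 𝓘(ℝ, E) x, J x (J x v) = -v
  integrable : ∀ x ∈ V, ∃ φ : OpenPartialHomeomorph M (Fin n → ℂ),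
    x ∈ φ.source ∧ φ.source ⊆ V ∧ IsComplexCoordinates J φ

/-- The real coordinate vector fields of `φ = (z₁, …, zₙ)`, `z_k = x_k + i y_k`, at the point `x`:
`coordVec φ x (k, 0) = ∂/∂x_k` and `coordVec φ x (k, 1) = ∂/∂y_k`. -/
def coordVec {n : ℕ} (φ : OpenPartialHomeomorph M (Fin n → ℂ)) (x : M) (p : Fin n × Fin 2) :
    TangentSpace 𝓘(ℝ, E) x :=
  (mfderiv 𝓘(ℝ, Fin n → ℂ) 𝓘(ℝ, E) φ.symm (φ x) : (Fin n → ℂ) →L[ℝ] E)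
    (Pi.single p.1 (![1, Complex.I] p.2))

end Global

/-! ### The normal form -/

section NormalForm

variable {n : ℕ}

/-- The coordinate `z_k`, numbered from `1` to `n`, with the convention `z_k = 0` for other `k`. -/
def coord (z : Fin n → ℂ) (k : ℕ) : ℂ :=
  if h : 1 ≤ k ∧ k ≤ n then z ⟨k - 1, by omega⟩ else 0

/-- The functions `a_k = k ℓ'(z_n) z_k` for `k ≠ n - 1`, and
`a_{n-1} = 1 + (n - 1) ℓ'(z_n) z_{n-1}`. -/
def aFun (ℓ : ℂ → ℂ) (z : Fin n → ℂ) (k : ℕ) : ℂ :=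
  (if k = n - 1 then 1 else 0) + k * deriv ℓ (coord z n) * coord z k

/-- The matrix `L^ℂ`: the Jordan block with eigenvalue `ℓ(z_n)` whose last column is replaced by
`(a_1, …, a_{n-1}, ℓ(z_n))`. The indices `i, j` run from `0` to `n - 1`. -/
def LC (ℓ : ℂ → ℂ) (z : Fin n → ℂ) : Matrix (Fin n) (Fin n) ℂ :=
  Matrix.of fun i j =>
    if i = j then ℓ (coord z n)
    else if (j : ℕ) = n - 1 then aFun ℓ z (i + 1)
    else if (j : ℕ) = i + 1 then 1
    else 0

/-- The matrix with last column `(a_{n-1}, …, a_1, s)`, last row `(a_{n-1}, …, a_1, s)`, where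
`s = ∑_{k=1}^{n-2} a_k a_{n-1-k}`, with entries `1` on the rest of the antidiagonal, and `0`
elsewhere. For `n = 1` the only entry is `a_{n-1} = 1`. The indices `i, j` run from `0` to
`n - 1`. -/
def antiC (ℓ : ℂ → ℂ) (z : Fin n → ℂ) : Matrix (Fin n) (Fin n) ℂ :=
  Matrix.of fun i j =>
    if (i : ℕ) = n - 1 ∧ (j : ℕ) = n - 1 then
      (if n = 1 then aFun ℓ z (n - 1)
        else ∑ k ∈ Finset.Icc 1 (n - 2), aFun ℓ z k * aFun ℓ z (n - 1 - k))
    else if (j : ℕ) = n - 1 then aFun ℓ z (n - 1 - i)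
    else if (i : ℕ) = n - 1 then aFun ℓ z (n - 1 - j)
    else if (i : ℕ) + j + 1 = n then 1
    else 0

/-- The matrix `g^ℂ = -i · antiC · (L^ℂ - conj ℓ(z_n))ⁿ`. -/
def gC (ℓ : ℂ → ℂ) (z : Fin n → ℂ) : Matrix (Fin n) (Fin n) ℂ :=
  (-Complex.I) • (antiC ℓ z * (LC ℓ z - (conj (ℓ (coord z n))) • (1 : Matrix _ _ ℂ)) ^ n)

/-- The real linear operator `v ↦ A v` on `ℂⁿ`. -/
def opOf (A : Matrix (Fin n) (Fin n) ℂ) : (Fin n → ℂ) →L[ℝ] (Fin n → ℂ) :=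
  (A.mulVecLin.restrictScalars ℝ).toContinuousLinearMap

/-- The real part `(u, v) ↦ Re (uᵀ B v)` of the complex bilinear form on `ℂⁿ` with matrix `B`. -/
def reFormOf (B : Matrix (Fin n) (Fin n) ℂ) : (Fin n → ℂ) →L[ℝ] (Fin n → ℂ) →L[ℝ] ℝ :=
  (LinearMap.mk₂ ℝ (fun u v : Fin n → ℂ => (u ⬝ᵥ B *ᵥ v).re)
    (fun u u' v => by simp [add_dotProduct])
    (fun c u v => by simp [smul_dotProduct])
    (fun u v v' => by simp [Matrix.mulVec_add, dotProduct_add])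
    (fun c u v => by simp [Matrix.mulVec_smul, dotProduct_smul])).toContinuousBilinearMap

/-- The real `2n × 2n` matrix obtained by replacing each entry `a + ib` by the block
`(a, -b; b, a)`. -/
def realOp (A : Matrix (Fin n) (Fin n) ℂ) : Matrix (Fin n × Fin 2) (Fin n × Fin 2) ℝ :=
  Matrix.of fun p q =>
    !![(A p.1 q.1).re, -(A p.1 q.1).im; (A p.1 q.1).im, (A p.1 q.1).re] p.2 q.2

/-- The real `2n × 2n` matrix obtained by replacing each entry `a + ib` by the block
`(a, -b; -b, -a)`. -/
def realForm (B : Matrix (Fin n) (Fin n) ℂ) : Matrix (Fin n × Fin 2) (Fin n × Fin 2) ℝ :=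
  Matrix.of fun p q =>
    !![(B p.1 q.1).re, -(B p.1 q.1).im; -(B p.1 q.1).im, -(B p.1 q.1).re] p.2 q.2

/-- The field of bilinear forms `Re g^ℂ` on `ℂⁿ`, regarded as a real manifold. -/
def modelMetric (n : ℕ) (ℓ : ℂ → ℂ) (z : Fin n → ℂ) :
    TangentSpace 𝓘(ℝ, Fin n → ℂ) z →L[ℝ] TangentSpace 𝓘(ℝ, Fin n → ℂ) z →L[ℝ] ℝ :=
  reFormOf (gC ℓ z)

/-- The field of operators `L^ℂ` on `ℂⁿ`, regarded as a real manifold. -/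
def modelOp (n : ℕ) (ℓ : ℂ → ℂ) (z : Fin n → ℂ) :
    TangentSpace 𝓘(ℝ, Fin n → ℂ) z →L[ℝ] TangentSpace 𝓘(ℝ, Fin n → ℂ) z :=
  opOf (LC ℓ z)

end NormalForm

end GeodEquiv

end

noncomputable section

namespace GeodEquiv

/-! ### Linear algebra of the model Jordan block -/

section ModelAlgebra

variable {n : ℕ}

/-! Write N for `shiftN`, S for `raiseS`, H for `degH`, K for the antidiagonal form `pairK`, e_n for
`lastVec`, and B for `formB n n ρ`, that is -iK(N + ρ)^n with ρ = λ - conj λ. The proof is a moving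
frame argument: a canonical coframe θ is attached to (g, L), compatibility becomes a structure
equation for θ, and this equation integrates to coordinates.

Pointwise algebra. A real form for which a nonreal Jordan block is selfadjoint is the real part of a
complex form for which N is selfadjoint (`bilin_of_jordan_selfadjoint`). Since e_n is cyclic for N,
such a form is Re(-iK(r, a(N) b)) for a single vector r. An operator C commuting with N takes it to
Re B as soon as (N + ρ)^n C² = r(N), and this square root is a binomial series, because everything
is a scalar plus a nilpotent. Done smoothly, this gives a coframe in which L = N + λ and g = Re B
(`exists_canonical_coframe`).

Structure equations. Tracing the compatibility equation against operators commuting with L shows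
that dλ is complex linear and kills the image of N, so dλ = μ θ_n
(`exists_eigenvalue_differential`). The Koszul formula expresses ∇L through dλ and the torsion of θ.
The choice dθ = -dλ ∧ Sθ solves the resulting equation (`modelKoszul_commutator`). It is the only
solution: the contorsion of a difference of solutions is skew, but it commutes with the block and is
therefore symmetric (`torsion_eq_zero`).

Integration. In components dθ_{k+1} = -k dλ ∧ θ_k, a triangular system. If θ_k - dz_k is a multiple
of dλ, then θ_{k+1} - k z_k dλ is closed, so the Poincaré lemma yields z_{k+1}; altogether θ = dz +
dλ · Sz (`exists_coordinates_of_torsion`). Now dλ is a multiple of dz_n, hence λ = ℓ(z_n) with ℓ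
holomorphic, and θ = P dz with P = 1 + ℓ' Sz ⊗ dz_n (`frameP`). Conjugating N + λ and pulling back B
by P gives exactly the stated matrices (`frameP_LC`, `dotProduct_gC`).

Converse. For every holomorphic ℓ the coframe P dz satisfies the structure equation, so the same
Koszul computation proves compatibility (`compatEqAt_of_torsion`). The metric degenerates exactly
when ρ = 0 or P is singular. -/

lemma coord_succ (v : Fin n → ℂ) (i : Fin n) : coord v (i + 1) = v i := by
  simp [coord, Nat.succ_le_of_lt i.2]

lemma coord_zero (v : Fin n → ℂ) : coord v 0 = 0 := by simp [coord]

lemma coord_of_lt (v : Fin n → ℂ) {k : ℕ} (h : n < k) : coord v k = 0 := by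
  simp only [coord]
  rw [dif_neg]
  omega

lemma eq_coord (v : Fin n → ℂ) {i : Fin n} {k : ℕ} (h : k = i + 1) : v i = coord v k := by
  rw [h, coord_succ]

/-- The coordinate `coord · k` as a linear form. -/
def coordLin (n k : ℕ) : (Fin n → ℂ) →ₗ[ℂ] ℂ where
  toFun v := coord v k
  map_add' u v := by simp only [coord]; split_ifs <;> simp
  map_smul' c v := by simp only [coord]; split_ifs <;> simp

@[simp] lemma coordLin_apply (k : ℕ) (v : Fin n → ℂ) : coordLin n k v = coord v k := rfl

lemma coord_add (u v : Fin n → ℂ) (k : ℕ) : coord (u + v) k = coord u k + coord v k :=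
  (coordLin n k).map_add u v

lemma coord_smul (c : ℂ) (v : Fin n → ℂ) (k : ℕ) : coord (c • v) k = c * coord v k :=
  (coordLin n k).map_smul c v

/-- The nilpotent Jordan block. -/
def shiftN (n : ℕ) : Module.End ℂ (Fin n → ℂ) :=
  LinearMap.pi fun i => coordLin n (i + 2)

/-- The operator `e_k ↦ k e_{k+1}`. -/
def raiseS (n : ℕ) : Module.End ℂ (Fin n → ℂ) :=
  LinearMap.pi fun i => (i : ℂ) • coordLin n i

/-- The operator `e_k ↦ k e_k`. -/
def degH (n : ℕ) : Module.End ℂ (Fin n → ℂ) :=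
  LinearMap.pi fun i => ((i : ℂ) + 1) • coordLin n (i + 1)

/-- The last basis vector. -/
def lastVec (n : ℕ) : Fin n → ℂ := fun i => if (i : ℕ) + 1 = n then 1 else 0

lemma coord_shiftN (v : Fin n → ℂ) {k : ℕ} (hk : 1 ≤ k) :
    coord (shiftN n v) k = coord v (k + 1) := by
  by_cases h : k ≤ n
  · obtain ⟨j, rfl⟩ : ∃ j, k = j + 1 := ⟨k - 1, by omega⟩
    have := coord_succ (shiftN n v) ⟨j, by omega⟩
    simp only [] at this
    rw [this]
    rfl
  · rw [coord_of_lt _ (by omega), coord_of_lt _ (by omega)]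

lemma coord_raiseS (v : Fin n → ℂ) {k : ℕ} (hk : k + 1 ≤ n) :
    coord (raiseS n v) (k + 1) = k * coord v k := by
  have := coord_succ (raiseS n v) ⟨k, by omega⟩
  simp only [] at this
  rw [this]
  rfl

lemma coord_degH (v : Fin n → ℂ) (k : ℕ) : coord (degH n v) k = k * coord v k := by
  rcases k with _ | k
  · simp [coord_zero]
  by_cases h : k + 1 ≤ n
  · have := coord_succ (degH n v) ⟨k, by omega⟩
    simp only [] at this
    rw [this]
    simp [degH]
  · rw [coord_of_lt _ (by omega), coord_of_lt _ (by omega), mul_zero]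

lemma coord_lastVec {k : ℕ} (hn : 1 ≤ n) : coord (lastVec n) k = if k = n then 1 else 0 := by
  by_cases h : 1 ≤ k ∧ k ≤ n
  · simp only [coord, dif_pos h, lastVec]
    congr 1
    simp only [eq_iff_iff]
    omega
  · simp only [coord, dif_neg h]
    rw [if_neg]
    omega

lemma ext_coord {u v : Fin n → ℂ} (h : ∀ k, 1 ≤ k → k ≤ n → coord u k = coord v k) : u = v := by
  funext i
  rw [← coord_succ u, ← coord_succ v]
  exact h _ (by omega) (by omega)

lemma coord_shiftN_last (v : Fin n → ℂ) : coord (shiftN n v) n = 0 := by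
  rcases Nat.eq_zero_or_pos n with rfl | h
  · exact coord_zero _
  · rw [coord_shiftN _ h, coord_of_lt _ (by omega)]

/-- The relations SN = H - 1, NS = H - n z_n e_n and [H, N] = -N, here and in the next two lemmas,
are what the connection computation rests on. The boundary term appears because S would push e_n out
of range. -/
lemma raiseS_shiftN (v : Fin n → ℂ) : raiseS n (shiftN n v) = degH n v - v := by
  rw [eq_sub_iff_add_eq]
  refine ext_coord fun k h1 h2 => ?_
  obtain ⟨k, rfl⟩ : ∃ j, k = j + 1 := ⟨k - 1, by omega⟩
  rw [coord_add, coord_raiseS _ h2, coord_degH]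
  rcases k with _ | k
  · simp
  · rw [coord_shiftN _ (by omega)]
    push_cast
    ring

lemma shiftN_raiseS (v : Fin n → ℂ) :
    shiftN n (raiseS n v) = degH n v - ((n : ℂ) * coord v n) • lastVec n := by
  rw [eq_sub_iff_add_eq]
  refine ext_coord fun k h1 h2 => ?_
  rw [coord_add, coord_shiftN _ h1, coord_smul, coord_degH, coord_lastVec (by omega)]
  rcases h2.lt_or_eq with h | rfl
  · rw [coord_raiseS _ (by omega), if_neg (by omega)]
    ring
  · rw [coord_of_lt _ (by omega)]
    simp

lemma degH_shiftN (v : Fin n → ℂ) :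
    degH n (shiftN n v) = shiftN n (degH n v) - shiftN n v := by
  rw [eq_sub_iff_add_eq]
  refine ext_coord fun k h1 h2 => ?_
  rw [coord_add, coord_degH, coord_shiftN _ h1, coord_shiftN _ h1, coord_degH]
  push_cast
  ring

lemma coord_shiftN_pow (m : ℕ) (v : Fin n → ℂ) {k : ℕ} (hk : 1 ≤ k) :
    coord ((shiftN n ^ m) v) k = coord v (k + m) := by
  induction m generalizing k with
  | zero => rfl
  | succ m ih =>
    rw [pow_succ', Module.End.mul_apply, coord_shiftN _ hk, ih (by omega)]
    congr 1
    omega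

lemma shiftN_pow_self : shiftN n ^ n = 0 := by
  refine LinearMap.ext fun v => ext_coord fun k h1 h2 => ?_
  rw [coord_shiftN_pow _ _ h1, coord_of_lt _ (by omega)]
  exact ((coordLin n k).map_zero).symm

/-- The bilinear form with ones on the antidiagonal. -/
def pairK (n : ℕ) : (Fin n → ℂ) →ₗ[ℂ] (Fin n → ℂ) →ₗ[ℂ] ℂ :=
  LinearMap.mk₂ ℂ (fun u v => ∑ i, u i * v (Fin.rev i))
    (fun u u' v => by simp [add_mul, Finset.sum_add_distrib])
    (fun c u v => by simp [mul_assoc, Finset.mul_sum])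
    (fun u v v' => by simp [mul_add, Finset.sum_add_distrib])
    (fun c u v => by simp [mul_left_comm, Finset.mul_sum])

lemma pairK_apply (u v : Fin n → ℂ) : pairK n u v = ∑ i, u i * v (Fin.rev i) := rfl

lemma pairK_eq_range (u v : Fin n → ℂ) :
    pairK n u v = ∑ i ∈ Finset.range n, coord u (i + 1) * coord v (n - i) := by
  rw [pairK_apply, Finset.sum_range]
  refine Finset.sum_congr rfl fun i _ => ?_
  rw [coord_succ, eq_coord v (i := Fin.rev i) (k := n - i)]
  simp only [Fin.val_rev]
  omega

lemma pairK_comm (u v : Fin n → ℂ) : pairK n u v = pairK n v u := by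
  rw [pairK_apply, pairK_apply, ← Equiv.sum_comp Fin.revPerm]
  simp [mul_comm]

lemma pairK_shiftN (u v : Fin n → ℂ) : pairK n (shiftN n u) v = pairK n u (shiftN n v) := by
  rw [pairK_eq_range, pairK_eq_range]
  -- A sum of n + 1 terms whose first and last vanish, since an index exceeds n there; dropping one
  -- end or the other gives the two sides.
  have h := Finset.sum_range_succ (fun j => coord u (j + 1) * coord v (n - j + 1)) n
  rw [Finset.sum_range_succ'] at h
  rw [coord_of_lt u (by omega : n < n + 1), coord_of_lt v (by omega : n < n - 0 + 1)] at h
  simp only [zero_mul, mul_zero, add_zero] at h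
  refine Eq.trans ?_ (h.trans ?_)
  · refine Finset.sum_congr rfl fun i hi => ?_
    have := Finset.mem_range.1 hi
    rw [coord_shiftN _ (by omega)]
    congr 2
    omega
  · refine Finset.sum_congr rfl fun i hi => ?_
    have := Finset.mem_range.1 hi
    rw [coord_shiftN _ (by omega)]

/-- K pairs index i + 1 with index n - i, and these weights always add up to n + 1. -/
lemma pairK_degH (u v : Fin n → ℂ) :
    pairK n (degH n u) v + pairK n u (degH n v) = ((n : ℂ) + 1) * pairK n u v := by
  simp only [pairK_eq_range, Finset.mul_sum, ← Finset.sum_add_distrib]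
  refine Finset.sum_congr rfl fun i hi => ?_
  rw [coord_degH, coord_degH, Nat.cast_sub (Finset.mem_range.1 hi).le]
  push_cast
  ring

lemma pairK_single (u : Fin n → ℂ) (i : Fin n) : pairK n u (Pi.single i 1) = u (Fin.rev i) := by
  rw [pairK_comm, pairK_apply]
  simp [Pi.single_apply]

lemma pairK_nondegenerate {u : Fin n → ℂ} (h : ∀ v, pairK n u v = 0) : u = 0 := by
  funext i
  have := h (Pi.single (Fin.rev i) 1)
  rwa [pairK_single, Fin.rev_rev] at this

/-- The operator `N + ρ`. -/
def sigmaOp (n : ℕ) (ρ : ℂ) : Module.End ℂ (Fin n → ℂ) := shiftN n + ρ • 1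

lemma sigmaOp_apply (ρ : ℂ) (v : Fin n → ℂ) : sigmaOp n ρ v = shiftN n v + ρ • v := rfl

lemma commute_sigmaOp (ρ : ℂ) : Commute (shiftN n) (sigmaOp n ρ) :=
  (Commute.refl _).add_right ((Commute.one_right _).smul_right ρ)

lemma shiftN_sigmaOp_pow (ρ : ℂ) (m : ℕ) (v : Fin n → ℂ) :
    shiftN n ((sigmaOp n ρ ^ m) v) = (sigmaOp n ρ ^ m) (shiftN n v) :=
  LinearMap.congr_fun ((commute_sigmaOp (n := n) ρ).pow_right m).eq v

lemma sigmaOp_injective {ρ : ℂ} (hρ : ρ ≠ 0) : Function.Injective (sigmaOp n ρ) := by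
  have : IsUnit (sigmaOp n ρ) :=
    IsNilpotent.isUnit_add_right_of_commute (r := shiftN n) ⟨n, shiftN_pow_self⟩
      ((IsUnit.mk0 ρ hρ).map (algebraMap ℂ (Module.End ℂ (Fin n → ℂ))) |> fun h => by
        simpa [Algebra.algebraMap_eq_smul_one] using h)
      ((Commute.one_right _).smul_right ρ)
  exact ((Module.End.isUnit_iff _).1 this).1

/-- The complex bilinear form `-i K (N + ρ)^m`. -/
def formB (n m : ℕ) (ρ : ℂ) : (Fin n → ℂ) →ₗ[ℂ] (Fin n → ℂ) →ₗ[ℂ] ℂ :=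
  (-Complex.I) • (pairK n).compl₂ (sigmaOp n ρ ^ m)

lemma formB_apply (m : ℕ) (ρ : ℂ) (u v : Fin n → ℂ) :
    formB n m ρ u v = -Complex.I * pairK n u ((sigmaOp n ρ ^ m) v) := rfl

lemma pairK_sigmaOp_pow (m : ℕ) (ρ : ℂ) (u v : Fin n → ℂ) :
    pairK n ((sigmaOp n ρ ^ m) u) v = pairK n u ((sigmaOp n ρ ^ m) v) := by
  induction m generalizing u v with
  | zero => rfl
  | succ m ih =>
    rw [pow_succ, Module.End.mul_apply, ih, ← pow_succ, pow_succ',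
      Module.End.mul_apply, sigmaOp_apply, sigmaOp_apply]
    simp [pairK_shiftN]

lemma formB_comm (m : ℕ) (ρ : ℂ) (u v : Fin n → ℂ) : formB n m ρ u v = formB n m ρ v u := by
  rw [formB_apply, formB_apply, pairK_comm, pairK_sigmaOp_pow]

lemma formB_shiftN (m : ℕ) (ρ : ℂ) (u v : Fin n → ℂ) :
    formB n m ρ (shiftN n u) v = formB n m ρ u (shiftN n v) := by
  rw [formB_apply, formB_apply, pairK_shiftN, shiftN_sigmaOp_pow]

lemma formB_succ (m : ℕ) (ρ : ℂ) (u v : Fin n → ℂ) :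
    formB n (m + 1) ρ u v = formB n m ρ (shiftN n u) v + ρ * formB n m ρ u v := by
  rw [formB_shiftN]
  simp only [formB_apply, pow_succ, Module.End.mul_apply, sigmaOp_apply, map_add, map_smul,
    smul_eq_mul]
  ring

lemma degH_sigmaOp_pow (m : ℕ) (ρ : ℂ) (v : Fin n → ℂ) :
    (sigmaOp n ρ ^ m) (degH n v) = degH n ((sigmaOp n ρ ^ m) v)
      + (m : ℂ) • shiftN n ((sigmaOp n ρ ^ (m - 1)) v) := by
  induction m with
  | zero => simp
  | succ m ih =>
    rw [pow_succ', Module.End.mul_apply, ih, Module.End.mul_apply, map_add, map_smul,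
      sigmaOp_apply ρ (degH n _), sigmaOp_apply ρ ((sigmaOp n ρ ^ m) v), map_add, degH_shiftN]
    rcases m with _ | m
    · simp
      abel
    · simp only [Nat.add_sub_cancel, pow_succ' _ m, Module.End.mul_apply, sigmaOp_apply, map_add,
        map_smul, degH_shiftN]
      push_cast
      module

/-- The first term is the weight n + 1 of K; the second is the effect on (N + ρ)^m of the derivation
[·, H], which fixes N. -/
lemma formB_degH (m : ℕ) (ρ : ℂ) (u v : Fin n → ℂ) :
    formB n m ρ (degH n u) v + formB n m ρ u (degH n v) = ((n : ℂ) + 1) * formB n m ρ u v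
      + (m : ℂ) * formB n (m - 1) ρ (shiftN n u) v := by
  have h := pairK_degH u ((sigmaOp n ρ ^ m) v)
  rw [formB_shiftN]
  simp only [formB_apply, degH_sigmaOp_pow, map_add, map_smul, smul_eq_mul, shiftN_sigmaOp_pow]
    at h ⊢
  linear_combination (-Complex.I) * h

/-- Testing against v and i v kills both parts of the complex value; then K is nondegenerate and (N
+ ρ)^m is injective. -/
lemma formB_nondegenerate {m : ℕ} {ρ : ℂ} (hρ : ρ ≠ 0) {u : Fin n → ℂ}
    (h : ∀ v, (formB n m ρ u v).re = 0) : u = 0 := by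
  have h' : ∀ v, formB n m ρ u v = 0 := fun v => by
    refine Complex.ext (h v) ?_
    have := h (Complex.I • v)
    simpa using this
  have h2 : (sigmaOp n ρ ^ m) u = 0 := pairK_nondegenerate fun v => by
    have := h' v
    rw [formB_apply, ← pairK_sigmaOp_pow] at this
    simpa using this
  have : Function.Injective (sigmaOp n ρ ^ m) := by
    rw [Module.End.coe_pow]
    exact (sigmaOp_injective hρ).iterate m
  exact this (by rw [h2, map_zero])

end ModelAlgebra

/-! ### The Koszul identity of the model torsion, and forms for which a nonreal block is selfadjoint
-/

section ModelConnection

variable {n : ℕ}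

/-- The operator `J = N + lam` of multiplication by the Jordan block. -/
lemma jordanBlock_mulVec (lam : ℂ) (v : Fin n → ℂ) :
    jordanBlock n lam *ᵥ v = shiftN n v + lam • v := by
  funext i
  have h : ∀ j, jordanBlock n lam i j * v j
      = (if i = j then lam * v j else 0) + if (j : ℕ) = i + 1 then v j else 0 := fun j => by
    simp only [jordanBlock, Matrix.of_apply]
    split_ifs with h1 h2
    · subst h1; omega
    · simp
    · simp
    · simp
  simp only [Matrix.mulVec, dotProduct, h, Finset.sum_add_distrib, Finset.sum_ite_eq,
    Finset.mem_univ, if_true, Pi.add_apply, Pi.smul_apply, smul_eq_mul]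
  rw [add_comm]
  congr 1
  show _ = coord v (i + 2)
  by_cases hi : (i : ℕ) + 1 < n
  · rw [Finset.sum_eq_single ⟨i + 1, hi⟩]
    · rw [if_pos rfl]
      exact eq_coord v rfl
    · intro b _ hb
      rw [if_neg]
      exact fun h => hb (Fin.ext h)
    · simp
  · rw [coord_of_lt _ (by omega)]
    refine Finset.sum_eq_zero fun j _ => if_neg ?_
    omega

/-- The Koszul expression of a frame whose torsion is `T`, for the metric `Re (formB n n ρ)` with
`ρ = lam - conj lam` and `α = d lam`. -/
def koszulForm (n : ℕ) (ρ : ℂ) (αu αv αw : ℂ) (Tuv Tvw Twu u v w : Fin n → ℂ) : ℂ :=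
  n * ((αu - conj αu) * formB n (n - 1) ρ v w + (αv - conj αv) * formB n (n - 1) ρ u w
    - (αw - conj αw) * formB n (n - 1) ρ u v)
  + formB n n ρ Tuv w - formB n n ρ Tvw u + formB n n ρ Twu v

/-- The torsion of the canonical frame, when `d lam = μ • (last coordinate)`. -/
def modelTorsion (μ : ℂ) (u v : Fin n → ℂ) : Fin n → ℂ :=
  (μ * coord u n) • raiseS n v - (μ * coord v n) • raiseS n u

/-- The Koszul expression for `modelTorsion`. -/
def modelKoszul (ρ μ : ℂ) (u v w : Fin n → ℂ) : ℂ :=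
  koszulForm n ρ (μ * coord u n) (μ * coord v n) (μ * coord w n)
    (modelTorsion μ u v) (modelTorsion μ v w) (modelTorsion μ w u) u v w

lemma formB_pred (hn : 1 ≤ n) (ρ : ℂ) (u v : Fin n → ℂ) :
    formB n n ρ u v = formB n (n - 1) ρ (shiftN n u) v + ρ * formB n (n - 1) ρ u v := by
  have := formB_succ (n := n) (n - 1) ρ u v
  rwa [Nat.sub_add_cancel hn] at this

/-- In the commutator with the block, [S, N] cancels the term 2 dλ(u) B(v, w), and its boundary
terms in e_n cancel as well. What S contributes beyond this is dλ(v) times B(Hu, w) + B(u, Hw) -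
B(u, w), plus the same with v and w exchanged. By `formB_degH` this has an overall factor n, because
the exponent of N + ρ is n, and with the derivative of the metric it collapses to the right side. -/
lemma modelKoszul_commutator (hn : 1 ≤ n) (lam μ : ℂ) (u v w : Fin n → ℂ) :
    (2 * (μ * coord u n) * formB n n (lam - conj lam) v w
      + modelKoszul (lam - conj lam) μ u (shiftN n v + lam • v) w
      - modelKoszul (lam - conj lam) μ u v (shiftN n w + lam • w)).re
    = 2 * n * ((μ * coord v n).re * (formB n n (lam - conj lam) u w).re
      + (μ * coord w n).re * (formB n n (lam - conj lam) u v).re) := by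
  have h1 := formB_degH n (lam - conj lam) u w
  have h2 := formB_degH n (lam - conj lam) u v
  set b := formB n (n - 1) (lam - conj lam) u w with hb
  set c := formB n (n - 1) (lam - conj lam) (shiftN n u) w with hc
  set b' := formB n (n - 1) (lam - conj lam) u v with hb'
  set c' := formB n (n - 1) (lam - conj lam) (shiftN n u) v with hc'
  have k1 : formB n n (lam - conj lam) u w = c + (lam - conj lam) * b := formB_pred hn _ _ _
  have k2 : formB n n (lam - conj lam) u v = c' + (lam - conj lam) * b' := formB_pred hn _ _ _
  set x := μ * coord v n with hx
  set y := μ * coord w n with hy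
  have hE : 2 * (μ * coord u n) * formB n n (lam - conj lam) v w
      + modelKoszul (lam - conj lam) μ u (shiftN n v + lam • v) w
      - modelKoszul (lam - conj lam) μ u v (shiftN n w + lam • w)
      = n * (x * (2 * c + (lam - conj lam) * b) + (lam * x - conj (lam * x)) * b
          - (x - conj x) * (c + lam * b))
        + n * (y * (2 * c' + (lam - conj lam) * b') + (lam * y - conj (lam * y)) * b'
          - (y - conj y) * (c' + lam * b')) := by
    simp only [modelKoszul, koszulForm, modelTorsion, coord_add, coord_smul, coord_shiftN_last,
      zero_add, map_add, map_smul, map_sub, LinearMap.add_apply, LinearMap.sub_apply,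
      LinearMap.smul_apply, smul_eq_mul, raiseS_shiftN, ← formB_shiftN, shiftN_raiseS, smul_add,
      map_mul]
    rw [formB_comm _ _ (degH n w) u, formB_comm _ _ (degH n v) u, formB_comm _ _ w v,
      formB_comm _ _ v u, formB_comm _ _ w u, k1, k2]
    rw [k1] at h1
    rw [k2] at h2
    simp only [← hb, ← hc, ← hb', ← hc', hx, hy, map_mul]
    linear_combination x * h1 + y * h2
  rw [hE, k1, k2]
  simp only [Complex.add_re, Complex.mul_re, Complex.sub_re, Complex.natCast_re, Complex.natCast_im,
    Complex.conj_re, Complex.conj_im, Complex.mul_im, Complex.sub_im, Complex.add_im, map_mul,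
    Complex.re_ofNat, Complex.im_ofNat]
  ring

/-- A real bilinear form on `ℂⁿ` with respect to which a nonreal Jordan block is selfadjoint is
symmetric over `ℂ`. -/
lemma bilin_of_jordan_selfadjoint {lam : ℂ} (hlam : lam.im ≠ 0)
    (d : (Fin n → ℂ) →ₗ[ℝ] (Fin n → ℂ) →ₗ[ℝ] ℝ)
    (hd : ∀ v w, d (shiftN n v + lam • v) w = d v (shiftN n w + lam • w)) :
    (∀ (c : ℂ) v w, d (c • v) w = d v (c • w)) ∧
      (∀ v w, d (shiftN n v) w = d v (shiftN n w)) := by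
  have hsm : ∀ (a : ℝ) (c : ℂ) (v : Fin n → ℂ), ((a : ℂ) * c) • v = a • c • v := fun a c v => by
    rw [mul_smul]; rfl
  have hlin : ∀ (c : ℂ) (v : Fin n → ℂ), c • v = c.re • v + c.im • Complex.I • v := fun c v => by
    conv_lhs => rw [← Complex.re_add_im c, add_smul, hsm]
    rfl
  -- f measures the failure of multiplication by i to be selfadjoint for d.
  set f : (Fin n → ℂ) → (Fin n → ℂ) → ℝ := fun v w => d (Complex.I • v) w - d v (Complex.I • w)
    with hf
  have hII : ∀ v : Fin n → ℂ, Complex.I • Complex.I • v = -v := fun v => by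
    rw [smul_smul, Complex.I_mul_I, neg_one_smul]
  have f1 : ∀ v w, f (shiftN n v) w - f v (shiftN n w)
      = 2 * lam.im * f v (Complex.I • w) := fun v w => by
    have e1 := hd (Complex.I • v) w
    have e2 := hd v (Complex.I • w)
    simp only [hlin lam, hII, map_add, map_smul, LinearMap.add_apply, LinearMap.smul_apply, map_neg,
      LinearMap.neg_apply, smul_eq_mul] at e1 e2
    simp only [hf, hII, map_neg]
    linear_combination e1 - e2
  -- Downward induction on a + b. When a + b = 2n, one of the powers of N is zero. Since Im λ ≠ 0,
  -- `f1` expresses f at (a, b) through f at (a + 1, b) and (a, b + 1).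
  have f2 : ∀ m, m ≤ 2 * n → ∀ a b, a + b = 2 * n - m → ∀ v w,
      f ((shiftN n ^ a) v) ((shiftN n ^ b) w) = 0 := by
    intro m
    induction m with
    | zero =>
      intro _ a b hab v w
      have : n ≤ a ∨ n ≤ b := by omega
      rcases this with h | h
      · rw [pow_eq_zero_of_le h shiftN_pow_self]
        simp [hf]
      · rw [pow_eq_zero_of_le h shiftN_pow_self]
        simp [hf]
    | succ m ih =>
      intro hm a b hab v w
      have e := f1 ((shiftN n ^ a) v) ((shiftN n ^ b) (Complex.I • w))
      rw [← Module.End.mul_apply, ← pow_succ', ← Module.End.mul_apply, ← pow_succ',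
        ih (by omega) _ _ (by omega), ih (by omega) _ _ (by omega), map_smul, hII] at e
      have : f ((shiftN n ^ a) v) (-(shiftN n ^ b) w)
          = - f ((shiftN n ^ a) v) ((shiftN n ^ b) w) := by
        simp [hf]; ring
      rw [this] at e
      have h2 : 2 * lam.im ≠ 0 := mul_ne_zero two_ne_zero hlam
      have := (mul_eq_zero.1 (by linarith : 2 * lam.im * -f ((shiftN n ^ a) v) ((shiftN n ^ b) w) = 0))
      rcases this with h | h
      · exact absurd h h2
      · linarith
  have f3 : ∀ v w, d (Complex.I • v) w = d v (Complex.I • w) := fun v w => by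
    have := f2 (2 * n) le_rfl 0 0 (by simp) v w
    exact sub_eq_zero.1 this
  have f4 : ∀ (c : ℂ) v w, d (c • v) w = d v (c • w) := fun c v w => by
    rw [hlin, hlin c w]
    simp [f3]
  refine ⟨f4, fun v w => ?_⟩
  have := hd v w
  simp only [map_add, LinearMap.add_apply, f4] at this
  linarith

/-- The polynomial in the nilpotent Jordan block that maps the last basis vector to `r`. -/
def polyOp (r : Fin n → ℂ) : Module.End ℂ (Fin n → ℂ) :=
  ∑ k : Fin n, r k • shiftN n ^ (n - 1 - k : ℕ)

/-- e_n is cyclic for N, so an operator commuting with N can be read off from its value at e_n. -/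
lemma polyOp_lastVec (r : Fin n → ℂ) : polyOp r (lastVec n) = r := by
  funext i
  have hn : 1 ≤ n := by have := i.2; omega
  simp only [polyOp, LinearMap.sum_apply, Finset.sum_apply, LinearMap.smul_apply, Pi.smul_apply,
    smul_eq_mul]
  have : ∀ k : Fin n, ((shiftN n ^ (n - 1 - k : ℕ)) (lastVec n)) i = if i = k then 1 else 0 := by
    intro k
    rw [← coord_succ ((shiftN n ^ _) _), coord_shiftN_pow _ _ (by omega), coord_lastVec hn]
    congr 1
    rw [Fin.ext_iff, eq_iff_iff]
    omega
  simp [this]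

lemma commute_polyOp (r : Fin n → ℂ) {C : Module.End ℂ (Fin n → ℂ)} (hC : Commute C (shiftN n)) :
    Commute C (polyOp r) :=
  Commute.sum_right _ _ _ fun _ _ => (hC.pow_right _).smul_right _

/-- Two operators commuting with the nilpotent Jordan block agree if they agree on the last
vector. -/
lemma eq_of_commute_shiftN {C D : Module.End ℂ (Fin n → ℂ)} (hC : Commute C (shiftN n))
    (hD : Commute D (shiftN n)) (h : C (lastVec n) = D (lastVec n)) : C = D := by
  refine LinearMap.ext fun v => ?_
  rw [← polyOp_lastVec v, ← Module.End.mul_apply, ← Module.End.mul_apply,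
    (commute_polyOp v hC).eq, (commute_polyOp v hD).eq, Module.End.mul_apply, Module.End.mul_apply,
    h]

/-- Write v and w as polynomials in N applied to e_n; both polynomials move across d, and they
commute. -/
lemma symm_of_jordan_selfadjoint {lam : ℂ} (hlam : lam.im ≠ 0)
    (d : (Fin n → ℂ) →ₗ[ℝ] (Fin n → ℂ) →ₗ[ℝ] ℝ)
    (hd : ∀ v w, d (shiftN n v + lam • v) w = d v (shiftN n w + lam • w)) (v w : Fin n → ℂ) :
    d v w = d w v := by
  obtain ⟨h1, h2⟩ := bilin_of_jordan_selfadjoint hlam d hd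
  have h3 : ∀ (m : ℕ) v w, d ((shiftN n ^ m) v) w = d v ((shiftN n ^ m) w) := by
    intro m
    induction m with
    | zero => simp
    | succ m ih =>
      intro v w
      rw [pow_succ', Module.End.mul_apply, h2, ih, ← Module.End.mul_apply, ← pow_succ, pow_succ']
  have h4 : ∀ r v w, d (polyOp r v) w = d v (polyOp r w) := by
    intro r v w
    simp only [polyOp, LinearMap.sum_apply, map_sum, LinearMap.smul_apply, h1]
    exact Finset.sum_congr rfl fun k _ => by rw [h3, map_smul]
  calc d v w = d (polyOp v (lastVec n)) (polyOp w (lastVec n)) := by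
        rw [polyOp_lastVec, polyOp_lastVec]
    _ = d (polyOp w (lastVec n)) (polyOp v (lastVec n)) := by
        rw [h4, h4, ← Module.End.mul_apply, ← Module.End.mul_apply,
          (commute_polyOp w (commute_polyOp v (Commute.refl _)).symm).eq]
    _ = d w v := by rw [polyOp_lastVec, polyOp_lastVec]

end ModelConnection

/-! ### Uniqueness of the torsion, complex linear covectors and real traces -/

section TorsionUniqueness

variable {n : ℕ}

lemma koszulForm_sub (ρ αu αv αw : ℂ) (T₁ T₂ T₃ S₁ S₂ S₃ u v w : Fin n → ℂ) :
    koszulForm n ρ αu αv αw T₁ T₂ T₃ u v w - koszulForm n ρ αu αv αw S₁ S₂ S₃ u v w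
      = formB n n ρ (T₁ - S₁) w - formB n n ρ (T₂ - S₂) u + formB n n ρ (T₃ - S₃) v := by
  simp only [koszulForm, map_sub, LinearMap.sub_apply]
  ring

/-- A difference of torsions whose contorsion commutes with a nonreal Jordan block vanishes. -/
lemma torsion_eq_zero {lam : ℂ} (hlam : lam.im ≠ 0)
    (X : (Fin n → ℂ) →ₗ[ℝ] (Fin n → ℂ) →ₗ[ℝ] (Fin n → ℂ)) (hX : ∀ u v, X u v = - X v u)
    (h : ∀ u v w : Fin n → ℂ,
      (formB n n (lam - conj lam) (X u (shiftN n v + lam • v)) w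
        - formB n n (lam - conj lam) (X (shiftN n v + lam • v) w) u
        + formB n n (lam - conj lam) (X w u) (shiftN n v + lam • v)).re
      = (formB n n (lam - conj lam) (X u v) (shiftN n w + lam • w)
        - formB n n (lam - conj lam) (X v (shiftN n w + lam • w)) u
        + formB n n (lam - conj lam) (X (shiftN n w + lam • w) u) v).re) : X = 0 := by
  set ρ := lam - conj lam with hρ
  have hρ0 : ρ ≠ 0 := fun h0 => hlam (by
    have := congrArg Complex.im h0
    simp [hρ] at this
    linarith)
  have hsm : ∀ (c : ℝ) (a b : Fin n → ℂ), formB n n ρ (c • a) b = c * formB n n ρ a b :=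
    fun c a b => by
      have := congrArg (fun f => f b) ((formB n n ρ).map_smul (c : ℂ) a)
      exact this
  have hsm' : ∀ (c : ℝ) (a b : Fin n → ℂ), formB n n ρ a (c • b) = c * formB n n ρ a b :=
    fun c a b => (formB n n ρ a).map_smul (c : ℂ) b
  set d : (Fin n → ℂ) → (Fin n → ℂ) →ₗ[ℝ] (Fin n → ℂ) →ₗ[ℝ] ℝ := fun u =>
    LinearMap.mk₂ ℝ (fun v w => (formB n n ρ (X u v) w - formB n n ρ (X v w) u
      + formB n n ρ (X w u) v).re)
      (fun a b c => by simp only [map_add, LinearMap.add_apply, Complex.add_re, Complex.sub_re]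
                       ring)
      (fun r a b => by
        simp only [map_smul, LinearMap.smul_apply, hsm, hsm', Complex.add_re, Complex.sub_re,
          Complex.re_ofReal_mul, smul_eq_mul]
        ring)
      (fun a b c => by simp only [map_add, LinearMap.add_apply, Complex.add_re, Complex.sub_re]
                       ring)
      (fun r a b => by
        simp only [map_smul, LinearMap.smul_apply, hsm, hsm', Complex.add_re, Complex.sub_re,
          Complex.re_ofReal_mul, smul_eq_mul]
        ring) with hd
  have hd' : ∀ u v w, d u v w = (formB n n ρ (X u v) w - formB n n ρ (X v w) u
      + formB n n ρ (X w u) v).re := fun u v w => rfl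
  -- The contorsion `d u` is skew because X is, and symmetric because the block is selfadjoint for
  -- it.
  have h0 : ∀ u v w, d u v w = 0 := by
    intro u v w
    have hs := symm_of_jordan_selfadjoint hlam (d u) (h u) v w
    have ha : d u v w + d u w v = 0 := by
      rw [hd', hd', hX w v, hX w u, hX v u]
      simp only [map_neg, LinearMap.neg_apply, Complex.add_re, Complex.sub_re, Complex.neg_re]
      ring
    linarith
  refine LinearMap.ext fun u => LinearMap.ext fun v => formB_nondegenerate (m := n) hρ0 fun w => ?_
  -- The contorsion determines the torsion: `d u v w - d v u w` is twice the real part of B(X u v,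
  -- w).
  have e1 := h0 u v w
  have e2 := h0 v u w
  rw [hd'] at e1 e2
  rw [hX v u, hX u w, hX w v] at e2
  simp only [map_neg, LinearMap.neg_apply, Complex.add_re, Complex.sub_re, Complex.neg_re] at e1 e2
  linarith

/-- A real linear form on `ℂⁿ` that is complex linear and kills the image of the Jordan block is
a multiple of the last coordinate. -/
lemma eq_mul_last_coord (hn : 1 ≤ n) (β : (Fin n → ℂ) →ₗ[ℝ] ℂ)
    (h1 : ∀ (c : ℂ) v, (c * β v).re = (β (c • v)).re)
    (h2 : ∀ (c : ℂ) v, (β (c • shiftN n v)).re = 0) (v : Fin n → ℂ) :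
    β v = β (lastVec n) * coord v n := by
  have hI : ∀ v, β (Complex.I • v) = Complex.I * β v := fun v => by
    have e1 := h1 Complex.I v
    have e2 := h1 Complex.I (Complex.I • v)
    rw [smul_smul, Complex.I_mul_I, neg_one_smul, map_neg] at e2
    refine Complex.ext e1.symm ?_
    simpa using e2
  have hc : ∀ (c : ℂ) v, β (c • v) = c * β v := fun c v => by
    have : c • v = c.re • v + c.im • Complex.I • v := by
      conv_lhs => rw [← Complex.re_add_im c, add_smul, mul_smul]
      rfl
    rw [this, map_add, map_smul, map_smul, hI]
    conv_rhs => rw [← Complex.re_add_im c]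
    simp only [Complex.real_smul]
    ring
  have hN : ∀ v, β (shiftN n v) = 0 := fun v => by
    have e1 := h2 1 v
    have e2 := h2 Complex.I v
    rw [one_smul] at e1
    rw [hI] at e2
    refine Complex.ext e1 ?_
    simpa using e2
  have hv : v = coord v n • lastVec n + shiftN n (fun i => coord v i) := by
    refine ext_coord fun k hk1 hk2 => ?_
    rw [coord_add, coord_smul, coord_lastVec hn, coord_shiftN _ hk1]
    rcases hk2.lt_or_eq with h | rfl
    · rw [if_neg (by omega), mul_zero, zero_add]
      exact (coord_succ (fun i : Fin n => coord v i) ⟨k, h⟩).symm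
    · rw [coord_of_lt (fun i : Fin k => coord v i) (by omega)]
      simp
  conv_lhs => rw [hv, map_add, hN, hc, add_zero]
  ring

/-- The real trace of multiplication by a complex number. -/
lemma trace_smul_id (c : ℂ) :
    LinearMap.trace ℝ (Fin n → ℂ) ((c • (1 : Module.End ℂ (Fin n → ℂ))).restrictScalars ℝ)
      = 2 * n * c.re := by
  -- Complex conjugation conjugates multiplication by i to its negative, so its real trace vanishes.
  have hI : LinearMap.trace ℝ (Fin n → ℂ)
      ((Complex.I • (1 : Module.End ℂ (Fin n → ℂ))).restrictScalars ℝ) = 0 := by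
    let e : (Fin n → ℂ) ≃ₗ[ℝ] (Fin n → ℂ) :=
      LinearEquiv.piCongrRight fun _ => Complex.conjAe.toLinearEquiv
    have h := LinearMap.trace_conj'
      ((Complex.I • (1 : Module.End ℂ (Fin n → ℂ))).restrictScalars ℝ) e
    have h2 : e.conj ((Complex.I • (1 : Module.End ℂ (Fin n → ℂ))).restrictScalars ℝ)
        = - ((Complex.I • (1 : Module.End ℂ (Fin n → ℂ))).restrictScalars ℝ) := by
      refine LinearMap.ext fun v => funext fun i => ?_
      simp only [LinearEquiv.conj_apply, e]
      simp
      exact Complex.conj_conj (v i)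
    rw [h2, map_neg] at h
    linarith
  have hc : (c • (1 : Module.End ℂ (Fin n → ℂ))).restrictScalars ℝ
      = c.re • LinearMap.id
        + c.im • (Complex.I • (1 : Module.End ℂ (Fin n → ℂ))).restrictScalars ℝ := by
    refine LinearMap.ext fun v => funext fun i => ?_
    simp only [LinearMap.restrictScalars_apply, LinearMap.smul_apply, Module.End.one_apply,
      Pi.smul_apply, smul_eq_mul, LinearMap.add_apply, LinearMap.id_apply, Pi.add_apply,
      Complex.real_smul]
    conv_lhs => rw [← Complex.re_add_im c]
    ring
  have hid : LinearMap.trace ℝ (Fin n → ℂ) LinearMap.id = 2 * n := by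
    rw [LinearMap.trace_id, Module.finrank_pi_fintype]
    simp [mul_comm]
  rw [hc, map_add, map_smul, map_smul, hI, hid]
  simp [mul_comm]

/-- NP is nilpotent, since P commutes with N. -/
lemma trace_shiftN_mul {P : Module.End ℂ (Fin n → ℂ)} (hP : Commute P (shiftN n)) :
    LinearMap.trace ℝ (Fin n → ℂ) ((shiftN n * P).restrictScalars ℝ) = 0 := by
  refine (LinearMap.isNilpotent_trace_of_isNilpotent ⟨n, ?_⟩).eq_zero
  have : (shiftN n * P) ^ n = 0 := by
    rw [hP.symm.mul_pow, shiftN_pow_self, zero_mul]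
  refine LinearMap.ext fun v => ?_
  have h : ∀ m v, (((shiftN n * P).restrictScalars ℝ) ^ m) v = ((shiftN n * P) ^ m) v := by
    intro m
    induction m with
    | zero => simp
    | succ m ih => intro v; rw [pow_succ, pow_succ, Module.End.mul_apply, ih]; rfl
  rw [h, this]
  rfl

end TorsionUniqueness

/-! ### The Levi-Civita connection in an adapted coframe -/

section FrameCalculus

variable {n : ℕ}

lemma hasDerivAt_coord {f : ℝ → Fin n → ℂ} {f' : Fin n → ℂ} {t : ℝ} (hf : HasDerivAt f f' t)
    (k : ℕ) : HasDerivAt (fun s => coord (f s) k) (coord f' k) t :=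
  (((coordLin n k).restrictScalars ℝ).toContinuousLinearMap).hasFDerivAt.comp_hasDerivAt t hf

lemma hasDerivAt_shiftN {f : ℝ → Fin n → ℂ} {f' : Fin n → ℂ} {t : ℝ} (hf : HasDerivAt f f' t) :
    HasDerivAt (fun s => shiftN n (f s)) (shiftN n f') t :=
  (((shiftN n).restrictScalars ℝ).toContinuousLinearMap).hasFDerivAt.comp_hasDerivAt t hf

lemma hasDerivAt_sigmaOp_pow {b : ℝ → Fin n → ℂ} {b' : Fin n → ℂ} {ρ : ℝ → ℂ} {ρ' : ℂ} {t : ℝ}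
    (hb : HasDerivAt b b' t) (hρ : HasDerivAt ρ ρ' t) (m : ℕ) :
    HasDerivAt (fun s => (sigmaOp n (ρ s) ^ m) (b s))
      ((sigmaOp n (ρ t) ^ m) b' + (m * ρ') • (sigmaOp n (ρ t) ^ (m - 1)) (b t)) t := by
  induction m with
  | zero => simpa using hb
  | succ m ih =>
    have h := (hasDerivAt_shiftN ih).add (hρ.smul ih)
    simp only [pow_succ', Module.End.mul_apply, sigmaOp_apply]
    refine h.congr_deriv ?_
    rcases m with _ | m
    · simp [add_assoc]
    · simp only [Nat.add_sub_cancel, pow_succ', Module.End.mul_apply, sigmaOp_apply, map_add,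
        map_smul]
      push_cast
      module

lemma hasDerivAt_pairK {a b : ℝ → Fin n → ℂ} {a' b' : Fin n → ℂ} {t : ℝ}
    (ha : HasDerivAt a a' t) (hb : HasDerivAt b b' t) :
    HasDerivAt (fun s => pairK n (a s) (b s)) (pairK n a' (b t) + pairK n (a t) b') t := by
  simp only [pairK_apply, ← Finset.sum_add_distrib]
  exact HasDerivAt.fun_sum fun i _ => (hasDerivAt_pi.1 ha i).mul (hasDerivAt_pi.1 hb _)

lemma hasDerivAt_formB {a b : ℝ → Fin n → ℂ} {a' b' : Fin n → ℂ} {ρ : ℝ → ℂ} {ρ' : ℂ} {t : ℝ}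
    (ha : HasDerivAt a a' t) (hb : HasDerivAt b b' t) (hρ : HasDerivAt ρ ρ' t) (m : ℕ) :
    HasDerivAt (fun s => formB n m (ρ s) (a s) (b s))
      (formB n m (ρ t) a' (b t) + formB n m (ρ t) (a t) b'
        + m * ρ' * formB n (m - 1) (ρ t) (a t) (b t)) t := by
  simp only [formB_apply]
  refine ((hasDerivAt_pairK ha (hasDerivAt_sigmaOp_pow hb hρ m)).const_mul (-Complex.I)).congr_deriv
    ?_
  simp only [map_add, map_smul, smul_eq_mul]
  ring

lemma hasDerivAt_re {f : ℝ → ℂ} {f' : ℂ} {t : ℝ} (hf : HasDerivAt f f' t) :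
    HasDerivAt (fun s => (f s).re) f'.re t :=
  Complex.reCLM.hasFDerivAt.comp_hasDerivAt t hf

lemma hasDerivAt_conj {f : ℝ → ℂ} {f' : ℂ} {t : ℝ} (hf : HasDerivAt f f' t) :
    HasDerivAt (fun s => conj (f s)) (conj f') t :=
  Complex.conjCLE.toContinuousLinearMap.hasFDerivAt.comp_hasDerivAt t hf

variable {E : Type*} [NormedAddCommGroup E] [NormedSpace ℝ E]

/-- The coframe `θ` at `y` brings the operator `A` and the form `G` to the model form with
eigenvalue `Λ`. -/
structure IsAdaptedAt (G : E → E →L[ℝ] E →L[ℝ] ℝ) (A : E → E →L[ℝ] E)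
    (θ : E → E →L[ℝ] (Fin n → ℂ)) (Λ : E → ℂ) (y : E) : Prop where
  map_op : ∀ v, θ y (A y v) = shiftN n (θ y v) + Λ y • θ y v
  map_form : ∀ v w, G y v w = (formB n n (Λ y - conj (Λ y)) (θ y v) (θ y w)).re

variable {G : E → E →L[ℝ] E →L[ℝ] ℝ} {A : E → E →L[ℝ] E}
    {θ : E → E →L[ℝ] (Fin n → ℂ)} {Λ : E → ℂ} {y : E}

lemma hasDerivAt_line (y u : E) : HasDerivAt (fun t : ℝ => y + t • u) u 0 := by
  simpa using ((hasDerivAt_id (0 : ℝ)).smul_const u).const_add y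

lemma hasDerivAt_comp_line {F : Type*} [NormedAddCommGroup F] [NormedSpace ℝ F] {f : E → F}
    {f' : E →L[ℝ] F} {y : E} (hf : HasFDerivAt f f' y) (u : E) :
    HasDerivAt (fun t : ℝ => f (y + t • u)) (f' u) 0 :=
  HasFDerivAt.comp_hasDerivAt_of_eq (f := fun t : ℝ => y + t • u) (0 : ℝ) hf (hasDerivAt_line y u)
    (by simp)

lemma hasDerivAt_clm_apply_const {F H : Type*} [NormedAddCommGroup F] [NormedSpace ℝ F]
    [NormedAddCommGroup H] [NormedSpace ℝ H] {f : ℝ → F →L[ℝ] H} {f' : F →L[ℝ] H} {t : ℝ}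
    (hf : HasDerivAt f f' t) (v : F) : HasDerivAt (fun s => f s v) (f' v) t := by
  simpa using hf.clm_apply (hasDerivAt_const t v)

lemma eventually_line {p : E → Prop} (h : ∀ᶠ y' in nhds y, p y') (u : E) :
    ∀ᶠ t : ℝ in nhds 0, p (y + t • u) := by
  have : Filter.Tendsto (fun t : ℝ => y + t • u) (nhds 0) (nhds y) := by
    have := (hasDerivAt_line y u).continuousAt
    simpa [ContinuousAt] using this
  exact this.eventually h

/-- The product rule. Besides θ, the form depends on y through (N + ρ)^n with ρ = Λ - conj Λ, whence
the term with `α u - conj (α u)` and the exponent n - 1. -/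
lemma fderiv_form_adapted (hG : DifferentiableAt ℝ G y)
    {Θ : E →L[ℝ] E →L[ℝ] (Fin n → ℂ)} (hθ : HasFDerivAt θ Θ y)
    {α : E →L[ℝ] ℂ} (hΛ : HasFDerivAt Λ α y)
    (h : ∀ᶠ y' in nhds y, IsAdaptedAt G A θ Λ y') (u v w : E) :
    fderiv ℝ G y u v w
      = (formB n n (Λ y - conj (Λ y)) (Θ u v) (θ y w)
        + formB n n (Λ y - conj (Λ y)) (θ y v) (Θ u w)
        + n * (α u - conj (α u)) * formB n (n - 1) (Λ y - conj (Λ y)) (θ y v) (θ y w)).re := by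
  have h1 : HasDerivAt (fun t : ℝ => G (y + t • u) v w) (fderiv ℝ G y u v w) 0 :=
    by
    have a1 := hasDerivAt_comp_line (F := E →L[ℝ] E →L[ℝ] ℝ) hG.hasFDerivAt u
    have a2 := hasDerivAt_clm_apply_const a1 v
    have a3 := hasDerivAt_clm_apply_const a2 w
    exact a3
  have hθ' := hasDerivAt_comp_line hθ u
  have hΛ' := hasDerivAt_comp_line hΛ u
  have hρ : HasDerivAt (fun t : ℝ => Λ (y + t • u) - conj (Λ (y + t • u)))
    (α u - conj (α u)) 0 := hΛ'.sub (hasDerivAt_conj hΛ')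
  have h2 := hasDerivAt_re (hasDerivAt_formB (hasDerivAt_clm_apply_const hθ' v)
    (hasDerivAt_clm_apply_const hθ' w) hρ n)
  have h4 : (fun t : ℝ => G (y + t • u) v w) =ᶠ[nhds 0]
      fun t => (formB n n (Λ (y + t • u) - conj (Λ (y + t • u))) (θ (y + t • u) v)
        (θ (y + t • u) w)).re :=
    (eventually_line h u).mono fun t ht => ht.map_form v w
  rw [h1.unique (h2.congr_of_eventuallyEq h4)]
  simp only [zero_smul, add_zero]

lemma fderiv_op_adapted (hA : DifferentiableAt ℝ A y)
    {Θ : E →L[ℝ] E →L[ℝ] (Fin n → ℂ)} (hθ : HasFDerivAt θ Θ y)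
    {α : E →L[ℝ] ℂ} (hΛ : HasFDerivAt Λ α y)
    (h : ∀ᶠ y' in nhds y, IsAdaptedAt G A θ Λ y') (u v : E) :
    θ y (fderiv ℝ A y u v)
      = shiftN n (Θ u v) + Λ y • Θ u v + α u • θ y v - Θ u (A y v) := by
  have hθ' := hasDerivAt_comp_line hθ u
  have h1 := hθ'.clm_apply (hasDerivAt_clm_apply_const (hasDerivAt_comp_line hA.hasFDerivAt u) v)
  have hθv := hasDerivAt_clm_apply_const hθ' v
  have h2 := (hasDerivAt_shiftN hθv).add ((hasDerivAt_comp_line hΛ u).smul hθv)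
  have h3 := h1.unique (h2.congr_of_eventuallyEq
    ((eventually_line h u).mono fun t ht => ht.map_op v))
  simp only [zero_smul, add_zero] at h3
  rw [eq_sub_iff_add_eq, add_comm, h3]
  abel

lemma two_mul_christoffel (hG : (G y).IsInvertible) (u v w : E) :
    2 * G y (christoffel G y u v) w
      = fderiv ℝ G y u v w + fderiv ℝ G y v u w - fderiv ℝ G y w u v := by
  simp only [christoffel, ContinuousLinearMap.comp_apply]
  rw [ContinuousLinearMap.IsInvertible.self_apply_inverse hG]
  simp

/-- The connection form of a frame, through the Koszul formula. -/
lemma two_mul_christoffel_adapted (hGi : (G y).IsInvertible) (hG : DifferentiableAt ℝ G y)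
    {Θ : E →L[ℝ] E →L[ℝ] (Fin n → ℂ)} (hθ : HasFDerivAt θ Θ y)
    {α : E →L[ℝ] ℂ} (hΛ : HasFDerivAt Λ α y)
    (h : ∀ᶠ y' in nhds y, IsAdaptedAt G A θ Λ y') (u v w : E) :
    2 * G y (christoffel G y u v) w
      = (2 * formB n n (Λ y - conj (Λ y)) (Θ u v) (θ y w)
        + koszulForm n (Λ y - conj (Λ y)) (α u) (α v) (α w) (Θ v u - Θ u v) (Θ w v - Θ v w)
          (Θ u w - Θ w u) (θ y u) (θ y v) (θ y w)).re := by
  rw [two_mul_christoffel hGi, fderiv_form_adapted hG hθ hΛ h, fderiv_form_adapted hG hθ hΛ h,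
    fderiv_form_adapted hG hθ hΛ h, ← Complex.add_re, ← Complex.sub_re]
  congr 1
  simp only [koszulForm, map_sub, LinearMap.sub_apply]
  rw [formB_comm _ _ (θ y v) (Θ u w), formB_comm _ _ (θ y u) (Θ v w),
    formB_comm _ _ (θ y u) (Θ w v)]
  ring

/-- The derivatives Θ u (·) in `fderiv_op_adapted` cancel against those in
`two_mul_christoffel_adapted`; only dΛ and the antisymmetrised Θ, the torsion, survive. -/
lemma two_mul_covDerivEnd_adapted (hGi : (G y).IsInvertible) (hG : DifferentiableAt ℝ G y)
    (hA : DifferentiableAt ℝ A y)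
    {Θ : E →L[ℝ] E →L[ℝ] (Fin n → ℂ)} (hθ : HasFDerivAt θ Θ y)
    {α : E →L[ℝ] ℂ} (hΛ : HasFDerivAt Λ α y)
    (h : ∀ᶠ y' in nhds y, IsAdaptedAt G A θ Λ y') (u v w : E) :
    2 * G y (covDerivEnd G A y u v) w
      = (2 * α u * formB n n (Λ y - conj (Λ y)) (θ y v) (θ y w)
        + koszulForm n (Λ y - conj (Λ y)) (α u) (α (A y v)) (α w) (Θ (A y v) u - Θ u (A y v))
          (Θ w (A y v) - Θ (A y v) w) (Θ u w - Θ w u) (θ y u) (θ y (A y v)) (θ y w)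
        - koszulForm n (Λ y - conj (Λ y)) (α u) (α v) (α (A y w)) (Θ v u - Θ u v)
          (Θ (A y w) v - Θ v (A y w)) (Θ u (A y w) - Θ (A y w) u)
          (θ y u) (θ y v) (θ y (A y w))).re := by
  have hy := h.self_of_nhds
  have e1 := two_mul_christoffel_adapted hGi hG hθ hΛ h u (A y v) w
  have e2 := two_mul_christoffel_adapted hGi hG hθ hΛ h u v (A y w)
  have hsa : ∀ a b, G y (A y a) b = G y a (A y b) := fun a b => by
    rw [hy.map_form, hy.map_form, hy.map_op, hy.map_op]
    simp [formB_shiftN]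
  have e3 : 2 * G y (covDerivEnd G A y u v) w = 2 * G y (fderiv ℝ A y u v) w
      + 2 * G y (christoffel G y u (A y v)) w - 2 * G y (christoffel G y u v) (A y w) := by
    simp only [covDerivEnd, add_apply, sub_apply,
      ContinuousLinearMap.comp_apply, map_add, map_sub, hsa]
    ring
  rw [e3, e1, e2, hy.map_form, fderiv_op_adapted hA hθ hΛ h, hy.map_op w]
  simp only [map_add, map_sub, map_smul, LinearMap.add_apply, LinearMap.sub_apply,
    LinearMap.smul_apply, smul_eq_mul, ← formB_shiftN, Complex.add_re, Complex.sub_re, mul_add,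
    Complex.mul_re, Complex.re_ofNat, Complex.im_ofNat, mul_sub, Complex.mul_im]
  ring

end FrameCalculus

/-! ### The compatibility equation in an adapted coframe -/

section CompatibleFrames

variable {n : ℕ} {E : Type*} [NormedAddCommGroup E] [NormedSpace ℝ E]
  {G : E → E →L[ℝ] E →L[ℝ] ℝ} {A : E → E →L[ℝ] E}
  {θ : E → E →L[ℝ] (Fin n → ℂ)} {Λ : E → ℂ} {y : E}

lemma isInvertible_of_nondegenerate [FiniteDimensional ℝ E] {b : E →L[ℝ] E →L[ℝ] ℝ}
    (h : ∀ u, (∀ v, b u v = 0) → u = 0) : b.IsInvertible := by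
  have hinj : Function.Injective (b : E →ₗ[ℝ] E →L[ℝ] ℝ) :=
    (injective_iff_map_eq_zero _).2 fun u hu => h u fun v => by
      have : b u = 0 := hu
      rw [this]
      rfl
  have hdim : Module.finrank ℝ E = Module.finrank ℝ (E →L[ℝ] ℝ) := by
    rw [← (LinearMap.toContinuousLinearMap (𝕜 := ℝ) (E := E) (F' := ℝ)).finrank_eq]
    exact (Subspace.dual_finrank_eq (K := ℝ) (V := E)).symm
  refine ⟨(LinearEquiv.ofInjectiveOfFinrankEq (b : E →ₗ[ℝ] E →L[ℝ] ℝ) hinj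
    hdim).toContinuousLinearEquiv, ?_⟩
  ext u v
  rfl

lemma formAdjoint_smulRight {b : E →L[ℝ] E →L[ℝ] ℝ} (hb : b.IsInvertible) (τ : E →L[ℝ] ℝ)
    (u v w : E) : b (formAdjoint b (τ.smulRight u) v) w = b v u * τ w := by
  simp only [formAdjoint, ContinuousLinearMap.comp_apply]
  rw [hb.self_apply_inverse]
  simp [mul_comm]

/-- Lowering an index removes the adjoint and the inverse metric, which makes the equation
comparable with the Koszul formula. -/
lemma compatEqAt_iff (hb : (G y).IsInvertible) :
    CompatEqAt G A y ↔ ∀ u v w, 2 * G y (covDerivEnd G A y u v) w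
      = dTrace A y v * G y u w + G y v u * dTrace A y w := by
  have key : ∀ u v w, G y (((1 / 2 : ℝ) • ((dTrace A y).smulRight u
      + formAdjoint (G y) ((dTrace A y).smulRight u))) v) w
      = 1 / 2 * (dTrace A y v * G y u w + G y v u * dTrace A y w) := by
    intro u v w
    have h := formAdjoint_smulRight hb (dTrace A y) u v w
    rw [smul_apply, map_smul, add_apply, map_add, smul_apply, add_apply, h]
    simp
  constructor
  · intro h u v w
    rw [h u, key]
    ring
  · intro h u
    refine ContinuousLinearMap.ext fun v => ?_
    have hinj : Function.Injective (G y) := by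
      obtain ⟨e, he⟩ := hb
      rw [← he]
      exact e.injective
    refine hinj (ContinuousLinearMap.ext fun w => ?_)
    rw [key u v w]
    linarith [h u v w]

lemma trace_of_conj {A : E →ₗ[ℝ] E} {Λ : ℂ} (e : E ≃ₗ[ℝ] (Fin n → ℂ))
    (h : ∀ v, e (A v) = shiftN n (e v) + Λ • e v) :
    LinearMap.trace ℝ E A = 2 * n * Λ.re := by
  rw [← LinearMap.trace_conj' A e, ← trace_smul_id, ← sub_eq_zero, ← map_sub,
    ← trace_shiftN_mul (n := n) (Commute.one_left _)]
  congr 1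
  refine LinearMap.ext fun v => ?_
  simp [LinearEquiv.conj_apply, h]

lemma dTrace_adapted {α : E →L[ℝ] ℂ} (hΛ : HasFDerivAt Λ α y)
    (h : ∀ᶠ y' in nhds y, IsAdaptedAt G A θ Λ y')
    (hb : ∀ᶠ y' in nhds y, Function.Bijective (θ y')) (u : E) :
    dTrace A y u = 2 * n * (α u).re := by
  have h1 : (fun y' => LinearMap.trace ℝ E (A y').toLinearMap)
      =ᶠ[nhds y] fun y' => 2 * n * (Λ y').re := by
    filter_upwards [h, hb] with y' h1 h2
    exact trace_of_conj (LinearEquiv.ofBijective (θ y').toLinearMap h2) h1.map_op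
  have h2 : HasFDerivAt (fun y' => 2 * n * (Λ y').re) ((2 * n : ℝ) • (Complex.reCLM ∘L α)) y :=
    (Complex.reCLM.hasFDerivAt.comp y hΛ).const_mul (2 * n : ℝ)
  rw [dTrace, h1.fderiv_eq, h2.fderiv]
  simp

/-- The structure equations of the canonical coframe imply compatibility. -/
lemma compatEqAt_of_torsion (hn : 1 ≤ n) (hGi : (G y).IsInvertible)
    (hG : DifferentiableAt ℝ G y) (hA : DifferentiableAt ℝ A y)
    {Θ : E →L[ℝ] E →L[ℝ] (Fin n → ℂ)} (hθ : HasFDerivAt θ Θ y)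
    {α : E →L[ℝ] ℂ} (hΛ : HasFDerivAt Λ α y)
    (h : ∀ᶠ y' in nhds y, IsAdaptedAt G A θ Λ y')
    (hb : ∀ᶠ y' in nhds y, Function.Bijective (θ y'))
    {μ : ℂ} (hμ : ∀ u, α u = μ * coord (θ y u) n)
    (hT : ∀ u v, Θ v u - Θ u v = modelTorsion μ (θ y u) (θ y v)) : CompatEqAt G A y := by
  have hy := h.self_of_nhds
  rw [compatEqAt_iff hGi]
  intro u v w
  rw [two_mul_covDerivEnd_adapted hGi hG hA hθ hΛ h]
  simp only [hμ, hT, dTrace_adapted hΛ h hb, hy.map_form, hy.map_op]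
  have := modelKoszul_commutator hn (Λ y) μ (θ y u) (θ y v) (θ y w)
  simp only [modelKoszul] at this
  refine Eq.trans ?_ (this.trans ?_)
  · congr 2
  · rw [formB_comm _ _ (θ y v) (θ y u)]
    simp
    ring

/-- The trace of the compatibility equation against an operator commuting with `A`. -/
lemma trace_compat [FiniteDimensional ℝ E] (hGi : (G y).IsInvertible)
    (hA : DifferentiableAt ℝ A y)
    {Θ : E →L[ℝ] E →L[ℝ] (Fin n → ℂ)} (hθ : HasFDerivAt θ Θ y)
    {α : E →L[ℝ] ℂ} (hΛ : HasFDerivAt Λ α y)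
    (h : ∀ᶠ y' in nhds y, IsAdaptedAt G A θ Λ y')
    (hb : ∀ᶠ y' in nhds y, Function.Bijective (θ y'))
    (hC : CompatEqAt G A y) (e : E ≃ₗ[ℝ] (Fin n → ℂ)) (he : ∀ v, e v = θ y v)
    {P : Module.End ℂ (Fin n → ℂ)} (hP : Commute P (shiftN n)) (u : E) :
    LinearMap.trace ℝ (Fin n → ℂ) ((α u • P).restrictScalars ℝ)
      = 2 * n * (α (e.symm (P (e u)))).re := by
  have hy := h.self_of_nhds
  set p : E →ₗ[ℝ] E := e.symm.toLinearMap ∘ₗ P.restrictScalars ℝ ∘ₗ e.toLinearMap with hp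
  have hep : ∀ v, e (p v) = P (e v) := fun v => by simp [hp]
  have hPN : ∀ v, P (shiftN n v) = shiftN n (P v) := fun v => LinearMap.congr_fun hP.eq v
  have hpA : ∀ v, p (A y v) = A y (p v) := fun v => e.injective (by
    rw [hep, he, hy.map_op, he, hy.map_op, ← he, ← he, hep, map_add, hPN, map_smul])
  -- The commutant of N is ℂ[N], and both N and complex scalars are selfadjoint for the complex
  -- form.
  have hpsa : ∀ v w, G y (p v) w = G y v (p w) := by
    have hB : ∀ a b, formB n n (Λ y - conj (Λ y)) (P a) b
        = formB n n (Λ y - conj (Λ y)) a (P b) := by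
      have hPp : P = polyOp (P (lastVec n)) :=
        eq_of_commute_shiftN hP (commute_polyOp _ (Commute.refl _)).symm
          (polyOp_lastVec _).symm
      have hk : ∀ (m : ℕ) a b, formB n n (Λ y - conj (Λ y)) ((shiftN n ^ m) a) b
        = formB n n (Λ y - conj (Λ y)) a ((shiftN n ^ m) b) := by
        intro m
        induction m with
        | zero => simp
        | succ m ih =>
          intro a b
          rw [pow_succ', Module.End.mul_apply, formB_shiftN, ih, ← Module.End.mul_apply,
            ← pow_succ, pow_succ']
      intro a b
      rw [hPp]
      simp only [polyOp, LinearMap.sum_apply, map_sum, LinearMap.smul_apply, map_smul, hk]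
    intro v w
    rw [hy.map_form, hy.map_form, ← he, ← he, ← he, ← he, hep, hep, hB]
  have hCu := hC u
  set τ := dTrace A y with hτ
  have hτα : ∀ v, τ v = 2 * n * (α v).re := dTrace_adapted hΛ h hb
  -- right hand side
  have hR : LinearMap.trace ℝ E ((((1 / 2 : ℝ) • (τ.smulRight u
      + formAdjoint (G y) (τ.smulRight u)) : E →L[ℝ] E) : E →ₗ[ℝ] E) ∘ₗ p) = τ (p u) := by
    have e1 : ((((1 / 2 : ℝ) • (τ.smulRight u
      + formAdjoint (G y) (τ.smulRight u)) : E →L[ℝ] E) : E →ₗ[ℝ] E) ∘ₗ p)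
      = (1 / 2 : ℝ) • (((τ : E →ₗ[ℝ] ℝ) ∘ₗ p).smulRight u
        + (((G y).flip u : E →ₗ[ℝ] ℝ) ∘ₗ p).smulRight ((G y).inverse τ)) := by
      refine LinearMap.ext fun v => ?_
      have : formAdjoint (G y) (τ.smulRight u) (p v) = G y (p v) u • (G y).inverse τ := by
        rw [← map_smul]
        simp only [formAdjoint, ContinuousLinearMap.comp_apply]
        congr 1
        ext w
        simp [mul_comm]
      simp [this]
    have e2 : G y ((G y).inverse τ) (p u) = τ (p u) := by rw [hGi.self_apply_inverse]
    rw [e1, map_smul, map_add, LinearMap.trace_smulRight, LinearMap.trace_smulRight]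
    simp only [LinearMap.comp_apply, ContinuousLinearMap.coe_coe, ContinuousLinearMap.flip_apply,
      hpsa, e2, smul_eq_mul]
    ring
  -- left hand side
  set ψ : E →ₗ[ℝ] E := e.symm.toLinearMap ∘ₗ (Θ u : E →ₗ[ℝ] (Fin n → ℂ)) with hψ
  have heψ : ∀ v, e (ψ v) = Θ u v := fun v => by simp [hψ]
  set q : E →ₗ[ℝ] E := e.symm.toLinearMap ∘ₗ (α u • P).restrictScalars ℝ ∘ₗ e.toLinearMap with hq
  have heq : ∀ v, e (q v) = α u • P (e v) := fun v => by simp [hq]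
  set Γ : E →ₗ[ℝ] E := (christoffel G y u : E →ₗ[ℝ] E) with hΓ
  set a : E →ₗ[ℝ] E := (A y : E →ₗ[ℝ] E) with ha
  have hpa : p * a = a * p := LinearMap.ext hpA
  -- Up to commutators with `a`, which are traceless, only the variation of the eigenvalue
  -- contributes.
  have hL : ((covDerivEnd G A y u : E →L[ℝ] E) : E →ₗ[ℝ] E) ∘ₗ p
      = q + (a * (ψ * p) - (ψ * p) * a) + ((Γ * p) * a - a * (Γ * p)) := by
    refine LinearMap.ext fun v => ?_
    have e1 : fderiv ℝ A y u (p v) = q v + (a (ψ (p v)) - ψ (p (a v))) := by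
      refine e.injective ?_
      have hav : a v = A y v := rfl
      have haψ : a (ψ (p v)) = A y (ψ (p v)) := rfl
      rw [he, fderiv_op_adapted hA hθ hΛ h, map_add, map_sub, heψ, heq, haψ, he (A y _),
        hy.map_op, ← he (ψ _), heψ, ← he (p v), hep, hav, hpA]
      abel
    simp only [covDerivEnd, LinearMap.comp_apply, ContinuousLinearMap.coe_coe, add_apply,
      sub_apply, ContinuousLinearMap.comp_apply, LinearMap.add_apply, LinearMap.sub_apply,
      Module.End.mul_apply, e1]
    have e2 : A y (p v) = p (a v) := (hpA v).symm
    rw [e2]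
    show _ = q v + (a (ψ (p v)) - ψ (p (a v))) + (christoffel G y u (p (a v))
      - A y (christoffel G y u (p v)))
    abel
  have hLt : LinearMap.trace ℝ E (((covDerivEnd G A y u : E →L[ℝ] E) : E →ₗ[ℝ] E) ∘ₗ p)
      = LinearMap.trace ℝ (Fin n → ℂ) ((α u • P).restrictScalars ℝ) := by
    rw [hL, map_add, map_add, map_sub, map_sub, LinearMap.trace_mul_comm ℝ a (ψ * p),
      LinearMap.trace_mul_comm ℝ a (Γ * p), sub_self, sub_self, add_zero, add_zero,
      ← LinearMap.trace_conj' q e]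
    congr 1
    refine LinearMap.ext fun v => ?_
    simp [LinearEquiv.conj_apply, heq]
  rw [← hLt, hCu, hR, hτα]
  rfl

end CompatibleFrames

/-! ### The structure equations of a compatible pair -/

section StructureEquations

variable {n : ℕ} {E : Type*} [NormedAddCommGroup E] [NormedSpace ℝ E]
  {G : E → E →L[ℝ] E →L[ℝ] ℝ} {A : E → E →L[ℝ] E}
  {θ : E → E →L[ℝ] (Fin n → ℂ)} {Λ : E → ℂ} {y : E}

/-- For a compatible pair the differential of the eigenvalue is a complex multiple of the last
form of an adapted coframe. -/
lemma exists_eigenvalue_differential (hn : 1 ≤ n) [FiniteDimensional ℝ E]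
    (hGi : (G y).IsInvertible) (hA : DifferentiableAt ℝ A y)
    {Θ : E →L[ℝ] E →L[ℝ] (Fin n → ℂ)} (hθ : HasFDerivAt θ Θ y)
    {α : E →L[ℝ] ℂ} (hΛ : HasFDerivAt Λ α y)
    (h : ∀ᶠ y' in nhds y, IsAdaptedAt G A θ Λ y')
    (hb : ∀ᶠ y' in nhds y, Function.Bijective (θ y'))
    (hC : CompatEqAt G A y) : ∃ μ : ℂ, ∀ u, α u = μ * coord (θ y u) n := by
  set e : E ≃ₗ[ℝ] (Fin n → ℂ) := LinearEquiv.ofBijective (θ y).toLinearMap hb.self_of_nhds with he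
  have he' : ∀ v, e v = θ y v := fun v => rfl
  set β : (Fin n → ℂ) →ₗ[ℝ] ℂ := (α : E →ₗ[ℝ] ℂ) ∘ₗ e.symm.toLinearMap with hβ
  have hn' : (2 * n : ℝ) ≠ 0 := by positivity
  -- The test operators c · 1 give complex linearity of dΛ; the operators c · N, whose products with
  -- scalars are traceless, show that dΛ kills the image of N.
  have h1 : ∀ (c : ℂ) v, (c * β v).re = (β (c • v)).re := by
    intro c v
    have h0 := trace_compat hGi hA hθ hΛ h hb hC e he'
      (P := c • 1) ((Commute.one_left _).smul_left c) (e.symm v)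
    rw [smul_smul, trace_smul_id] at h0
    have := mul_left_cancel₀ hn' h0
    simpa [hβ, mul_comm c] using this
  have h2 : ∀ (c : ℂ) v, (β (c • shiftN n v)).re = 0 := by
    intro c v
    have h0 := trace_compat hGi hA hθ hΛ h hb hC e he'
      (P := c • shiftN n) ((Commute.refl _).smul_left c) (e.symm v)
    have h3 : α (e.symm v) • c • shiftN n
        = shiftN n * ((α (e.symm v) * c) • (1 : Module.End ℂ (Fin n → ℂ))) := by
      rw [mul_smul_comm, mul_one, smul_smul]
    rw [h3, trace_shiftN_mul ((Commute.one_left _).smul_left _)] at h0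
    have := (mul_eq_zero.1 h0.symm).resolve_left hn'
    simpa [hβ] using this
  refine ⟨β (lastVec n), fun u => ?_⟩
  rw [← he', ← eq_mul_last_coord hn β h1 h2]
  simp [hβ]

/-- The first structure equation of an adapted coframe of a compatible pair. -/
lemma torsion_of_compatEqAt (hn : 1 ≤ n) (him : (Λ y).im ≠ 0)
    (hGi : (G y).IsInvertible) (hG : DifferentiableAt ℝ G y) (hA : DifferentiableAt ℝ A y)
    {Θ : E →L[ℝ] E →L[ℝ] (Fin n → ℂ)} (hθ : HasFDerivAt θ Θ y)
    {α : E →L[ℝ] ℂ} (hΛ : HasFDerivAt Λ α y)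
    (h : ∀ᶠ y' in nhds y, IsAdaptedAt G A θ Λ y')
    (hb : ∀ᶠ y' in nhds y, Function.Bijective (θ y'))
    (hC : CompatEqAt G A y) {μ : ℂ} (hμ : ∀ u, α u = μ * coord (θ y u) n) (u v : E) :
    Θ v u - Θ u v = modelTorsion μ (θ y u) (θ y v) := by
  have hy := h.self_of_nhds
  set e : E ≃ₗ[ℝ] (Fin n → ℂ) := LinearEquiv.ofBijective (θ y).toLinearMap hb.self_of_nhds with he
  have he' : ∀ v, e v = θ y v := fun v => rfl
  have hes : ∀ a, θ y (e.symm a) = a := fun a => e.apply_symm_apply a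
  have hrs : ∀ (c : ℝ) (a : Fin n → ℂ) k, coord (c • a) k = c * coord a k := fun c a k =>
    coord_smul (c : ℂ) a k
  have hS : ∀ (c : ℝ) (a : Fin n → ℂ), raiseS n (c • a) = c • raiseS n a := fun c a =>
    (raiseS n).map_smul (c : ℂ) a
  -- X is the actual torsion minus the model one, carried to ℂⁿ by θ.
  set X : (Fin n → ℂ) →ₗ[ℝ] (Fin n → ℂ) →ₗ[ℝ] (Fin n → ℂ) := LinearMap.mk₂ ℝ
    (fun a b => Θ (e.symm b) (e.symm a) - Θ (e.symm a) (e.symm b) - modelTorsion μ a b)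
    (fun a a' b => by
      simp only [map_add, add_apply, modelTorsion, coord_add, mul_add, add_smul, smul_add]
      abel)
    (fun c a b => by
      simp only [map_smul, smul_apply, modelTorsion, hrs, hS, smul_sub]
      congr 2
      · rw [mul_left_comm, mul_smul]; rfl
      · rw [smul_comm])
    (fun a b b' => by
      simp only [map_add, add_apply, modelTorsion, coord_add, mul_add, add_smul, smul_add]
      abel)
    (fun c a b => by
      simp only [map_smul, smul_apply, modelTorsion, hrs, hS, smul_sub]
      congr 2
      · rw [smul_comm]
      · rw [mul_left_comm, mul_smul]; rfl) with hX
  have hX' : ∀ a b, X a b = Θ (e.symm b) (e.symm a) - Θ (e.symm a) (e.symm b)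
    - modelTorsion μ a b := fun a b => rfl
  have hX0 : X = 0 := by
    refine torsion_eq_zero him X (fun a b => ?_) (fun a b c => ?_)
    · rw [hX', hX']
      simp only [modelTorsion]
      abel
    · have h1 := (compatEqAt_iff hGi).1 hC (e.symm a) (e.symm b) (e.symm c)
      have hJ : ∀ b, A y (e.symm b) = e.symm (shiftN n b + Λ y • b) := fun b =>
        e.injective (by rw [he', hy.map_op, hes, e.apply_symm_apply])
      rw [two_mul_covDerivEnd_adapted hGi hG hA hθ hΛ h] at h1
      simp only [hμ, dTrace_adapted hΛ h hb, hy.map_form, hJ, hes] at h1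
      -- The model torsion solves the same inhomogeneous equation, so the difference X satisfies the
      -- homogeneous one required by `torsion_eq_zero`.
      have h2 := modelKoszul_commutator hn (Λ y) μ a b c
      rw [formB_comm _ _ b a] at h1
      have h3 : 2 * (n : ℝ) * (μ * coord b n).re * (formB n n (Λ y - conj (Λ y)) a c).re
          + (formB n n (Λ y - conj (Λ y)) a b).re * (2 * n * (μ * coord c n).re)
          = 2 * n * ((μ * coord b n).re * (formB n n (Λ y - conj (Λ y)) a c).re
      + (μ * coord c n).re * (formB n n (Λ y - conj (Λ y)) a b).re) := by ring
      rw [h3, ← h2] at h1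
      simp only [modelKoszul] at h1
      have k1 := congrArg Complex.re (koszulForm_sub (Λ y - conj (Λ y)) (μ * coord a n)
        (μ * coord (shiftN n b + Λ y • b) n) (μ * coord c n)
        (Θ (e.symm (shiftN n b + Λ y • b)) (e.symm a)
          - Θ (e.symm a) (e.symm (shiftN n b + Λ y • b)))
        (Θ (e.symm c) (e.symm (shiftN n b + Λ y • b))
          - Θ (e.symm (shiftN n b + Λ y • b)) (e.symm c))
        (Θ (e.symm a) (e.symm c) - Θ (e.symm c) (e.symm a))
        (modelTorsion μ a (shiftN n b + Λ y • b)) (modelTorsion μ (shiftN n b + Λ y • b) c)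
        (modelTorsion μ c a) a (shiftN n b + Λ y • b) c)
      have k2 := congrArg Complex.re (koszulForm_sub (Λ y - conj (Λ y)) (μ * coord a n)
        (μ * coord b n) (μ * coord (shiftN n c + Λ y • c) n)
        (Θ (e.symm b) (e.symm a) - Θ (e.symm a) (e.symm b))
        (Θ (e.symm (shiftN n c + Λ y • c)) (e.symm b)
          - Θ (e.symm b) (e.symm (shiftN n c + Λ y • c)))
        (Θ (e.symm a) (e.symm (shiftN n c + Λ y • c))
          - Θ (e.symm (shiftN n c + Λ y • c)) (e.symm a))
        (modelTorsion μ a b) (modelTorsion μ b (shiftN n c + Λ y • c))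
        (modelTorsion μ (shiftN n c + Λ y • c) a) a b (shiftN n c + Λ y • c))
      rw [hX', hX', hX', hX', hX', hX', ← k1, ← k2]
      simp only [Complex.add_re, Complex.sub_re] at h1 ⊢
      linarith
  have := congrArg (fun f => f (e u) (e v)) hX0
  simp only [hX', e.symm_apply_apply, LinearMap.zero_apply] at this
  exact sub_eq_zero.1 this

end StructureEquations

/-! ### Square roots in the commutant of the nilpotent block -/

section SquareRoot

open Polynomial

/-- The truncated binomial series of `(1 + X)^(-1/2)`. -/
lemma exists_polynomial_inv_sqrt (n : ℕ) :
    ∃ q : ℂ[X], q.coeff 0 = 1 ∧ (X : ℂ[X]) ^ n ∣ q ^ 2 * (1 + X) - 1 := by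
  induction n with
  | zero => exact ⟨1, by simp, by simp⟩
  | succ n ih =>
    obtain ⟨q, hq, s, hs⟩ := ih
    -- For n = 0 the correction below would change the constant coefficient, so q = 1 is taken
    -- directly.
    rcases Nat.eq_zero_or_pos n with rfl | hn
    · refine ⟨1, by simp, ?_⟩
      simp
    -- `s.coeff 0` is the coefficient of X^n in the error. As q has constant term 1, subtracting
    -- half of it from q removes all of it from q²(1 + X).
    refine ⟨q - C (s.coeff 0 / 2) * X ^ n, ?_, ?_⟩
    · simp [hq, hn.ne]
    · have h1 : (q - C (s.coeff 0 / 2) * X ^ n) ^ 2 * (1 + X) - 1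
          = X ^ n * (s - 2 * C (s.coeff 0 / 2) * q * (1 + X)
            + C (s.coeff 0 / 2) ^ 2 * X ^ n * (1 + X)) := by
        linear_combination hs
      rw [h1, pow_succ]
      refine mul_dvd_mul_left _ (X_dvd_iff.2 ?_)
      have h2 : (2 : ℂ[X]) = C 2 := rfl
      rw [h2]
      simp only [coeff_zero_eq_eval_zero] at hq ⊢
      simp [hq, hn.ne']
      ring

variable {n : ℕ}

/-- The commutant of N consists of polynomials in N. -/
lemma commute_of_commute_shiftN {C D : Module.End ℂ (Fin n → ℂ)} (hC : Commute C (shiftN n))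
    (hD : Commute D (shiftN n)) : Commute C D := by
  have h : D = polyOp (D (lastVec n)) :=
    eq_of_commute_shiftN hD (commute_polyOp _ (Commute.refl _)).symm (polyOp_lastVec _).symm
  rw [h]
  exact commute_polyOp _ hC

lemma eq_coord_smul_lastVec_add (hn : 1 ≤ n) (v : Fin n → ℂ) :
    v = coord v n • lastVec n + shiftN n (fun i => coord v i) := by
  refine ext_coord fun k hk1 hk2 => ?_
  rw [coord_add, coord_smul, coord_lastVec hn, coord_shiftN _ hk1]
  rcases hk2.lt_or_eq with h | rfl
  · rw [if_neg (by omega), mul_zero, zero_add]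
    exact (coord_succ (fun i : Fin n => coord v i) ⟨k, h⟩).symm
  · rw [coord_of_lt (fun i : Fin k => coord v i) (by omega)]
    simp

/-- M is a polynomial in N whose constant term is the last coordinate of M e_n; when that vanishes,
M is divisible by N. -/
lemma pow_eq_zero_of_commute_shiftN (hn : 1 ≤ n) {M : Module.End ℂ (Fin n → ℂ)}
    (hM : Commute M (shiftN n)) (h : coord (M (lastVec n)) n = 0) : M ^ n = 0 := by
  have hp : ∀ r : Fin n → ℂ, Commute (polyOp r) (shiftN n) := fun r =>
    (commute_polyOp r (Commute.refl _)).symm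
  have h1 := eq_coord_smul_lastVec_add hn (M (lastVec n))
  rw [h, zero_smul, zero_add] at h1
  have h2 : M = shiftN n * polyOp (fun i => coord (M (lastVec n)) i) := by
    refine eq_of_commute_shiftN hM ((Commute.refl _).mul_left (hp _)) ?_
    rw [Module.End.mul_apply, polyOp_lastVec]
    exact h1
  rw [h2, (hp _).symm.mul_pow, shiftN_pow_self, zero_mul]

lemma aeval_inv_sqrt {q : ℂ[X]} (hq : (X : ℂ[X]) ^ n ∣ q ^ 2 * (1 + X) - 1)
    {M : Module.End ℂ (Fin n → ℂ)} (hM : M ^ n = 0) :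
    aeval M q * aeval M q * (1 + M) = 1 := by
  obtain ⟨s, hs⟩ := hq
  have := congrArg (aeval M) hs
  simp only [map_sub, map_mul, map_pow, map_add, map_one, aeval_X, hM, zero_mul] at this
  rw [← pow_two]
  exact sub_eq_zero.1 this

/-- The operator `polyOp r` divided by its leading coefficient, minus the identity. -/
def unipPart (r : Fin n → ℂ) : Module.End ℂ (Fin n → ℂ) :=
  (coord r n)⁻¹ • polyOp r - 1

lemma commute_unipPart (r : Fin n → ℂ) : Commute (unipPart r) (shiftN n) :=
  (((commute_polyOp r (Commute.refl _)).symm).smul_left _).sub_left (Commute.one_left _)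

lemma unipPart_pow (hn : 1 ≤ n) {r : Fin n → ℂ} (hr : coord r n ≠ 0) : unipPart r ^ n = 0 := by
  refine pow_eq_zero_of_commute_shiftN hn (commute_unipPart r) ?_
  simp only [unipPart, LinearMap.sub_apply, LinearMap.smul_apply, polyOp_lastVec,
    Module.End.one_apply]
  rw [sub_eq_add_neg, ← neg_one_smul ℂ (lastVec n), coord_add, coord_smul, coord_smul,
    coord_lastVec hn, inv_mul_cancel₀ hr]
  simp

/-- A square root of `(N + ρ)^(-n) * polyOp r`, where `s ^ 2 * ρ ^ n = coord r n` and `q` is the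
truncated series of `(1 + X)^(-1/2)`. -/
def sqrtOp (q : ℂ[X]) (s ρ : ℂ) (r : Fin n → ℂ) : Module.End ℂ (Fin n → ℂ) :=
  s • (aeval (ρ⁻¹ • shiftN n) q ^ n * (aeval (unipPart r) q * (1 + unipPart r)))

lemma commute_aeval_shiftN {M : Module.End ℂ (Fin n → ℂ)} (hM : Commute M (shiftN n)) (q : ℂ[X]) :
    Commute (aeval M q) (shiftN n) := by
  rw [aeval_eq_sum_range]
  exact Commute.sum_left _ _ _ fun _ _ => (hM.pow_left _).smul_left _

lemma commute_sqrtOp (q : ℂ[X]) (s ρ : ℂ) (r : Fin n → ℂ) :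
    Commute (sqrtOp q s ρ r) (shiftN n) :=
  (((commute_aeval_shiftN ((Commute.refl _).smul_left _) q).pow_left n).mul_left
    ((commute_aeval_shiftN (commute_unipPart r) q).mul_left
      ((Commute.one_left _).add_left (commute_unipPart r)))).smul_left s

/-- Here b plays the role of (1 + N/ρ)^(-1/2) and a(1 + m) that of (1 + m)^(1/2). All factors lie in
the commutant of N, so the squares may be taken separately; `hs` matches the scalars. -/
lemma sqrtOp_mul_self (hn : 1 ≤ n) {q : ℂ[X]} (hq : (X : ℂ[X]) ^ n ∣ q ^ 2 * (1 + X) - 1)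
    {s ρ : ℂ} {r : Fin n → ℂ} (hρ : ρ ≠ 0) (hr : coord r n ≠ 0) (hs : s ^ 2 * ρ ^ n = coord r n) :
    sigmaOp n ρ ^ n * (sqrtOp q s ρ r * sqrtOp q s ρ r) = polyOp r := by
  set m := unipPart r with hm
  set m₂ := ρ⁻¹ • shiftN n with hm₂
  have hm₂c : Commute m₂ (shiftN n) := (Commute.refl _).smul_left _
  have hmc : Commute m (shiftN n) := commute_unipPart r
  set a := aeval m q with ha
  set b := aeval m₂ q with hb
  have hac : Commute a (shiftN n) := commute_aeval_shiftN hmc q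
  have hbc : Commute b (shiftN n) := commute_aeval_shiftN hm₂c q
  have hcc : Commute (1 + m) (shiftN n) := (Commute.one_left _).add_left hmc
  have huc : Commute (1 + m₂) (shiftN n) := (Commute.one_left _).add_left hm₂c
  have e1 : a * a * (1 + m) = 1 := aeval_inv_sqrt hq (unipPart_pow hn hr)
  have e2 : b * b * (1 + m₂) = 1 := aeval_inv_sqrt hq (by
    rw [hm₂, _root_.smul_pow, shiftN_pow_self, smul_zero])
  have e3 : sigmaOp n ρ = ρ • (1 + m₂) := by
    rw [hm₂, smul_add, smul_smul, mul_inv_cancel₀ hρ, one_smul, add_comm]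
    rfl
  have e4 : polyOp r = coord r n • (1 + m) := by
    rw [hm, unipPart, add_sub_cancel, smul_smul, mul_inv_cancel₀ hr, one_smul]
  have e5 : b ^ n * b ^ n * (1 + m₂) ^ n = 1 := by
    rw [← (Commute.refl b).mul_pow, ← (commute_of_commute_shiftN (hbc.mul_left hbc) huc).mul_pow,
      e2, one_pow]
  have e6 : (1 + m₂) ^ n * ((b ^ n * (a * (1 + m))) * (b ^ n * (a * (1 + m)))) = 1 + m := by
    have k1 : Commute (a * (1 + m)) (b ^ n) :=
      commute_of_commute_shiftN (hac.mul_left hcc) (hbc.pow_left n)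
    have k2 : Commute ((1 + m₂) ^ n) (b ^ n * b ^ n) :=
      commute_of_commute_shiftN (huc.pow_left n) ((hbc.pow_left n).mul_left (hbc.pow_left n))
    have k3 : Commute (1 + m) a := commute_of_commute_shiftN hcc hac
    rw [k1.mul_mul_mul_comm, ← mul_assoc, k2.eq, e5, one_mul, k3.mul_mul_mul_comm, ← mul_assoc, e1,
      one_mul]
  rw [sqrtOp, e3, _root_.smul_pow, smul_mul_smul_comm, smul_mul_smul_comm, e6, e4, ← hs]
  congr 1
  ring

end SquareRoot

/-! ### Smooth dependence of square roots and eigenvalues -/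

section SmoothFamilies

variable {n : ℕ} {E : Type*} [NormedAddCommGroup E] [NormedSpace ℝ E]

lemma contDiff_coord (k : ℕ) : ContDiff ℝ ∞ fun v : Fin n → ℂ => coord v k :=
  (((coordLin n k).restrictScalars ℝ).toContinuousLinearMap).contDiff

lemma contDiff_endApply (C : Module.End ℂ (Fin n → ℂ)) : ContDiff ℝ ∞ fun v => C v :=
  ((C.restrictScalars ℝ).toContinuousLinearMap).contDiff

/-- A family of operators that preserves smoothness of vector functions. -/
def SmoothOpOn (C : E → Module.End ℂ (Fin n → ℂ)) (W : Set E) : Prop :=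
  ∀ f : E → Fin n → ℂ, ContDiffOn ℝ ∞ f W → ContDiffOn ℝ ∞ (fun y => C y (f y)) W

namespace SmoothOpOn

variable {C D : E → Module.End ℂ (Fin n → ℂ)} {W : Set E}

lemma const (C : Module.End ℂ (Fin n → ℂ)) : SmoothOpOn (fun _ : E => C) W :=
  fun _ hf => (contDiff_endApply C).comp_contDiffOn hf

lemma add (hC : SmoothOpOn C W) (hD : SmoothOpOn D W) : SmoothOpOn (fun y => C y + D y) W :=
  fun f hf => (hC f hf).add (hD f hf)

lemma sub (hC : SmoothOpOn C W) (hD : SmoothOpOn D W) : SmoothOpOn (fun y => C y - D y) W :=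
  fun f hf => (hC f hf).sub (hD f hf)

lemma mul (hC : SmoothOpOn C W) (hD : SmoothOpOn D W) : SmoothOpOn (fun y => C y * D y) W :=
  fun f hf => hC _ (hD f hf)

lemma smul {s : E → ℂ} (hs : ContDiffOn ℝ ∞ s W) (hC : SmoothOpOn C W) :
    SmoothOpOn (fun y => s y • C y) W :=
  fun f hf => hs.smul (hC f hf)

lemma pow (hC : SmoothOpOn C W) (m : ℕ) : SmoothOpOn (fun y => C y ^ m) W := by
  induction m with
  | zero => exact fun f hf => by simpa using hf
  | succ m ih => simpa only [pow_succ] using ih.mul hC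

lemma sum {ι : Type*} {s : Finset ι} {C : ι → E → Module.End ℂ (Fin n → ℂ)}
    (h : ∀ i ∈ s, SmoothOpOn (C i) W) : SmoothOpOn (fun y => ∑ i ∈ s, C i y) W := by
  intro f hf
  simp only [LinearMap.sum_apply]
  exact ContDiffOn.sum fun i hi => h i hi f hf

lemma aeval (hC : SmoothOpOn C W) (q : Polynomial ℂ) :
    SmoothOpOn (fun y => Polynomial.aeval (C y) q) W := by
  simp only [Polynomial.aeval_eq_sum_range]
  exact sum fun i _ => smul contDiffOn_const (hC.pow i)

lemma polyOp {r : E → Fin n → ℂ} (hr : ContDiffOn ℝ ∞ r W) :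
    SmoothOpOn (fun y => polyOp (r y)) W :=
  sum fun k _ => smul (contDiffOn_pi.1 hr k) (const _)

lemma sqrtOp (q : Polynomial ℂ) {s ρ : E → ℂ} {r : E → Fin n → ℂ} (hs : ContDiffOn ℝ ∞ s W)
    (hρ : ContDiffOn ℝ ∞ ρ W) (hρ0 : ∀ y ∈ W, ρ y ≠ 0) (hr : ContDiffOn ℝ ∞ r W)
    (hr0 : ∀ y ∈ W, coord (r y) n ≠ 0) :
    SmoothOpOn (fun y => sqrtOp q (s y) (ρ y) (r y)) W := by
  have h1 : SmoothOpOn (fun y => unipPart (r y)) W :=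
    (smul (((contDiff_coord n).comp_contDiffOn hr).inv hr0) (polyOp hr)).sub (const 1)
  exact smul hs ((((smul (hρ.inv hρ0) (const _)).aeval q).pow n).mul
    ((h1.aeval q).mul ((const 1).add h1)))

end SmoothOpOn

/-- Dividing by `h y₀` brings the values near 1, where the principal logarithm is smooth; a root of
`h y₀` is put back as a factor. -/
lemma exists_smooth_sqrt {W : Set E} (hW : IsOpen W) {y₀ : E} (hy₀ : y₀ ∈ W) {h : E → ℂ}
    (hh : ContDiffOn ℝ ∞ h W) (h0 : h y₀ ≠ 0) :
    ∃ (W' : Set E) (s : E → ℂ), IsOpen W' ∧ y₀ ∈ W' ∧ W' ⊆ W ∧ ContDiffOn ℝ ∞ s W' ∧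
      ∀ y ∈ W', s y ^ 2 = h y ∧ h y ≠ 0 := by
  obtain ⟨s₀, hs₀⟩ := IsAlgClosed.exists_pow_nat_eq (h y₀) (n := 2) two_pos
  have hq : ContDiffOn ℝ ∞ (fun y => h y / h y₀) W := hh.div_const _
  refine ⟨W ∩ (fun y => h y / h y₀) ⁻¹' Complex.slitPlane,
    fun y => s₀ * Complex.exp (Complex.log (h y / h y₀) / 2),
    hq.continuousOn.isOpen_inter_preimage hW Complex.isOpen_slitPlane,
    ⟨hy₀, by simp [h0]⟩, inter_subset_left, ?_, ?_⟩
  · intro y hy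
    have h1 : ContDiffWithinAt ℝ ∞ (fun y => Complex.log (h y / h y₀))
        (W ∩ (fun y => h y / h y₀) ⁻¹' Complex.slitPlane) y :=
      ContDiffAt.comp_contDiffWithinAt (g := Complex.log) (f := fun y => h y / h y₀) y
        ((Complex.contDiffAt_log hy.2).restrict_scalars ℝ) ((hq y hy.1).mono inter_subset_left)
    have h2 : ContDiff ℝ ∞ fun z : ℂ => s₀ * Complex.exp (z / 2) :=
      contDiff_const.mul (Complex.contDiff_exp.comp (contDiff_id.div_const 2))
    exact h2.contDiffAt.comp_contDiffWithinAt y h1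
  · intro y hy
    have hne : h y / h y₀ ≠ 0 := Complex.slitPlane_ne_zero hy.2
    refine ⟨?_, fun h => hne (by simp [h])⟩
    rw [mul_pow, hs₀, ← Complex.exp_nat_mul]
    push_cast
    rw [mul_div_cancel₀ _ (two_ne_zero' ℂ), Complex.exp_log hne, mul_div_cancel₀ _ h0]

/-- The trace of an operator conjugate to `N P + Λ`, with `P` commuting with `N`. -/
lemma trace_of_conj_mul {A : E →ₗ[ℝ] E} {Λ : ℂ} {P : Module.End ℂ (Fin n → ℂ)}
    (hP : Commute P (shiftN n)) (e : E ≃ₗ[ℝ] (Fin n → ℂ))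
    (h : ∀ v, e (A v) = shiftN n (P (e v)) + Λ • e v) :
    LinearMap.trace ℝ E A = 2 * n * Λ.re := by
  rw [← LinearMap.trace_conj' A e, ← trace_smul_id, ← sub_eq_zero, ← map_sub,
    ← trace_shiftN_mul hP]
  congr 1
  refine LinearMap.ext fun v => ?_
  simp [LinearEquiv.conj_apply, h]

lemma contDiffOn_trace [FiniteDimensional ℝ E] {X : Type*} [NormedAddCommGroup X] [NormedSpace ℝ X]
    {B : X → E →L[ℝ] E} {W : Set X} (hB : ContDiffOn ℝ ∞ B W) :
    ContDiffOn ℝ ∞ (fun y => LinearMap.trace ℝ E (B y).toLinearMap) W :=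
  ((LinearMap.trace ℝ E ∘ₗ
    (ContinuousLinearMap.coeLM ℝ : (E →L[ℝ] E) →ₗ[ℝ] E →ₗ[ℝ] E)).toContinuousLinearMap).contDiff
    |>.comp_contDiffOn hB

/-- A continuous nonreal eigenvalue of constant multiplicity of a smooth field of operators is
smooth. -/
lemma contDiffOn_eigenvalue [FiniteDimensional ℝ E] (hn : 1 ≤ n) {W : Set E} (hW : IsOpen W)
    {y₀ : E} (hy₀ : y₀ ∈ W)
    {A : E → E →L[ℝ] E} (hA : ContDiffOn ℝ ∞ A W) {Λ : E → ℂ} (hΛ : ContinuousOn Λ W)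
    (him : ∀ y ∈ W, (Λ y).im ≠ 0)
    (hT : ∀ y ∈ W, ∃ T : E ≃ₗ[ℝ] (Fin n → ℂ), ∀ v, T (A y v) = shiftN n (T v) + Λ y • T v) :
    ∃ W' : Set E, IsOpen W' ∧ y₀ ∈ W' ∧ W' ⊆ W ∧ ContDiffOn ℝ ∞ Λ W' := by
  have hn' : (2 * n : ℝ) ≠ 0 := by positivity
  -- From tr A = 2n Re Λ and tr A² = 2n Re Λ², a is Re Λ and b is (Im Λ)².
  set a : E → ℝ := fun y => LinearMap.trace ℝ E (A y).toLinearMap / (2 * n) with ha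
  set b : E → ℝ := fun y => a y ^ 2 - LinearMap.trace ℝ E (A y ∘L A y).toLinearMap / (2 * n)
    with hb
  have hac : ContDiffOn ℝ ∞ a W := (contDiffOn_trace hA).div_const _
  have hbc : ContDiffOn ℝ ∞ b W :=
    (hac.pow 2).sub ((contDiffOn_trace (hA.clm_comp hA)).div_const _)
  have ha' : ∀ y ∈ W, (Λ y).re = a y := fun y hy => by
    obtain ⟨T, hT⟩ := hT y hy
    have := trace_of_conj (A := (A y).toLinearMap) T hT
    rw [ha]
    simp only [this]
    field_simp
  have hb' : ∀ y ∈ W, (Λ y).im ^ 2 = b y := fun y hy => by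
    obtain ⟨T, hT⟩ := hT y hy
    have h1 := trace_of_conj_mul (A := (A y ∘L A y).toLinearMap) (Λ := Λ y ^ 2)
      (P := shiftN n + (2 * Λ y) • 1)
      ((Commute.refl _).add_left ((Commute.one_left _).smul_left _)) T (fun v => by
        change T (A y (A y v)) = _
        rw [hT, hT]
        simp only [map_add, map_smul, LinearMap.add_apply, LinearMap.smul_apply,
          Module.End.one_apply]
        module)
    rw [hb]
    simp only [h1, ← ha' y hy]
    rw [mul_div_cancel_left₀ _ hn', pow_two (Λ y), Complex.mul_re]
    ring
  -- Traces determine Im Λ only up to sign; continuity of Λ fixes the sign near y₀.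
  set ε : ℝ := (Λ y₀).im / |(Λ y₀).im| with hε
  have him₀ : ContinuousOn (fun y => (Λ y).im * (Λ y₀).im) W :=
    (Complex.continuous_im.comp_continuousOn hΛ).mul continuousOn_const
  refine ⟨W ∩ (fun y => (Λ y).im * (Λ y₀).im) ⁻¹' Ioi 0,
    him₀.isOpen_inter_preimage hW isOpen_Ioi, ⟨hy₀, mul_self_pos.2 (him y₀ hy₀)⟩,
    inter_subset_left, ?_⟩
  have h1 : ContDiffOn ℝ ∞ (fun y => ((a y : ℝ) : ℂ) + ((ε * √(b y) : ℝ) : ℂ) * Complex.I) W := by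
    have h2 : ContDiffOn ℝ ∞ (fun y => √(b y)) W := hbc.sqrt fun y hy => by
      rw [← hb' y hy]
      exact pow_ne_zero 2 (him y hy)
    exact (Complex.ofRealCLM.contDiff.comp_contDiffOn hac).add
      ((Complex.ofRealCLM.contDiff.comp_contDiffOn (contDiffOn_const.mul h2)).mul contDiffOn_const)
  refine (h1.mono inter_subset_left).congr fun y hy => ?_
  have hpos : 0 < (Λ y).im * (Λ y₀).im := hy.2
  refine Complex.ext ?_ ?_
  · simp [ha' y hy.1]
  · simp only [Complex.add_im, Complex.ofReal_im, Complex.mul_im, Complex.ofReal_re, Complex.I_im,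
      Complex.I_re, mul_one, mul_zero, add_zero, zero_add]
    rw [← hb' y hy.1, Real.sqrt_sq_eq_abs, hε]
    rcases (him y₀ hy₀).lt_or_gt with h | h
    · have : (Λ y).im < 0 := by nlinarith
      have h0 := h.ne
      rw [abs_of_neg h, abs_of_neg this]
      field_simp
    · have : 0 < (Λ y).im := by nlinarith
      rw [abs_of_pos h, abs_of_pos this]
      field_simp

end SmoothFamilies

/-! ### A smooth coframe bringing the operator to Jordan form -/

section RawCoframe

variable {n : ℕ} {E : Type*} [NormedAddCommGroup E] [NormedSpace ℝ E]

/-- The operator `η ↦ η ∘ B - κ η` on complex valued real linear forms. -/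
def twist (B : E →L[ℝ] E) (κ : ℂ) : Module.End ℂ (E →L[ℝ] ℂ) where
  toFun η := η ∘L B - κ • η
  map_add' η η' := by ext; simp; ring
  map_smul' c η := by ext; simp; ring

lemma twist_apply (B : E →L[ℝ] E) (κ : ℂ) (η : E →L[ℝ] ℂ) (v : E) :
    twist B κ η v = η (B v) - κ * η v := rfl

lemma commute_twist (B : E →L[ℝ] E) (κ κ' : ℂ) : Commute (twist B κ) (twist B κ') := by
  refine LinearMap.ext fun η => ContinuousLinearMap.ext fun v => ?_
  simp only [Module.End.mul_apply, twist_apply]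
  ring

/-- The scalar part of the block cancels against κ, and precomposition with N remains. This serves
both complex linear η, with κ = λ, and conjugate linear η, with κ = conj λ. -/
lemma twist_pow_of_semilinear {B : E →L[ℝ] E} {lam κ : ℂ} (T : E ≃ₗ[ℝ] (Fin n → ℂ))
    (hT : ∀ v, T (B v) = shiftN n (T v) + lam • T v) {η : E →L[ℝ] ℂ}
    (hη : ∀ w, η (T.symm (lam • w)) = κ * η (T.symm w)) (k : ℕ) (v : E) :
    (twist B κ ^ k) η v = η (T.symm ((shiftN n ^ k) (T v))) := by
  induction k generalizing v with
  | zero => simp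
  | succ k ih =>
    rw [pow_succ', Module.End.mul_apply, twist_apply, ih, ih, hT, map_add, map_smul, map_add,
      map_add, hη, ← Module.End.mul_apply, ← pow_succ]
    ring

lemma twist_pow_of_linear {B : E →L[ℝ] E} {lam κ : ℂ} (T : E ≃ₗ[ℝ] (Fin n → ℂ))
    (hT : ∀ v, T (B v) = shiftN n (T v) + lam • T v) {η : E →L[ℝ] ℂ}
    (φ : (Fin n → ℂ) →ₗ[ℂ] ℂ) (hη : ∀ v, η v = φ (T v)) (k : ℕ) (v : E) :
    (twist B κ ^ k) η v = φ ((sigmaOp n (lam - κ) ^ k) (T v)) := by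
  induction k generalizing v with
  | zero => simp [hη]
  | succ k ih =>
    rw [pow_succ', Module.End.mul_apply, twist_apply, ih, ih, hT, pow_succ, Module.End.mul_apply,
      sigmaOp_apply]
    simp only [map_add, map_smul, smul_eq_mul]
    ring

/-- Through T, split η into a complex linear and a conjugate linear part; each is killed by one of
the two commuting factors. -/
lemma twist_pow_mul_twist_pow [FiniteDimensional ℝ E] {B : E →L[ℝ] E} {lam : ℂ}
    (T : E ≃ₗ[ℝ] (Fin n → ℂ))
    (hT : ∀ v, T (B v) = shiftN n (T v) + lam • T v) (η : E →L[ℝ] ℂ) :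
    (twist B lam ^ n) ((twist B (conj lam) ^ n) η) = 0 := by
  set η' : E →L[ℝ] ℂ := LinearMap.toContinuousLinearMap
    ((η : E →ₗ[ℝ] ℂ) ∘ₗ T.symm.toLinearMap ∘ₗ
      ((Complex.I • (1 : Module.End ℂ (Fin n → ℂ))).restrictScalars ℝ) ∘ₗ T.toLinearMap) with hη'
  have h0 : ∀ w, η' (T.symm w) = η (T.symm (Complex.I • w)) := fun w => by simp [hη']
  have hlin : ∀ (w : Fin n → ℂ), lam • w = lam.re • w + lam.im • Complex.I • w := fun w => by
    conv_lhs => rw [← Complex.re_add_im lam, add_smul, mul_smul]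
    rfl
  have hII : ∀ w : Fin n → ℂ, Complex.I • Complex.I • w = -w := fun w => by
    rw [smul_smul, Complex.I_mul_I, neg_one_smul]
  have hre : lam = lam.re + lam.im * Complex.I := (Complex.re_add_im lam).symm
  have hcj : conj lam = lam.re - lam.im * Complex.I :=
    Complex.ext (by simp) (by simp)
  have h1 : ∀ w, (η - Complex.I • η') (T.symm (lam • w))
      = lam * (η - Complex.I • η') (T.symm w) := fun w => by
    conv_rhs => rw [hre]
    simp only [sub_apply, smul_apply, hlin, map_add, map_smul, h0, hII, map_neg, smul_eq_mul,
      Complex.real_smul]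
    linear_combination (lam.im * η (T.symm (Complex.I • w))) * Complex.I_mul_I
  have h2 : ∀ w, (η + Complex.I • η') (T.symm (lam • w))
      = conj lam * (η + Complex.I • η') (T.symm w) := fun w => by
    rw [hcj]
    simp only [add_apply, smul_apply, hlin, map_add, map_smul, h0, hII, map_neg, smul_eq_mul,
      Complex.real_smul]
    linear_combination (lam.im * η (T.symm (Complex.I • w))) * Complex.I_mul_I
  have k1 : (twist B lam ^ n) (η - Complex.I • η') = 0 := ContinuousLinearMap.ext fun v => by
    rw [twist_pow_of_semilinear T hT h1, shiftN_pow_self]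
    simp
  have k2 : (twist B (conj lam) ^ n) (η + Complex.I • η') = 0 :=
    ContinuousLinearMap.ext fun v => by
      rw [twist_pow_of_semilinear T hT h2, shiftN_pow_self]
      simp
  have hsum : η = (1 / 2 : ℂ) • ((η - Complex.I • η') + (η + Complex.I • η')) := by
    module
  have hcomm : ∀ ζ, (twist B lam ^ n) ((twist B (conj lam) ^ n) ζ)
      = (twist B (conj lam) ^ n) ((twist B lam ^ n) ζ) := fun ζ =>
    LinearMap.congr_fun ((commute_twist B lam (conj lam)).pow_pow n n).eq ζ
  rw [hsum, map_smul, map_smul, map_add, map_add, k2, hcomm, k1, map_zero, map_zero, add_zero]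
  refine ContinuousLinearMap.ext fun v => ?_
  change (1 / 2 : ℂ) * 0 = 0
  rw [mul_zero]

lemma contDiffOn_twist {A : E → E →L[ℝ] E} {κ : E → ℂ} {η : E → E →L[ℝ] ℂ} {W : Set E}
    (hA : ContDiffOn ℝ ∞ A W) (hκ : ContDiffOn ℝ ∞ κ W) (hη : ContDiffOn ℝ ∞ η W) :
    ContDiffOn ℝ ∞ (fun y => twist (A y) (κ y) (η y)) W :=
  (hη.clm_comp hA).sub (hκ.smul hη)

lemma contDiffOn_twist_pow {A : E → E →L[ℝ] E} {κ : E → ℂ} {η : E → E →L[ℝ] ℂ} {W : Set E}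
    (hA : ContDiffOn ℝ ∞ A W) (hκ : ContDiffOn ℝ ∞ κ W) (hη : ContDiffOn ℝ ∞ η W) (k : ℕ) :
    ContDiffOn ℝ ∞ (fun y => (twist (A y) (κ y) ^ k) (η y)) W := by
  induction k with
  | zero => simpa using hη
  | succ k ih =>
    simp only [pow_succ', Module.End.mul_apply]
    exact contDiffOn_twist hA hκ ih

/-- A smooth field of operators conjugate to nonreal Jordan blocks is locally brought to Jordan
form by a smooth coframe. -/
lemma exists_jordan_coframe [FiniteDimensional ℝ E] {W : Set E} (hW : IsOpen W)
    {y₀ : E} (hy₀ : y₀ ∈ W) {A : E → E →L[ℝ] E} (hA : ContDiffOn ℝ ∞ A W)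
    {Λ : E → ℂ} (hΛ : ContDiffOn ℝ ∞ Λ W) (him : ∀ y ∈ W, (Λ y).im ≠ 0)
    (hT : ∀ y ∈ W, ∃ T : E ≃ₗ[ℝ] (Fin n → ℂ), ∀ v, T (A y v) = shiftN n (T v) + Λ y • T v) :
    ∃ (W' : Set E) (θ : E → E →L[ℝ] (Fin n → ℂ)), IsOpen W' ∧ y₀ ∈ W' ∧ W' ⊆ W ∧
      ContDiffOn ℝ ∞ θ W' ∧ (∀ y ∈ W', (θ y).IsInvertible) ∧
      ∀ y ∈ W', ∀ v, θ y (A y v) = shiftN n (θ y v) + Λ y • θ y v := by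
  obtain ⟨T₀, hT₀⟩ := hT y₀ hy₀
  set η₀ : E →L[ℝ] ℂ := LinearMap.toContinuousLinearMap
    (((coordLin n 1).restrictScalars ℝ) ∘ₗ T₀.toLinearMap) with hη₀
  -- Applying (A* - conj Λ)^n to a fixed covector lands smoothly in the generalized Λ-eigenspace of
  -- covectors; powers of A* - Λ then give the rows of a Jordan coframe.
  set ηb : E → E →L[ℝ] ℂ := fun y => (twist (A y) (conj (Λ y)) ^ n) η₀ with hηb
  set θ : E → E →L[ℝ] (Fin n → ℂ) := fun y =>
    ContinuousLinearMap.pi fun k : Fin n => (twist (A y) (Λ y) ^ (k : ℕ)) (ηb y) with hθ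
  have hθk : ∀ y v, ∀ k : Fin n, θ y v k = (twist (A y) (Λ y) ^ (k : ℕ)) (ηb y) v :=
    fun y v k => rfl
  have hcj : ContDiffOn ℝ ∞ (fun y => conj (Λ y)) W :=
    Complex.conjCLE.contDiff.comp_contDiffOn hΛ
  have hθs : ContDiffOn ℝ ∞ θ W := by
    refine contDiffOn_clm_apply.2 fun v => contDiffOn_pi.2 fun k => ?_
    simp only [hθk]
    exact (contDiffOn_twist_pow hA hΛ (contDiffOn_twist_pow hA hcj contDiffOn_const n)
      k).clm_apply contDiffOn_const
  have hθA : ∀ y ∈ W, ∀ v, θ y (A y v) = shiftN n (θ y v) + Λ y • θ y v := by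
    intro y hy v
    obtain ⟨T, hT⟩ := hT y hy
    funext k
    have h1 : θ y (A y v) k = (twist (A y) (Λ y) ^ ((k : ℕ) + 1)) (ηb y) v + Λ y * θ y v k := by
      rw [pow_succ', Module.End.mul_apply, twist_apply, hθk, hθk]
      ring
    have h2 : (twist (A y) (Λ y) ^ ((k : ℕ) + 1)) (ηb y) v = shiftN n (θ y v) k := by
      change _ = coord (θ y v) (k + 2)
      by_cases hk : (k : ℕ) + 1 < n
      · rw [← eq_coord (θ y v) (i := ⟨k + 1, hk⟩) rfl, hθk]
      · rw [coord_of_lt _ (by omega), show (k : ℕ) + 1 = n by omega, hηb]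
        simp only []
        rw [twist_pow_mul_twist_pow T hT]
        rfl
    rw [h1, h2]
    rfl
  -- The choice of `η₀` makes `θ y₀` equal to (N + ρ)^n T₀. Invertibility is an open condition, so
  -- this point suffices.
  have hθ₀ : (θ y₀).IsInvertible := by
    have hform : ∀ v, θ y₀ v = (sigmaOp n (Λ y₀ - conj (Λ y₀)) ^ n) (T₀ v) := by
      intro v
      have h1 : ∀ v, ηb y₀ v = (coordLin n 1 ∘ₗ sigmaOp n (Λ y₀ - conj (Λ y₀)) ^ n) (T₀ v) :=
        fun v => twist_pow_of_linear T₀ hT₀ (coordLin n 1) (fun v => rfl) n v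
      funext k
      rw [hθk, twist_pow_of_linear T₀ hT₀ _ h1, sub_self]
      have h2 : sigmaOp n 0 = shiftN n := by
        refine LinearMap.ext fun v => ?_
        rw [sigmaOp_apply, zero_smul, add_zero]
      rw [h2, LinearMap.comp_apply, coordLin_apply]
      have h3 : (sigmaOp n (Λ y₀ - conj (Λ y₀)) ^ n) ((shiftN n ^ (k : ℕ)) (T₀ v))
          = (shiftN n ^ (k : ℕ)) ((sigmaOp n (Λ y₀ - conj (Λ y₀)) ^ n) (T₀ v)) :=
        LinearMap.congr_fun ((commute_sigmaOp (n := n) _).pow_pow k n).eq.symm (T₀ v)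
      rw [h3, coord_shiftN_pow _ _ le_rfl, add_comm, coord_succ]
    have hρ : Λ y₀ - conj (Λ y₀) ≠ 0 := fun h => him y₀ hy₀ (by
      have := congrArg Complex.im h
      simp at this
      linarith)
    have hinj : Function.Injective (θ y₀ : E →ₗ[ℝ] (Fin n → ℂ)) := by
      intro v w hvw
      have hvw' : θ y₀ v = θ y₀ w := hvw
      rw [hform, hform] at hvw'
      have : Function.Injective (sigmaOp n (Λ y₀ - conj (Λ y₀)) ^ n) := by
        rw [Module.End.coe_pow]
        exact (sigmaOp_injective hρ).iterate n
      exact T₀.injective (this hvw')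
    refine ⟨(LinearEquiv.ofInjectiveOfFinrankEq (θ y₀ : E →ₗ[ℝ] (Fin n → ℂ)) hinj
      T₀.finrank_eq).toContinuousLinearEquiv, ?_⟩
    ext v k
    rfl
  refine ⟨W ∩ θ ⁻¹' {f | f.IsInvertible}, θ,
    hθs.continuousOn.isOpen_inter_preimage hW ?_, ⟨hy₀, hθ₀⟩, inter_subset_left,
    hθs.mono inter_subset_left, fun y hy => hy.2, fun y hy => hθA y hy.1⟩
  exact ContinuousLinearEquiv.isOpen

end RawCoframe

/-! ### Normalising the metric: the canonical coframe -/

section CanonicalCoframe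

variable {n : ℕ} {E : Type*} [NormedAddCommGroup E] [NormedSpace ℝ E]

lemma pairK_of_commute {P : Module.End ℂ (Fin n → ℂ)} (hP : Commute P (shiftN n))
    (u v : Fin n → ℂ) : pairK n (P u) v = pairK n u (P v) := by
  have h : P = polyOp (P (lastVec n)) :=
    eq_of_commute_shiftN hP (commute_polyOp _ (Commute.refl _)).symm (polyOp_lastVec _).symm
  have hk : ∀ (m : ℕ) u v, pairK n ((shiftN n ^ m) u) v = pairK n u ((shiftN n ^ m) v) := by
    intro m
    induction m with
    | zero => simp
    | succ m ih =>
      intro u v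
      rw [pow_succ', Module.End.mul_apply, pairK_shiftN, ih, ← Module.End.mul_apply, ← pow_succ,
        pow_succ']
  rw [h]
  simp only [polyOp, LinearMap.sum_apply, map_sum, LinearMap.smul_apply, map_smul, hk]

lemma commute_polyOp_shiftN (r : Fin n → ℂ) : Commute (polyOp r) (shiftN n) :=
  (commute_polyOp r (Commute.refl _)).symm

/-- C, S and `polyOp` all lie in the commutant of N, so they commute and move across K; a enters as
`polyOp a` applied to e_n, and `polyOp r` applied to e_n gives r back. -/
lemma pairK_sqrt {C S : Module.End ℂ (Fin n → ℂ)} (hC : Commute C (shiftN n))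
    (hS : Commute S (shiftN n)) {r : Fin n → ℂ} (h : S * (C * C) = polyOp r) (a b : Fin n → ℂ) :
    pairK n (C a) (S (C b)) = pairK n r (polyOp a b) := by
  have h1 : C (S (C b)) = polyOp r b := by
    rw [← h, ← Module.End.mul_apply, ← Module.End.mul_apply, ← mul_assoc,
      (commute_of_commute_shiftN hC hS).eq]
  rw [pairK_of_commute hC, h1, ← pairK_of_commute (commute_polyOp_shiftN r)]
  conv_lhs => rw [← polyOp_lastVec a]
  rw [← Module.End.mul_apply,
    (commute_of_commute_shiftN (commute_polyOp_shiftN r) (commute_polyOp_shiftN a)).eq,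
    Module.End.mul_apply, polyOp_lastVec, pairK_of_commute (commute_polyOp_shiftN a)]

/-- The vector representing a real linear form `f` as `Re (-i K(r, ·))`. -/
def reprVec (f : (Fin n → ℂ) → ℝ) : Fin n → ℂ := fun k =>
  Complex.I * (f (Pi.single (Fin.rev k) 1)
    - Complex.I * f (Complex.I • Pi.single (Fin.rev k) 1))

lemma pairK_reprVec (f : (Fin n → ℂ) →ₗ[ℝ] ℝ) (x : Fin n → ℂ) :
    (-Complex.I * pairK n (reprVec f) x).re = f x := by
  have hx : x = ∑ j, ((x j).re • (Pi.single j 1 : Fin n → ℂ)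
      + (x j).im • (Complex.I • (Pi.single j 1 : Fin n → ℂ))) := by
    funext i
    simp [Finset.sum_apply, Pi.single_apply, Finset.sum_add_distrib]
  conv_rhs => rw [hx]
  rw [pairK_apply, map_sum, Finset.mul_sum, Complex.re_sum, ← Equiv.sum_comp Fin.revPerm]
  refine Finset.sum_congr rfl fun j _ => ?_
  simp [reprVec]
  ring

lemma apply_polyOp_comm {lam : ℂ} (hlam : lam.im ≠ 0)
    (d : (Fin n → ℂ) →ₗ[ℝ] (Fin n → ℂ) →ₗ[ℝ] ℝ)
    (hd : ∀ v w, d (shiftN n v + lam • v) w = d v (shiftN n w + lam • w)) (r v w : Fin n → ℂ) :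
    d (polyOp r v) w = d v (polyOp r w) := by
  obtain ⟨h1, h2⟩ := bilin_of_jordan_selfadjoint hlam d hd
  have h3 : ∀ (m : ℕ) v w, d ((shiftN n ^ m) v) w = d v ((shiftN n ^ m) w) := by
    intro m
    induction m with
    | zero => simp
    | succ m ih =>
      intro v w
      rw [pow_succ', Module.End.mul_apply, h2, ih, ← Module.End.mul_apply, ← pow_succ, pow_succ']
  simp only [polyOp, LinearMap.sum_apply, map_sum, LinearMap.smul_apply, h1]
  exact Finset.sum_congr rfl fun k _ => by rw [h3, map_smul]

/-- If r_n = 0 then N^(n-1) r = 0, and the nonzero vector N^(n-1) e_n lies in the kernel of d. -/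
lemma coord_reprVec_ne_zero (hn : 1 ≤ n) {lam : ℂ} (hlam : lam.im ≠ 0)
    (d : (Fin n → ℂ) →ₗ[ℝ] (Fin n → ℂ) →ₗ[ℝ] ℝ)
    (hd : ∀ v w, d (shiftN n v + lam • v) w = d v (shiftN n w + lam • w))
    (hnd : ∀ v, (∀ w, d v w = 0) → v = 0) : coord (reprVec (d (lastVec n))) n ≠ 0 := by
  intro h0
  set r := reprVec (d (lastVec n)) with hr
  have hNr : (shiftN n ^ (n - 1)) r = 0 := by
    refine ext_coord fun k h1 h2 => ?_
    rw [coord_shiftN_pow _ _ h1]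
    rcases h1.lt_or_eq with h | rfl
    · rw [coord_of_lt _ (by omega)]
      exact ((coordLin n k).map_zero).symm
    · rw [show 1 + (n - 1) = n by omega, h0]
      exact ((coordLin n 1).map_zero).symm
  have hz : (shiftN n ^ (n - 1)) (lastVec n) = 0 := by
    refine hnd _ fun a => ?_
    rw [symm_of_jordan_selfadjoint hlam d hd, ← polyOp_lastVec a, apply_polyOp_comm hlam d hd,
      ← pairK_reprVec, ← hr, ← Module.End.mul_apply,
      ((commute_polyOp_shiftN a).pow_right (n - 1)).eq, Module.End.mul_apply,
      ← pairK_of_commute ((Commute.refl (shiftN n)).pow_left (n - 1)), hNr]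
    simp
  have h1 := coord_shiftN_pow (n - 1) (lastVec n) (le_refl 1)
  rw [hz, coord_lastVec hn, if_pos (by omega)] at h1
  exact zero_ne_one (((coordLin n 1).map_zero).symm.trans h1)

lemma sub_conj_ne_zero {lam : ℂ} (h : lam.im ≠ 0) : lam - conj lam ≠ 0 := fun h0 => h (by
  have := congrArg Complex.im h0
  simp at this
  linarith)

/-- The canonical coframe of a form and a selfadjoint field of nonreal Jordan blocks. -/
lemma exists_canonical_coframe [FiniteDimensional ℝ E] (hn : 1 ≤ n) {W : Set E} (hW : IsOpen W)
    {y₀ : E} (hy₀ : y₀ ∈ W) {A : E → E →L[ℝ] E} (hA : ContDiffOn ℝ ∞ A W)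
    {G : E → E →L[ℝ] E →L[ℝ] ℝ} (hG : ContDiffOn ℝ ∞ G W)
    (hnd : ∀ y ∈ W, ∀ u, (∀ v, G y u v = 0) → u = 0)
    (hsa : ∀ y ∈ W, ∀ u v, G y (A y u) v = G y u (A y v))
    {Λ : E → ℂ} (hΛ : ContDiffOn ℝ ∞ Λ W) (him : ∀ y ∈ W, (Λ y).im ≠ 0)
    (hT : ∀ y ∈ W, ∃ T : E ≃ₗ[ℝ] (Fin n → ℂ), ∀ v, T (A y v) = shiftN n (T v) + Λ y • T v) :
    ∃ (W' : Set E) (θ : E → E →L[ℝ] (Fin n → ℂ)), IsOpen W' ∧ y₀ ∈ W' ∧ W' ⊆ W ∧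
      ContDiffOn ℝ ∞ θ W' ∧ (∀ y ∈ W', Function.Bijective (θ y)) ∧
      ∀ y ∈ W', IsAdaptedAt G A θ Λ y := by
  obtain ⟨W₁, θ, hW₁, hy₁, hW₁W, hθ, hθi, hθA⟩ := exists_jordan_coframe hW hy₀ hA hΛ him hT
  set ψ : E → (Fin n → ℂ) →L[ℝ] E := fun y => (θ y).inverse with hψ
  have hψs : ContDiffOn ℝ ∞ ψ W₁ := by
    intro y hy
    obtain ⟨e, he⟩ := hθi y hy
    have h1 : ContDiffAt ℝ ∞ ContinuousLinearMap.inverse (θ y) := by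
      rw [← he]
      exact contDiffAt_map_inverse e
    exact h1.comp_contDiffWithinAt y (hθ y hy)
  have hθψ : ∀ y ∈ W₁, ∀ a, θ y (ψ y a) = a := fun y hy a => (hθi y hy).self_apply_inverse a
  have hψθ : ∀ y ∈ W₁, ∀ a, ψ y (θ y a) = a := fun y hy a => (hθi y hy).inverse_apply_self a
  set d : E → (Fin n → ℂ) →ₗ[ℝ] (Fin n → ℂ) →ₗ[ℝ] ℝ := fun y =>
    LinearMap.mk₂ ℝ (fun a b => G y (ψ y a) (ψ y b)) (by simp) (by simp) (by simp) (by simp)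
    with hd
  have hd' : ∀ y a b, d y a b = G y (ψ y a) (ψ y b) := fun y a b => rfl
  have hAψ : ∀ y ∈ W₁, ∀ a, ψ y (shiftN n a + Λ y • a) = A y (ψ y a) := fun y hy a => by
    have := hθA y hy (ψ y a)
    rw [hθψ y hy] at this
    rw [← this, hψθ y hy]
  have hdJ : ∀ y ∈ W₁, ∀ v w, d y (shiftN n v + Λ y • v) w = d y v (shiftN n w + Λ y • w) :=
    fun y hy v w => by rw [hd', hd', hAψ y hy, hAψ y hy, hsa y (hW₁W hy)]
  have hdnd : ∀ y ∈ W₁, ∀ v, (∀ w, d y v w = 0) → v = 0 := fun y hy v hv => by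
    have h1 := hnd y (hW₁W hy) (ψ y v) fun w => by
      have := hv (θ y w)
      rwa [hd', hψθ y hy] at this
    rw [← hθψ y hy v, h1, map_zero]
  -- r represents the linear form d(e_n, ·), which determines d because d(a, b) = d(e_n, a(N) b).
  set r : E → Fin n → ℂ := fun y => reprVec (d y (lastVec n)) with hr
  have hrs : ContDiffOn ℝ ∞ r W₁ := by
    have hds : ∀ a, ContDiffOn ℝ ∞ (fun y => ((d y (lastVec n) a : ℝ) : ℂ)) W₁ := fun a =>
      Complex.ofRealCLM.contDiff.comp_contDiffOn
        (((hG.mono hW₁W).clm_apply (hψs.clm_apply contDiffOn_const)).clm_apply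
          (hψs.clm_apply contDiffOn_const))
    exact contDiffOn_pi.2 fun k =>
      contDiffOn_const.mul ((hds _).sub (contDiffOn_const.mul (hds _)))
  set ρ : E → ℂ := fun y => Λ y - conj (Λ y) with hρ
  have hρ0 : ∀ y ∈ W, ρ y ≠ 0 := fun y hy => sub_conj_ne_zero (him y hy)
  have hρs : ContDiffOn ℝ ∞ ρ W := hΛ.sub (Complex.conjCLE.contDiff.comp_contDiffOn hΛ)
  -- The scalar part of (N + ρ)^n C² = r(N): the function s must satisfy s² ρ^n = r_n.
  obtain ⟨W₂, s, hW₂, hy₂, hW₂W, hs, hs2⟩ := exists_smooth_sqrt hW₁ hy₁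
    (h := fun y => coord (r y) n * (ρ y ^ n)⁻¹)
    (((contDiff_coord n).comp_contDiffOn hrs).mul (((hρs.mono hW₁W).pow n).inv
      fun y hy => pow_ne_zero n (hρ0 y (hW₁W hy))))
    (mul_ne_zero (coord_reprVec_ne_zero hn (him y₀ hy₀) _ (hdJ y₀ hy₁) (hdnd y₀ hy₁))
      (inv_ne_zero (pow_ne_zero n (hρ0 y₀ hy₀))))
  obtain ⟨q, -, hq⟩ := exists_polynomial_inv_sqrt n
  have hr0 : ∀ y ∈ W₂, coord (r y) n ≠ 0 := fun y hy h => (hs2 y hy).2 (by simp [h])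
  set C : E → Module.End ℂ (Fin n → ℂ) := fun y => sqrtOp q (s y) (ρ y) (r y) with hC
  have hCs : SmoothOpOn C W₂ := SmoothOpOn.sqrtOp q hs (hρs.mono (hW₂W.trans hW₁W))
    (fun y hy => hρ0 y (hW₁W (hW₂W hy))) (hrs.mono hW₂W) hr0
  have hCN : ∀ y, Commute (C y) (shiftN n) := fun y => commute_sqrtOp _ _ _ _
  have hCC : ∀ y ∈ W₂, sigmaOp n (ρ y) ^ n * (C y * C y) = polyOp (r y) := fun y hy =>
    sqrtOp_mul_self hn hq (hρ0 y (hW₁W (hW₂W hy))) (hr0 y hy) (by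
      rw [(hs2 y hy).1, inv_mul_cancel_right₀ (pow_ne_zero n (hρ0 y (hW₁W (hW₂W hy))))])
  have hdC : ∀ y ∈ W₂, ∀ a b, d y a b = (formB n n (ρ y) (C y a) (C y b)).re := by
    intro y hy a b
    rw [formB_apply, pairK_sqrt (hCN y) ((commute_sigmaOp (ρ y)).symm.pow_left n) (hCC y hy),
      pairK_reprVec, ← apply_polyOp_comm (him y (hW₁W (hW₂W hy))) (d y) (hdJ y (hW₂W hy)),
      polyOp_lastVec]
  refine ⟨W₂, fun y => ((C y).restrictScalars ℝ).toContinuousLinearMap ∘L θ y, hW₂, hy₂,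
    hW₂W.trans hW₁W, ?_, ?_, ?_⟩
  · refine contDiffOn_clm_apply.2 fun v => ?_
    exact hCs _ ((hθ.mono hW₂W).clm_apply contDiffOn_const)
  · intro y hy
    have hCinj : Function.Injective ((C y).restrictScalars ℝ) := by
      refine (injective_iff_map_eq_zero _).2 fun a ha => hdnd y (hW₂W hy) a fun w => ?_
      have ha' : C y a = 0 := ha
      rw [hdC y hy, ha']
      simp
    have hCb : Function.Bijective ((C y).restrictScalars ℝ) :=
      ⟨hCinj, LinearMap.injective_iff_surjective.1 hCinj⟩
    have hθb : Function.Bijective (θ y) := by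
      obtain ⟨e, he⟩ := hθi y (hW₂W hy)
      rw [← he]
      exact e.bijective
    exact hCb.comp hθb
  · intro y hy
    refine ⟨fun v => ?_, fun v w => ?_⟩
    · change C y (θ y (A y v)) = shiftN n (C y (θ y v)) + Λ y • C y (θ y v)
      rw [hθA y (hW₂W hy), map_add, map_smul]
      congr 1
      exact LinearMap.congr_fun (hCN y).eq _
    · have := hdC y hy (θ y v) (θ y w)
      rw [hd', hψθ y (hW₂W hy), hψθ y (hW₂W hy)] at this
      exact this

end CanonicalCoframe

/-! ### Integrating the structure equations -/

section Integration

variable {n : ℕ} {E : Type*} [NormedAddCommGroup E] [NormedSpace ℝ E]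

/-- The coordinate `coord · k` as a continuous real linear map. -/
def coordC (n k : ℕ) : (Fin n → ℂ) →L[ℝ] ℂ :=
  ((coordLin n k).restrictScalars ℝ).toContinuousLinearMap

@[simp] lemma coordC_apply (k : ℕ) (v : Fin n → ℂ) : coordC n k v = coord v k := rfl

lemma coord_sub (u v : Fin n → ℂ) (k : ℕ) : coord (u - v) k = coord u k - coord v k :=
  (coordLin n k).map_sub u v

lemma contDiffOn_of_hasFDerivAt {F : Type*} [NormedAddCommGroup F] [NormedSpace ℝ F]
    {W : Set E} (hW : IsOpen W) {f : E → F} {f' : E → E →L[ℝ] F}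
    (h : ∀ y ∈ W, HasFDerivAt f (f' y) y) (hf' : ContDiffOn ℝ ∞ f' W) : ContDiffOn ℝ ∞ f W :=
  (contDiffOn_infty_iff_fderiv_of_isOpen hW).2
    ⟨fun y hy => (h y hy).differentiableAt.differentiableWithinAt,
      hf'.congr fun y hy => (h y hy).fderiv⟩

/-- A coframe that satisfies the structure equations of the canonical coframe is integrated to a
system of coordinates. -/
lemma exists_coordinates_of_torsion [FiniteDimensional ℝ E] {W : Set E} (hW : IsOpen W)
    (hWc : Convex ℝ W) (y₀ : E)
    {θ : E → E →L[ℝ] (Fin n → ℂ)} (hθ : ContDiffOn ℝ ∞ θ W)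
    {Λ : E → ℂ} (hΛ : ContDiffOn ℝ ∞ Λ W) {μ : E → ℂ}
    (hμ : ∀ y ∈ W, ∀ u, fderiv ℝ Λ y u = μ y * coord (θ y u) n)
    (hT : ∀ y ∈ W, ∀ u v, fderiv ℝ θ y v u - fderiv ℝ θ y u v
      = modelTorsion (μ y) (θ y u) (θ y v)) :
    ∃ z : E → Fin n → ℂ, ContDiffOn ℝ ∞ z W ∧ z y₀ = 0 ∧
      ∀ y ∈ W, ∀ u, θ y u = fderiv ℝ z y u + fderiv ℝ Λ y u • raiseS n (z y) := by
  have hdΛ : ContDiffOn ℝ ∞ (fderiv ℝ Λ) W :=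
    ((contDiffOn_infty_iff_fderiv_of_isOpen hW).1 hΛ).2
  -- The coordinates are built one at a time from dζ_{k+1} = θ_{k+1} - k ζ_k dΛ; ζ_0 = 0 is the
  -- convention z_0 = 0.
  have main : ∀ m, m ≤ n → ∃ ζ : ℕ → E → ℂ, ζ 0 = 0 ∧ (∀ k, ζ k y₀ = 0) ∧
      (∀ k ≤ m, ContDiffOn ℝ ∞ (ζ k) W) ∧
      ∀ k < m, ∀ y ∈ W, HasFDerivAt (ζ (k + 1))
        (coordC n (k + 1) ∘L θ y - (k * ζ k y) • fderiv ℝ Λ y) y := by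
    intro m
    induction m with
    | zero =>
      intro _
      refine ⟨fun _ => 0, rfl, fun _ => rfl, fun k _ => contDiffOn_const, fun k hk => ?_⟩
      omega
    | succ m ih =>
      intro hm
      obtain ⟨ζ, h0, hy0, hs, hζ⟩ := ih (by omega)
      set η : E → E →L[ℝ] ℂ := fun y =>
        coordC n (m + 1) ∘L θ y - (m * ζ m y) • fderiv ℝ Λ y with hη
      have hηs : ContDiffOn ℝ ∞ η W :=
        (contDiffOn_const.clm_comp hθ).sub ((contDiffOn_const.mul (hs m le_rfl)).smul hdΛ)
      -- dη = -m dΛ ∧ θ_m - m dζ_m ∧ dΛ, which vanishes because θ_m - dζ_m is a multiple of dΛ.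
      have hclosed : ∀ y ∈ W, ∀ u v, fderiv ℝ η y u v = fderiv ℝ η y v u := by
        intro y hy
        have hyW := hW.mem_nhds hy
        have d1 : HasFDerivAt θ (fderiv ℝ θ y) y :=
          ((hθ.contDiffAt hyW).differentiableAt (by simp)).hasFDerivAt
        have d2 : HasFDerivAt (fderiv ℝ Λ) (fderiv ℝ (fderiv ℝ Λ) y) y :=
          ((hdΛ.contDiffAt hyW).differentiableAt (by simp)).hasFDerivAt
        have d3 : HasFDerivAt (ζ m) (fderiv ℝ (ζ m) y) y :=
          (((hs m le_rfl).contDiffAt hyW).differentiableAt (by simp)).hasFDerivAt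
        have hsymm : ∀ u v, fderiv ℝ (fderiv ℝ Λ) y u v = fderiv ℝ (fderiv ℝ Λ) y v u :=
          fun u v => ((hΛ.contDiffAt hyW).isSymmSndFDerivAt (by
            rw [minSmoothness_of_isRCLikeNormedField]
            exact ENat.LEInfty.out)).eq u v
        have d4 : HasFDerivAt (ζ m)
            (coordC n m ∘L θ y - (((m - 1 : ℕ) : ℂ) * ζ (m - 1) y) • fderiv ℝ Λ y) y ∨ m = 0 := by
          rcases m with _ | m
          · exact Or.inr rfl
          · exact Or.inl (hζ m (by omega) y hy)
        have key : ∀ u v, fderiv ℝ η y u v = coord (fderiv ℝ θ y u v) (m + 1)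
            - m * (fderiv ℝ (ζ m) y u * fderiv ℝ Λ y v
              + ζ m y * fderiv ℝ (fderiv ℝ Λ) y u v) := by
          intro u v
          have e1 := hasDerivAt_comp_line ((hηs.contDiffAt hyW).differentiableAt
            (by simp)).hasFDerivAt u
          have e2 := hasDerivAt_clm_apply_const e1 v
          have e3 := hasDerivAt_coord
            (hasDerivAt_clm_apply_const (hasDerivAt_comp_line d1 u) v) (m + 1)
          have e4 := (((hasDerivAt_comp_line d3 u).const_mul (m : ℂ)).mul
            (hasDerivAt_clm_apply_const (hasDerivAt_comp_line d2 u) v))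
          have e5 := e2.unique (e3.sub e4)
          rw [e5]
          simp only [zero_smul, add_zero]
          ring
        intro u v
        rw [key, key, hsymm u v]
        have ht := congrArg (fun x => coord x (m + 1)) (hT y hy u v)
        simp only [modelTorsion, coord_sub, coord_smul, coord_raiseS _ hm, ← hμ y hy] at ht
        have hz : (m : ℂ) * fderiv ℝ (ζ m) y u * fderiv ℝ Λ y v
            - m * fderiv ℝ (ζ m) y v * fderiv ℝ Λ y u
            = m * (coord (θ y u) m * fderiv ℝ Λ y v - coord (θ y v) m * fderiv ℝ Λ y u) := by
          rcases d4 with d4 | rfl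
          · rw [d4.fderiv]
            simp only [sub_apply, ContinuousLinearMap.comp_apply, coordC_apply, smul_apply,
              smul_eq_mul]
            ring
          · simp
        linear_combination -ht - hz
      obtain ⟨f, hf⟩ := hWc.exists_forall_hasFDerivAt_of_fderiv_symmetric hW
        (hηs.differentiableOn (by simp)) hclosed
      -- The constant is chosen so that the coordinates vanish at y₀; there dz will equal θ.
      have hf' : ∀ y ∈ W, HasFDerivAt (fun y => f y - f y₀) (η y) y := fun y hy =>
        (hf y hy).sub_const _
      refine ⟨fun k => if k = m + 1 then fun y => f y - f y₀ else ζ k, ?_, ?_, ?_, ?_⟩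
      · beta_reduce
        rw [if_neg (by omega), h0]
      · intro k
        beta_reduce
        split_ifs
        · exact sub_self _
        · exact hy0 k
      · intro k hk
        beta_reduce
        split_ifs with h
        · exact contDiffOn_of_hasFDerivAt hW hf' hηs
        · exact hs k (by omega)
      · intro k hk y hy
        beta_reduce
        rcases (Nat.lt_succ_iff.1 hk).lt_or_eq with h | rfl
        · rw [if_neg (by omega), if_neg (by omega)]
          exact hζ k h y hy
        · rw [if_pos rfl, if_neg (by omega)]
          exact hf' y hy
  obtain ⟨ζ, h0, hy0, hs, hζ⟩ := main n le_rfl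
  have hc : ∀ y k, k ≤ n → coord (fun i : Fin n => ζ (i + 1) y) k = ζ k y := by
    intro y k hk
    rcases k with _ | k
    · rw [coord_zero, h0]
      rfl
    · exact coord_succ (fun i : Fin n => ζ (i + 1) y) ⟨k, hk⟩
  refine ⟨fun y i => ζ (i + 1) y, contDiffOn_pi.2 fun i => hs _ i.2, funext fun i => hy0 _, ?_⟩
  intro y hy u
  funext i
  have h1 : HasFDerivAt (fun y (i : Fin n) => ζ (i + 1) y) (ContinuousLinearMap.pi fun i : Fin n =>
      coordC n (i + 1) ∘L θ y - ((i : ℕ) * ζ i y) • fderiv ℝ Λ y) y :=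
    hasFDerivAt_pi.2 fun i => hζ i i.2 y hy
  rw [h1.fderiv]
  have h2 : raiseS n (fun i : Fin n => ζ (i + 1) y) i = i * ζ i y := by
    rw [← hc y i i.2.le]
    rfl
  simp only [Pi.add_apply, Pi.smul_apply, ContinuousLinearMap.pi_apply, sub_apply,
    ContinuousLinearMap.comp_apply, coordC_apply, smul_apply, smul_eq_mul, coord_succ, h2]
  ring

end Integration

/-! ### The matrices of the normal form in terms of the coframe -/

section NormalFormIdentities

variable {n : ℕ}

/-- The canonical coframe of the normal form, as a field of operators. -/
def frameP (ℓ : ℂ → ℂ) (z : Fin n → ℂ) : Module.End ℂ (Fin n → ℂ) :=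
  1 + (deriv ℓ (coord z n) • coordLin n n).smulRight (raiseS n z)

lemma frameP_apply (ℓ : ℂ → ℂ) (z v : Fin n → ℂ) :
    frameP ℓ z v = v + (deriv ℓ (coord z n) * coord v n) • raiseS n z := rfl

lemma opOf_apply (A : Matrix (Fin n) (Fin n) ℂ) (v : Fin n → ℂ) : opOf A v = A *ᵥ v := rfl

lemma reFormOf_apply (B : Matrix (Fin n) (Fin n) ℂ) (u v : Fin n → ℂ) :
    reFormOf B u v = (u ⬝ᵥ B *ᵥ v).re := rfl

/-- For k < n, `aFun` at k is the k-th coordinate of N(e_n + ℓ' Sz): NSz has k-th coordinate k z_k,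
and N e_n accounts for the 1 at k = n - 1. -/
lemma LC_mulVec (ℓ : ℂ → ℂ) (z v : Fin n → ℂ) :
    LC ℓ z *ᵥ v = ℓ (coord z n) • v + shiftN n (frameP ℓ z v) := by
  funext i
  have hi := i.2
  have h : ∀ j, LC ℓ z i j * v j = (if i = j then ℓ (coord z n) * v j else 0)
      + ((if (j : ℕ) = i + 1 then v j else 0)
        + if (j : ℕ) = n - 1 then (if (i : ℕ) + 1 < n then
          ((i : ℂ) + 1) * deriv ℓ (coord z n) * coord z (i + 1) * v j else 0) else 0) := by
    intro j
    have hj := j.2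
    simp only [LC, Matrix.of_apply, aFun]
    by_cases h1 : i = j
    · subst h1
      simp
      intro h2 h3
      omega
    · have h1' : (i : ℕ) ≠ j := fun h => h1 (Fin.ext h)
      by_cases h2 : (j : ℕ) = n - 1
      · by_cases h3 : (i : ℕ) + 1 = n - 1
        · have h4 : (j : ℕ) = i + 1 := by omega
          have h5 : (i : ℕ) + 1 < n := by omega
          simp only [if_neg h1, if_pos h2, if_pos h3, if_pos h4, if_pos h5]
          push_cast
          ring
        · have h4 : ¬ (j : ℕ) = i + 1 := by omega
          have h5 : (i : ℕ) + 1 < n := by omega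
          simp only [if_neg h1, if_pos h2, if_neg h3, if_neg h4, if_pos h5]
          push_cast
          ring
      · simp [h1, h2]
  simp only [Matrix.mulVec, dotProduct, h, Finset.sum_add_distrib, Finset.sum_ite_eq,
    Finset.mem_univ, if_true, Pi.add_apply, Pi.smul_apply, smul_eq_mul]
  congr 1
  have hr : shiftN n (frameP ℓ z v) i = coord (shiftN n (frameP ℓ z v)) (i + 1) :=
    (coord_succ _ i).symm
  rw [hr, coord_shiftN _ (by omega), frameP_apply, coord_add, coord_smul]
  by_cases hlt : (i : ℕ) + 1 < n
  · rw [coord_raiseS _ (by omega), Finset.sum_eq_single ⟨i + 1, hlt⟩,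
      Finset.sum_eq_single ⟨n - 1, by omega⟩]
    · simp only [if_true, if_pos hlt]
      rw [eq_coord v (i := ⟨i + 1, hlt⟩) rfl,
        eq_coord v (i := ⟨n - 1, by omega⟩) (k := n) (by simp only []; omega)]
      push_cast
      ring
    · intro b _ hb
      exact if_neg fun h => hb (Fin.ext h)
    · simp
    · intro b _ hb
      exact if_neg fun h => hb (Fin.ext h)
    · simp
  · rw [coord_of_lt v (by omega : n < (i : ℕ) + 1 + 1),
      coord_of_lt (raiseS n z) (by omega : n < (i : ℕ) + 1 + 1)]
    simp only [if_neg hlt, ite_self, Finset.sum_const_zero, mul_zero, add_zero]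
    refine Finset.sum_eq_zero fun j _ => if_neg ?_
    omega

/-- `frameP` differs from the identity only through the last coordinate, so it fixes the image of N.
-/
lemma frameP_LC (ℓ : ℂ → ℂ) (z v : Fin n → ℂ) :
    frameP ℓ z (LC ℓ z *ᵥ v) = shiftN n (frameP ℓ z v) + ℓ (coord z n) • frameP ℓ z v := by
  rw [frameP_apply ℓ z (LC ℓ z *ᵥ v), LC_mulVec, coord_add, coord_shiftN_last, coord_smul]
  conv_rhs => rw [frameP_apply ℓ z v, ← frameP_apply ℓ z v]
  rw [frameP_apply ℓ z v]
  module

/-- The matrix is PᵀKP. The terms linear in ℓ' fill the last row and column; for n > 1 the corner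
keeps only ℓ'² K(Sz, Sz), since the first entry of Sz is zero. -/
lemma antiC_entry (ℓ : ℂ → ℂ) (z : Fin n → ℂ) (i j : Fin n) :
    antiC ℓ z i j = pairK n (frameP ℓ z (Pi.single i 1)) (frameP ℓ z (Pi.single j 1)) := by
  have hi := i.2
  have hj := j.2
  have hs : ∀ i : Fin n, coord (Pi.single i 1 : Fin n → ℂ) n = if (i : ℕ) = n - 1 then 1 else 0 := by
    intro i
    rw [← eq_coord (Pi.single i 1 : Fin n → ℂ) (i := ⟨n - 1, by omega⟩) (k := n)
      (by simp only []; omega), Pi.single_apply]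
    congr 1
    rw [Fin.ext_iff]
    exact propext eq_comm
  have hS : ∀ i : Fin n, raiseS n z (Fin.rev i)
      = ((n - 1 - i : ℕ) : ℂ) * coord z (n - 1 - i) := by
    intro i
    have h : ((Fin.rev i : Fin n) : ℕ) = n - 1 - i := by
      rw [Fin.val_rev]
      omega
    rw [← h]
    rfl
  have hpp : pairK n (raiseS n z) (raiseS n z) = ∑ k ∈ Finset.range n,
      ((k : ℂ) * coord z k) * (((n - 1 - k : ℕ) : ℂ) * coord z (n - 1 - k)) := by
    rw [pairK_apply, Finset.sum_range]
    exact Finset.sum_congr rfl fun k _ => by rw [hS]; rfl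
  have hee : pairK n (Pi.single i 1) (Pi.single j 1) = if (i : ℕ) + j + 1 = n then 1 else 0 := by
    rw [pairK_single, Pi.single_apply]
    congr 1
    rw [Fin.ext_iff, Fin.val_rev, eq_iff_iff]
    omega
  simp only [frameP_apply, map_add, map_smul, LinearMap.add_apply, LinearMap.smul_apply,
    smul_eq_mul, hs, pairK_single, hS, hee, pairK_comm (Pi.single i 1) (raiseS n z), hpp]
  simp only [antiC, Matrix.of_apply]
  by_cases h1 : (i : ℕ) = n - 1
  · by_cases h2 : (j : ℕ) = n - 1
    · simp only [h1, h2, and_self, if_true]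
      by_cases h3 : n = 1
      · subst h3
        simp [aFun]
      -- The additional indices k = 0 and k = n - 1 contribute nothing, and for 1 ≤ k ≤ n - 2 the
      -- exceptional 1 in `aFun` does not occur.
      · have hsum : ∑ k ∈ Finset.Icc 1 (n - 2), aFun ℓ z k * aFun ℓ z (n - 1 - k)
            = ∑ k ∈ Finset.range n, (deriv ℓ (coord z n)) ^ 2 *
              (((k : ℂ) * coord z k) * (((n - 1 - k : ℕ) : ℂ) * coord z (n - 1 - k))) := by
          refine Eq.trans (Finset.sum_congr rfl fun k hk => ?_) (Finset.sum_subset ?_ ?_)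
          · have := Finset.mem_Icc.1 hk
            rw [aFun, aFun, if_neg (by omega), if_neg (by omega)]
            ring
          · intro k hk
            have := Finset.mem_Icc.1 hk
            exact Finset.mem_range.2 (by omega)
          · intro k hk hk'
            have h4 := Finset.mem_range.1 hk
            rw [Finset.mem_Icc] at hk'
            have : k = 0 ∨ k = n - 1 := by omega
            rcases this with rfl | rfl
            · simp
            · simp
        rw [if_neg h3, if_neg (by omega), hsum, ← Finset.mul_sum]
        simp
        ring
    · simp only [h1, h2, and_false, if_false, if_true]
      rw [aFun]
      have : (n - 1 - (j : ℕ) = n - 1) ↔ n - 1 + (j : ℕ) + 1 = n := by omega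
      simp only [this]
      ring
  · by_cases h2 : (j : ℕ) = n - 1
    · simp only [h1, h2, false_and, if_false, if_true]
      rw [aFun]
      have : (n - 1 - (i : ℕ) = n - 1) ↔ (i : ℕ) + (n - 1) + 1 = n := by omega
      simp only [this]
      ring
    · simp [h1, h2]

lemma dotProduct_antiC (ℓ : ℂ → ℂ) (z u v : Fin n → ℂ) :
    u ⬝ᵥ antiC ℓ z *ᵥ v = pairK n (frameP ℓ z u) (frameP ℓ z v) := by
  have hx : ∀ x : Fin n → ℂ, frameP ℓ z x = ∑ i, x i • frameP ℓ z (Pi.single i 1) := fun x => by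
    rw [LinearMap.pi_apply_eq_sum_univ]
    refine Finset.sum_congr rfl fun i _ => ?_
    congr 2
    funext j
    simp [Pi.single_apply, eq_comm]
  rw [hx u, hx v]
  simp only [map_sum, LinearMap.sum_apply, map_smul, LinearMap.smul_apply, smul_eq_mul,
    ← antiC_entry, dotProduct, Matrix.mulVec, Finset.mul_sum]
  rw [Finset.sum_comm]
  refine Finset.sum_congr rfl fun i _ => Finset.sum_congr rfl fun j _ => ?_
  ring

lemma frameP_LC_sub_pow (ℓ : ℂ → ℂ) (z : Fin n → ℂ) (κ : ℂ) (m : ℕ) (v : Fin n → ℂ) :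
    frameP ℓ z ((LC ℓ z - κ • (1 : Matrix (Fin n) (Fin n) ℂ)) ^ m *ᵥ v)
      = (sigmaOp n (ℓ (coord z n) - κ) ^ m) (frameP ℓ z v) := by
  induction m generalizing v with
  | zero => simp
  | succ m ih =>
    rw [pow_succ, ← Matrix.mulVec_mulVec, ih, pow_succ, Module.End.mul_apply, Matrix.sub_mulVec,
      map_sub, frameP_LC, Matrix.smul_mulVec, Matrix.one_mulVec, map_smul, sigmaOp_apply]
    congr 1
    module

lemma dotProduct_gC (ℓ : ℂ → ℂ) (z u v : Fin n → ℂ) :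
    u ⬝ᵥ gC ℓ z *ᵥ v = formB n n (ℓ (coord z n) - conj (ℓ (coord z n)))
      (frameP ℓ z u) (frameP ℓ z v) := by
  rw [gC, Matrix.smul_mulVec, dotProduct_smul, ← Matrix.mulVec_mulVec, dotProduct_antiC,
    frameP_LC_sub_pow, formB_apply, smul_eq_mul]

lemma realOp_sum (A : Matrix (Fin n) (Fin n) ℂ) (b : Fin n × Fin 2) :
    A *ᵥ (Pi.single b.1 (![1, Complex.I] b.2))
      = ∑ a, realOp A a b • (Pi.single a.1 (![1, Complex.I] a.2) : Fin n → ℂ) := by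
  obtain ⟨b, ε⟩ := b
  rw [Fintype.sum_prod_type]
  funext i
  simp only [Fin.sum_univ_two, Finset.sum_apply, Pi.add_apply, Pi.smul_apply, Pi.single_apply,
    realOp, Matrix.of_apply, Complex.real_smul]
  rw [Finset.sum_eq_single i (fun j _ hj => by simp [hj.symm]) (by simp)]
  simp only [Matrix.mulVec_single, Pi.smul_apply]
  fin_cases ε
  · simp
  · simp
    rw [mul_comm]
    nth_rewrite 1 [← Complex.re_add_im (A i b)]
    linear_combination (A i b).im * Complex.I_mul_I

lemma realForm_eq (B : Matrix (Fin n) (Fin n) ℂ) (a b : Fin n × Fin 2) :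
    reFormOf B (Pi.single a.1 (![1, Complex.I] a.2)) (Pi.single b.1 (![1, Complex.I] b.2))
      = realForm B a b := by
  obtain ⟨a, ε⟩ := a
  obtain ⟨b, δ⟩ := b
  rw [reFormOf_apply]
  simp only [Matrix.mulVec_single, single_dotProduct, realForm, Matrix.of_apply, Pi.smul_apply]
  fin_cases ε <;> fin_cases δ <;> simp

end NormalFormIdentities

/-! ### Normal coordinates on an open subset of a vector space -/

section LocalNormalForm

variable {n : ℕ} {E : Type*} [NormedAddCommGroup E] [NormedSpace ℝ E]

/-- The inverse function theorem, with a ball as the target of the local diffeomorphism. -/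
lemma exists_localDiffeomorph_ball {F : Type*} [NormedAddCommGroup F] [NormedSpace ℝ F]
    [CompleteSpace E] [CompleteSpace F] {W : Set E} (hW : IsOpen W) {y₀ : E} (hy₀ : y₀ ∈ W)
    {z : E → F}
    (hz : ContDiffOn ℝ ∞ z W) (hi : (fderiv ℝ z y₀).IsInvertible) :
    ∃ (φ : OpenPartialHomeomorph E F) (r : ℝ), 0 < r ∧ (∀ y, φ y = z y) ∧ y₀ ∈ φ.source ∧
      φ.source ⊆ W ∧ φ.target = Metric.ball (z y₀) r ∧ ContDiffOn ℝ ∞ φ.symm φ.target := by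
  obtain ⟨e, he⟩ := hi
  have hz₀ : ContDiffAt ℝ ∞ z y₀ := hz.contDiffAt (hW.mem_nhds hy₀)
  have hd₀ : HasFDerivAt z (e : E →L[ℝ] F) y₀ := by
    rw [he]
    exact (hz₀.differentiableAt (by simp)).hasFDerivAt
  set φ₀ := hz₀.toOpenPartialHomeomorph z hd₀ (by simp) with hφ₀
  have hφz : ∀ y, φ₀ y = z y := fun y => rfl
  have hmem : y₀ ∈ φ₀.source := hz₀.mem_toOpenPartialHomeomorph_source hd₀ (by simp)
  have hcont : ContinuousOn (fderiv ℝ z) W :=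
    (((contDiffOn_infty_iff_fderiv_of_isOpen hW).1 hz).2).continuousOn
  have hopen : IsOpen (W ∩ fderiv ℝ z ⁻¹' range ((↑) : (E ≃L[ℝ] F) → E →L[ℝ] F)) :=
    hcont.isOpen_inter_preimage hW ContinuousLinearEquiv.isOpen
  -- Restricting to points with invertible derivative makes the inverse smooth on the whole target,
  -- not just at the image of y₀.
  set V := W ∩ fderiv ℝ z ⁻¹' range ((↑) : (E ≃L[ℝ] F) → E →L[ℝ] F) with hV
  set φ₁ := φ₀.restr V with hφ₁
  have hs₁ : φ₁.source = φ₀.source ∩ V := by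
    rw [hφ₁, OpenPartialHomeomorph.restr_source, hopen.interior_eq]
  have hy₁ : y₀ ∈ φ₁.source := by
    rw [hs₁]
    exact ⟨hmem, hy₀, e, he⟩
  obtain ⟨r, hr, hball⟩ := Metric.isOpen_iff.1 φ₁.open_target (φ₁ y₀) (φ₁.map_source hy₁)
  set φ := (φ₁.symm.restr (Metric.ball (z y₀) r)).symm with hφ
  have ht : φ.target = Metric.ball (z y₀) r := by
    change (φ₁.symm.restr (Metric.ball (z y₀) r)).source = _
    rw [OpenPartialHomeomorph.restr_source, Metric.isOpen_ball.interior_eq]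
    exact inter_eq_self_of_subset_right hball
  have hsub : φ.source ⊆ φ₁.source := by
    intro y hy
    have h1 := φ.map_source hy
    rw [ht] at h1
    have h2 := φ₁.map_target (hball h1)
    have h3 : φ₁.symm (φ y) = y := φ.left_inv hy
    rwa [h3] at h2
  refine ⟨φ, r, hr, fun y => rfl, ?_, fun y hy => ?_, ht, fun a ha => ?_⟩
  · have h1 : φ₁ y₀ ∈ φ.target := by
      rw [ht]
      exact Metric.mem_ball_self hr
    have h2 := φ.map_target h1
    have h3 : φ.symm (φ₁ y₀) = y₀ := φ₁.left_inv hy₁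
    rwa [h3] at h2
  · have := hsub hy
    rw [hs₁] at this
    exact this.2.1
  · have h1 := hsub (φ.map_target ha)
    rw [hs₁] at h1
    obtain ⟨-, h2, e', he'⟩ := h1
    have h3 : ContDiffAt ℝ ∞ z (φ.symm a) := hz.contDiffAt (hW.mem_nhds h2)
    refine (φ.contDiffAt_symm (f₀' := e') ha ?_ h3).contDiffWithinAt
    rw [he']
    exact (h3.differentiableAt (by simp)).hasFDerivAt

/-- The last coordinate vector. -/
lemma exists_coord_last_eq_one (hn : 1 ≤ n) :
    ∃ e : Fin n → ℂ, coord e n = 1 ∧ ‖e‖ = 1 ∧ ∀ w : Fin n → ℂ, ‖coord w n‖ ≤ ‖w‖ := by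
  refine ⟨Pi.single ⟨n - 1, by omega⟩ 1, ?_, ?_, fun w => ?_⟩
  · rw [← eq_coord (Pi.single ⟨n - 1, by omega⟩ 1 : Fin n → ℂ) (i := ⟨n - 1, by omega⟩) (k := n)
      (by simp only []; omega), Pi.single_eq_same]
  · rw [Pi.norm_single, norm_one]
  · rw [← eq_coord w (i := ⟨n - 1, by omega⟩) (k := n) (by simp only []; omega)]
    exact norm_le_pi_norm w _

/-- A function on a polydisc whose differential is a multiple of `dz_n` is a holomorphic function
of `z_n`. -/
lemma exists_holomorphic_of_fderiv (hn : 1 ≤ n) {r : ℝ} {f m : (Fin n → ℂ) → ℂ}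
    (hf : ∀ ζ ∈ Metric.ball (0 : Fin n → ℂ) r, DifferentiableAt ℝ f ζ)
    (hm : ∀ ζ ∈ Metric.ball (0 : Fin n → ℂ) r, ∀ w, fderiv ℝ f ζ w = m ζ * coord w n) :
    ∃ ℓ : ℂ → ℂ, DifferentiableOn ℂ ℓ (Metric.ball 0 r) ∧
      ∀ ζ ∈ Metric.ball (0 : Fin n → ℂ) r, coord ζ n ∈ Metric.ball (0 : ℂ) r ∧
        f ζ = ℓ (coord ζ n) ∧ m ζ = deriv ℓ (coord ζ n) := by
  obtain ⟨e, he, hne, hnorm⟩ := exists_coord_last_eq_one hn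
  have hmem : ∀ s ∈ Metric.ball (0 : ℂ) r, s • e ∈ Metric.ball (0 : Fin n → ℂ) r := by
    intro s hs
    rw [mem_ball_zero_iff] at hs ⊢
    rwa [norm_smul, hne, mul_one]
  have hcmem : ∀ ζ ∈ Metric.ball (0 : Fin n → ℂ) r, coord ζ n ∈ Metric.ball (0 : ℂ) r := by
    intro ζ hζ
    rw [mem_ball_zero_iff] at hζ ⊢
    exact (hnorm ζ).trans_lt hζ
  -- On the slice s ↦ s • e the real differential of f is multiplication by m, hence complex linear.
  have hℓ : ∀ s ∈ Metric.ball (0 : ℂ) r, HasDerivAt (fun s : ℂ => f (s • e)) (m (s • e)) s := by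
    intro s hs
    have h1 : HasFDerivAt (fun s : ℂ => s • e)
        ((ContinuousLinearMap.id ℝ ℂ).smulRight e) s :=
      (hasFDerivAt_id s).smul_const e
    have h2 : HasFDerivAt (fun s : ℂ => f (s • e))
        (fderiv ℝ f (s • e) ∘L (ContinuousLinearMap.id ℝ ℂ).smulRight e) s :=
      HasFDerivAt.comp s (hf _ (hmem s hs)).hasFDerivAt h1
    rw [hasDerivAt_iff_hasFDerivAt]
    refine hasFDerivAt_of_restrictScalars ℝ h2 ?_
    ext
    simp [hm _ (hmem s hs), coord_smul, he, mul_comm]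
  -- The segment from `coord ζ n • e` to ζ has constant last coordinate, so f is constant along it.
  have hconst : ∀ ζ ∈ Metric.ball (0 : Fin n → ℂ) r, f ζ = f (coord ζ n • e) := by
    intro ζ hζ
    have hb := hmem _ (hcmem ζ hζ)
    have hseg : ∀ t ∈ Icc (0 : ℝ) 1,
        coord ζ n • e + t • (ζ - coord ζ n • e) ∈ Metric.ball (0 : Fin n → ℂ) r := by
      intro t ht
      exact (convex_ball _ _).add_smul_sub_mem hb hζ ht
    have hw : coord (ζ - coord ζ n • e) n = 0 := by
      rw [coord_sub, coord_smul, he, mul_one, sub_self]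
    have h := (convex_Icc (0 : ℝ) 1).norm_image_sub_le_of_norm_hasDerivWithin_le (C := 0)
      (f := fun t : ℝ => f (coord ζ n • e + t • (ζ - coord ζ n • e))) (f' := fun _ => 0)
      (fun t ht => by
        have h1 : HasDerivAt (fun t : ℝ => coord ζ n • e + t • (ζ - coord ζ n • e))
            (ζ - coord ζ n • e) t := by
          simpa using ((hasDerivAt_id t).smul_const (ζ - coord ζ n • e)).const_add (coord ζ n • e)
        have h2 := ((hf _ (hseg t ht)).hasFDerivAt.comp_hasDerivAt t h1).hasDerivWithinAt
          (s := Icc (0 : ℝ) 1)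
        rwa [hm _ (hseg t ht), hw, mul_zero] at h2)
      (by simp) (left_mem_Icc.2 zero_le_one) (right_mem_Icc.2 zero_le_one)
    simp only [one_smul, zero_smul, add_zero, zero_mul, norm_le_zero_iff, sub_eq_zero,
      add_sub_cancel] at h
    exact h
  refine ⟨fun s => f (s • e), fun s hs => (hℓ s hs).differentiableAt.differentiableWithinAt,
    fun ζ hζ => ⟨hcmem ζ hζ, hconst ζ hζ, ?_⟩⟩
  have h1 : HasDerivAt (fun t : ℝ => ζ + t • e) e 0 := hasDerivAt_line ζ e
  have h2 : HasDerivAt (fun t : ℝ => f (ζ + t • e)) (fderiv ℝ f ζ e) 0 :=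
    hasDerivAt_comp_line (hf ζ hζ).hasFDerivAt e
  have h3 : HasDerivAt (fun t : ℝ => f ((coord ζ n + t) • e)) (m (coord ζ n • e)) 0 := by
    have h4 : HasDerivAt (fun t : ℝ => coord ζ n + (t : ℂ)) 1 0 :=
      (Complex.ofRealCLM.hasDerivAt (x := (0 : ℝ))).const_add (coord ζ n)
    have h5 := (hℓ _ (hcmem ζ hζ))
    rw [← add_zero (coord ζ n), ← Complex.ofReal_zero] at h5
    simpa [Function.comp_def] using h5.comp (0 : ℝ) h4
  have h4 : (fun t : ℝ => f (ζ + t • e)) =ᶠ[nhds 0] fun t : ℝ => f ((coord ζ n + t) • e) := by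
    have h5 : ∀ᶠ t : ℝ in nhds 0, ζ + t • e ∈ Metric.ball (0 : Fin n → ℂ) r :=
      eventually_line (Metric.isOpen_ball.mem_nhds hζ) e
    filter_upwards [h5] with t ht
    rw [hconst _ ht, coord_add, show t • e = (t : ℂ) • e from rfl, coord_smul, he, mul_one]
  have h6 := h2.unique (h3.congr_of_eventuallyEq h4)
  rw [hm ζ hζ, he, mul_one] at h6
  rw [h6, (hℓ _ (hcmem ζ hζ)).deriv]

/-- The local normal form, for tensor fields on an open subset of a vector space. -/
theorem exists_normal_coordinates [FiniteDimensional ℝ E] (hn : 1 ≤ n) {W : Set E} (hW : IsOpen W)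
    {y₀ : E} (hy₀ : y₀ ∈ W) {A : E → E →L[ℝ] E} (hA : ContDiffOn ℝ ∞ A W)
    {G : E → E →L[ℝ] E →L[ℝ] ℝ} (hG : ContDiffOn ℝ ∞ G W)
    (hnd : ∀ y ∈ W, ∀ u, (∀ v, G y u v = 0) → u = 0)
    (hsa : ∀ y ∈ W, ∀ u v, G y (A y u) v = G y u (A y v))
    (hC : ∀ y ∈ W, CompatEqAt G A y)
    {Λ : E → ℂ} (hΛ : ContinuousOn Λ W) (him : ∀ y ∈ W, (Λ y).im ≠ 0)
    (hT : ∀ y ∈ W, ∃ T : E ≃ₗ[ℝ] (Fin n → ℂ), ∀ v, T (A y v) = shiftN n (T v) + Λ y • T v) :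
    ∃ (φ : OpenPartialHomeomorph E (Fin n → ℂ)) (D : Set ℂ) (ℓ : ℂ → ℂ),
      y₀ ∈ φ.source ∧ φ.source ⊆ W ∧ ContDiffOn ℝ ∞ φ φ.source ∧
      ContDiffOn ℝ ∞ φ.symm φ.target ∧ IsOpen D ∧ DifferentiableOn ℂ ℓ D ∧
      ∀ y ∈ φ.source, coord (φ y) n ∈ D ∧ Λ y = ℓ (coord (φ y) n) ∧
        (∀ v, fderiv ℝ φ y (A y v) = LC ℓ (φ y) *ᵥ fderiv ℝ φ y v) ∧
        ∀ u v, G y u v = reFormOf (gC ℓ (φ y)) (fderiv ℝ φ y u) (fderiv ℝ φ y v) := by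
  obtain ⟨W₁, hW₁, hy₁, hW₁W, hΛ₁⟩ := contDiffOn_eigenvalue hn hW hy₀ hA hΛ him hT
  obtain ⟨W₂, θ, hW₂, hy₂, hW₂₁, hθ, hθb, hadapt⟩ := exists_canonical_coframe hn hW₁ hy₁
    (hA.mono hW₁W) (hG.mono hW₁W) (fun y hy => hnd y (hW₁W hy)) (fun y hy => hsa y (hW₁W hy)) hΛ₁
    (fun y hy => him y (hW₁W hy)) fun y hy => hT y (hW₁W hy)
  -- A ball is convex, as the Poincaré lemma requires.
  obtain ⟨R, hR, hball⟩ := Metric.isOpen_iff.1 hW₂ y₀ hy₂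
  set B := Metric.ball y₀ R with hB
  have hBo : IsOpen B := Metric.isOpen_ball
  have hBW : B ⊆ W := fun y hy => hW₁W (hW₂₁ (hball hy))
  have hnhds : ∀ y ∈ B, W ∈ nhds y := fun y hy => hW.mem_nhds (hBW hy)
  have hθ' : ContDiffOn ℝ ∞ θ B := hθ.mono hball
  have hΛ' : ContDiffOn ℝ ∞ Λ B := hΛ₁.mono fun y hy => hW₂₁ (hball hy)
  have hGd : ∀ y ∈ B, DifferentiableAt ℝ G y := fun y hy =>
    (hG.contDiffAt (hnhds y hy)).differentiableAt (by simp)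
  have hAd : ∀ y ∈ B, DifferentiableAt ℝ A y := fun y hy =>
    (hA.contDiffAt (hnhds y hy)).differentiableAt (by simp)
  have hθd : ∀ y ∈ B, HasFDerivAt θ (fderiv ℝ θ y) y := fun y hy =>
    ((hθ'.contDiffAt (hBo.mem_nhds hy)).differentiableAt (by simp)).hasFDerivAt
  have hΛd : ∀ y ∈ B, HasFDerivAt Λ (fderiv ℝ Λ y) y := fun y hy =>
    ((hΛ'.contDiffAt (hBo.mem_nhds hy)).differentiableAt (by simp)).hasFDerivAt
  have hGi : ∀ y ∈ B, (G y).IsInvertible := fun y hy =>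
    isInvertible_of_nondegenerate (hnd y (hBW hy))
  have had : ∀ y ∈ B, ∀ᶠ y' in nhds y, IsAdaptedAt G A θ Λ y' := fun y hy =>
    Filter.eventually_of_mem (hBo.mem_nhds hy) fun y' hy' => hadapt y' (hball hy')
  have hbij : ∀ y ∈ B, ∀ᶠ y' in nhds y, Function.Bijective (θ y') := fun y hy =>
    Filter.eventually_of_mem (hBo.mem_nhds hy) fun y' hy' => hθb y' (hball hy')
  have hμ : ∀ y, ∃ μ : ℂ, y ∈ B → ∀ u, fderiv ℝ Λ y u = μ * coord (θ y u) n := by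
    intro y
    by_cases hy : y ∈ B
    · obtain ⟨μ, hμ⟩ := exists_eigenvalue_differential hn (hGi y hy) (hAd y hy) (hθd y hy)
        (hΛd y hy) (had y hy) (hbij y hy) (hC y (hBW hy))
      exact ⟨μ, fun _ => hμ⟩
    · exact ⟨0, fun h => absurd h hy⟩
  choose μ hμ using hμ
  obtain ⟨z, hz, hz₀, hzθ⟩ := exists_coordinates_of_torsion hBo (convex_ball y₀ R) y₀ hθ' hΛ' hμ
    fun y hy u v => torsion_of_compatEqAt hn (him y (hBW hy)) (hGi y hy) (hGd y hy) (hAd y hy)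
      (hθd y hy) (hΛd y hy) (had y hy) (hbij y hy) (hC y (hBW hy)) (hμ y hy) u v
  have hy₀B : y₀ ∈ B := Metric.mem_ball_self hR
  have hzi : (fderiv ℝ z y₀).IsInvertible := by
    refine ⟨(LinearEquiv.ofBijective (θ y₀).toLinearMap (hθb y₀ hy₂)).toContinuousLinearEquiv, ?_⟩
    ext1 u
    refine (hzθ y₀ hy₀B u).trans ?_
    rw [hz₀, map_zero, smul_zero, add_zero]
  obtain ⟨φ, r, hr, hφz, hφy, hφB, hφt, hφs⟩ := exists_localDiffeomorph_ball hBo hy₀B hz hzi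
  rw [hz₀] at hφt
  have hφz' : (φ : E → Fin n → ℂ) = z := funext hφz
  have hφ : ContDiffOn ℝ ∞ φ φ.source := by
    rw [hφz']
    exact hz.mono hφB
  have hφd : ∀ y ∈ φ.source, HasFDerivAt φ (fderiv ℝ φ y) y := fun y hy =>
    ((hφ.contDiffAt (φ.open_source.mem_nhds hy)).differentiableAt (by simp)).hasFDerivAt
  have hψd : ∀ ζ ∈ φ.target, HasFDerivAt φ.symm (fderiv ℝ φ.symm ζ) ζ := fun ζ hζ =>
    ((hφs.contDiffAt (φ.open_target.mem_nhds hζ)).differentiableAt (by simp)).hasFDerivAt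
  have hφψ : ∀ ζ ∈ φ.target, ∀ w, fderiv ℝ φ (φ.symm ζ) (fderiv ℝ φ.symm ζ w) = w := by
    intro ζ hζ w
    have h1 := (hφd _ (φ.map_target hζ)).comp ζ (hψd ζ hζ)
    have h2 : HasFDerivAt (φ ∘ φ.symm) (ContinuousLinearMap.id ℝ (Fin n → ℂ)) ζ :=
      (hasFDerivAt_id ζ).congr_of_eventuallyEq
        (Filter.eventually_of_mem (φ.open_target.mem_nhds hζ) fun ζ' hζ' => φ.right_inv hζ')
    exact DFunLike.congr_fun (h1.unique h2) w
  have hsurj : ∀ y ∈ φ.source, Function.Surjective (fderiv ℝ φ y) := by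
    intro y hy w
    have h := hφψ (φ y) (φ.map_source hy) w
    rw [φ.left_inv hy] at h
    exact ⟨_, h⟩
  have hθφ : ∀ y ∈ φ.source, ∀ u, θ y u
      = fderiv ℝ φ y u + fderiv ℝ Λ y u • raiseS n (φ y) := by
    intro y hy u
    rw [hφz']
    exact hzθ y (hφB hy) u
  obtain ⟨e, he, -, -⟩ := exists_coord_last_eq_one hn
  have hdΛ : ∀ y ∈ φ.source, ∃ m : ℂ, ∀ u, fderiv ℝ Λ y u = m * coord (fderiv ℝ φ y u) n := by
    intro y hy
    -- The last component of θ = dz + dΛ · Sz reads c θ_n = dz_n. As dz_n is onto, c ≠ 0, and dΛ = μ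
    -- θ_n becomes a multiple of dz_n.
    set c : ℂ := 1 - μ y * coord (raiseS n (φ y)) n with hc
    have h1 : ∀ u, c * coord (θ y u) n = coord (fderiv ℝ φ y u) n := by
      intro u
      have h2 := congrArg (fun a => coord a n) (hθφ y hy u)
      simp only [coord_add, coord_smul, hμ y (hφB hy) u] at h2
      rw [hc]
      linear_combination h2
    have hc0 : c ≠ 0 := by
      intro h0
      obtain ⟨u, hu⟩ := hsurj y hy e
      have h2 := h1 u
      rw [h0, zero_mul, hu, he] at h2
      exact zero_ne_one h2
    refine ⟨μ y * c⁻¹, fun u => ?_⟩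
    rw [hμ y (hφB hy) u, ← h1 u]
    field_simp
  have hm : ∀ ζ, ∃ m : ℂ, ζ ∈ φ.target → ∀ u, fderiv ℝ Λ (φ.symm ζ) u
      = m * coord (fderiv ℝ φ (φ.symm ζ) u) n := by
    intro ζ
    by_cases hζ : ζ ∈ φ.target
    · obtain ⟨m, hm⟩ := hdΛ _ (φ.map_target hζ)
      exact ⟨m, fun _ => hm⟩
    · exact ⟨0, fun h => absurd h hζ⟩
  choose m hm using hm
  have hf : ∀ ζ ∈ φ.target,
      HasFDerivAt (fun ζ => Λ (φ.symm ζ)) (fderiv ℝ Λ (φ.symm ζ) ∘L fderiv ℝ φ.symm ζ) ζ :=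
    fun ζ hζ => (hΛd _ (hφB (φ.map_target hζ))).comp ζ (hψd ζ hζ)
  rw [hφt] at hf
  obtain ⟨ℓ, hℓ, hℓf⟩ := exists_holomorphic_of_fderiv hn (r := r) (m := m)
    (fun ζ hζ => (hf ζ hζ).differentiableAt) fun ζ hζ w => by
      have hζ' : ζ ∈ φ.target := by rwa [hφt]
      rw [(hf ζ hζ).fderiv, ContinuousLinearMap.comp_apply, hm ζ hζ', hφψ ζ hζ']
  refine ⟨φ, Metric.ball 0 r, ℓ, hφy, fun y hy => hBW (hφB hy), hφ, hφs, Metric.isOpen_ball, hℓ,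
    fun y hy => ?_⟩
  have hφy' : φ y ∈ Metric.ball (0 : Fin n → ℂ) r := by
    rw [← hφt]
    exact φ.map_source hy
  obtain ⟨h1, h2, h3⟩ := hℓf (φ y) hφy'
  rw [φ.left_inv hy] at h2
  have hadp := hadapt y (hball (hφB hy))
  have hframe : ∀ u, θ y u = frameP ℓ (φ y) (fderiv ℝ φ y u) := by
    intro u
    have h4 := hm (φ y) (φ.map_source hy) u
    rw [φ.left_inv hy] at h4
    rw [hθφ y hy u, frameP_apply, h4, h3]
  refine ⟨h1, h2, fun v => ?_, fun u v => ?_⟩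
  · obtain ⟨w, hw⟩ := hsurj y hy (LC ℓ (φ y) *ᵥ fderiv ℝ φ y v)
    rw [← hw]
    congr 1
    refine (hθb y (hball (hφB hy))).1 ?_
    rw [hadp.map_op, hframe w, hw, frameP_LC, ← hframe v, h2]
  · rw [hadp.map_form, hframe u, hframe v, h2, reFormOf_apply, dotProduct_gC]

end LocalNormalForm

/-! ### Transfer to manifolds -/

section ManifoldNormalForm

variable {n : ℕ} {E : Type*} [NormedAddCommGroup E] [NormedSpace ℝ E]
  {M : Type*} [TopologicalSpace M] [ChartedSpace E M]

lemma coe_extChartAt_symm (x₀ : M) :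
    ((extChartAt 𝓘(ℝ, E) x₀).symm : E → M) = (chartAt E x₀).symm := rfl

lemma chartDomain_eq (U : Set M) (x₀ : M) :
    chartDomain E U x₀ = (chartAt E x₀).target ∩ (chartAt E x₀).symm ⁻¹' U := by
  rw [chartDomain, coe_extChartAt_symm]
  simp

section Transfer

variable [IsManifold 𝓘(ℝ, E) ∞ M]

lemma mfderiv_chartAt_symm_apply {x₀ x : M} (hx : x ∈ (chartAt E x₀).source) (v : E) :
    (mfderiv 𝓘(ℝ, E) 𝓘(ℝ, E) (chartAt E x₀).symm (chartAt E x₀ x) : E →L[ℝ] E)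
      ((mfderiv 𝓘(ℝ, E) 𝓘(ℝ, E) (chartAt E x₀) x : E →L[ℝ] E) v) = v := by
  have : IsManifold 𝓘(ℝ, E) 1 M := IsManifold.of_le (n := ∞) (by simp)
  exact DFunLike.congr_fun ((mdifferentiable_chart (I := 𝓘(ℝ, E)) x₀).symm_comp_deriv hx) v

lemma formInChart_apply
    (g : ∀ x : M, TangentSpace 𝓘(ℝ, E) x →L[ℝ] TangentSpace 𝓘(ℝ, E) x →L[ℝ] ℝ)
    {x₀ x : M} (hx : x ∈ (chartAt E x₀).source) (u v : TangentSpace 𝓘(ℝ, E) x) :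
    formInChart g x₀ (chartAt E x₀ x)
      ((mfderiv 𝓘(ℝ, E) 𝓘(ℝ, E) (chartAt E x₀) x : E →L[ℝ] E) u)
      ((mfderiv 𝓘(ℝ, E) 𝓘(ℝ, E) (chartAt E x₀) x : E →L[ℝ] E) v) = g x u v := by
  -- The base point `symm (chart x)` is equal to x only propositionally; with vectors taken in E,
  -- the common fibre, it can be replaced by x.
  have h : ∀ x', x' = x → ∀ w₁ w₂ : E, (g x' : E →L[ℝ] E →L[ℝ] ℝ) w₁ w₂ = g x w₁ w₂ := by
    rintro x' rfl w₁ w₂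
    rfl
  refine (h ((chartAt E x₀).symm (chartAt E x₀ x)) ((chartAt E x₀).left_inv hx) _ _).trans ?_
  have h1 := mfderiv_chartAt_symm_apply hx u
  have h2 := mfderiv_chartAt_symm_apply hx v
  exact congrArg₂ (fun a b : E => (g x : E →L[ℝ] E →L[ℝ] ℝ) a b) h1 h2

lemma endInChart_apply
    (L : ∀ x : M, TangentSpace 𝓘(ℝ, E) x →L[ℝ] TangentSpace 𝓘(ℝ, E) x)
    {x₀ x : M} (hx : x ∈ (chartAt E x₀).source) (v : TangentSpace 𝓘(ℝ, E) x) :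
    endInChart L x₀ (chartAt E x₀ x)
      ((mfderiv 𝓘(ℝ, E) 𝓘(ℝ, E) (chartAt E x₀) x : E →L[ℝ] E) v)
      = (mfderiv 𝓘(ℝ, E) 𝓘(ℝ, E) (chartAt E x₀) x : E →L[ℝ] E) (L x v) := by
  have h : ∀ x', x' = x → ∀ w : E,
      (mfderiv 𝓘(ℝ, E) 𝓘(ℝ, E) (chartAt E x₀) x' : E →L[ℝ] E) ((L x' : E →L[ℝ] E) w)
      = (mfderiv 𝓘(ℝ, E) 𝓘(ℝ, E) (chartAt E x₀) x : E →L[ℝ] E) ((L x : E →L[ℝ] E) w) := by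
    rintro x' rfl w
    rfl
  refine (h ((chartAt E x₀).symm (chartAt E x₀ x)) ((chartAt E x₀).left_inv hx) _).trans ?_
  have h1 := mfderiv_chartAt_symm_apply hx v
  exact congrArg (fun a : E =>
    (mfderiv 𝓘(ℝ, E) 𝓘(ℝ, E) (chartAt E x₀) x : E →L[ℝ] E) ((L x : E →L[ℝ] E) a)) h1

/-- The differential of a chart, as a linear equivalence. -/
lemma exists_linearEquiv_mfderiv_chartAt {x₀ x : M} (hx : x ∈ (chartAt E x₀).source) :
    ∃ e : TangentSpace 𝓘(ℝ, E) x ≃ₗ[ℝ] E, ∀ v,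
      e v = (mfderiv 𝓘(ℝ, E) 𝓘(ℝ, E) (chartAt E x₀) x : E →L[ℝ] E) v := by
  have : IsManifold 𝓘(ℝ, E) 1 M := IsManifold.of_le (n := ∞) (by simp)
  exact ⟨((mdifferentiable_chart (I := 𝓘(ℝ, E)) x₀).mfderiv hx).toLinearEquiv, fun v => rfl⟩

end Transfer

lemma dCoord_mfderiv_symm {φ : OpenPartialHomeomorph M (Fin n → ℂ)}
    (h : ContMDiffOn 𝓘(ℝ, E) 𝓘(ℝ, Fin n → ℂ) ∞ φ φ.source)
    (hs : ContMDiffOn 𝓘(ℝ, Fin n → ℂ) 𝓘(ℝ, E) ∞ φ.symm φ.target) {x : M} (hx : x ∈ φ.source)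
    (w : Fin n → ℂ) :
    (dCoord φ x : E →L[ℝ] (Fin n → ℂ))
      ((mfderiv 𝓘(ℝ, Fin n → ℂ) 𝓘(ℝ, E) φ.symm (φ x) : (Fin n → ℂ) →L[ℝ] E) w) = w := by
  have hd : φ.MDifferentiable 𝓘(ℝ, E) 𝓘(ℝ, Fin n → ℂ) :=
    ⟨h.mdifferentiableOn (by simp), hs.mdifferentiableOn (by simp)⟩
  have h1 := hd.comp_symm_deriv (φ.map_source hx)
  rw [φ.left_inv hx] at h1
  exact DFunLike.congr_fun h1 w

lemma mfderiv_symm_dCoord {φ : OpenPartialHomeomorph M (Fin n → ℂ)}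
    (h : ContMDiffOn 𝓘(ℝ, E) 𝓘(ℝ, Fin n → ℂ) ∞ φ φ.source)
    (hs : ContMDiffOn 𝓘(ℝ, Fin n → ℂ) 𝓘(ℝ, E) ∞ φ.symm φ.target) {x : M} (hx : x ∈ φ.source)
    (v : TangentSpace 𝓘(ℝ, E) x) :
    (mfderiv 𝓘(ℝ, Fin n → ℂ) 𝓘(ℝ, E) φ.symm (φ x) : (Fin n → ℂ) →L[ℝ] E)
      (dCoord φ x v) = v := by
  have hd : φ.MDifferentiable 𝓘(ℝ, E) 𝓘(ℝ, Fin n → ℂ) :=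
    ⟨h.mdifferentiableOn (by simp), hs.mdifferentiableOn (by simp)⟩
  exact DFunLike.congr_fun (hd.symm_comp_deriv hx) v

/-- The complex structure transported by a chart with values in `ℂⁿ`. -/
def chartComplexStructure (φ : OpenPartialHomeomorph M (Fin n → ℂ)) (x : M) :
    TangentSpace 𝓘(ℝ, E) x →L[ℝ] TangentSpace 𝓘(ℝ, E) x :=
  (mfderiv 𝓘(ℝ, Fin n → ℂ) 𝓘(ℝ, E) φ.symm (φ x) : (Fin n → ℂ) →L[ℝ] E) ∘L
    (Complex.I • (dCoord φ x : E →L[ℝ] (Fin n → ℂ)))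

lemma dCoord_chartComplexStructure {φ : OpenPartialHomeomorph M (Fin n → ℂ)}
    (h : ContMDiffOn 𝓘(ℝ, E) 𝓘(ℝ, Fin n → ℂ) ∞ φ φ.source)
    (hs : ContMDiffOn 𝓘(ℝ, Fin n → ℂ) 𝓘(ℝ, E) ∞ φ.symm φ.target) {x : M} (hx : x ∈ φ.source)
    (v : TangentSpace 𝓘(ℝ, E) x) :
    dCoord φ x (chartComplexStructure φ x v) = Complex.I • dCoord φ x v :=
  dCoord_mfderiv_symm h hs hx _

/-- Existence of the normal form on a manifold. -/
theorem exists_complex_normal_form [FiniteDimensional ℝ E] [IsManifold 𝓘(ℝ, E) ∞ M] (hn : 1 ≤ n)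
    (g : ∀ x : M, TangentSpace 𝓘(ℝ, E) x →L[ℝ] TangentSpace 𝓘(ℝ, E) x →L[ℝ] ℝ)
    (L : ∀ x : M, TangentSpace 𝓘(ℝ, E) x →L[ℝ] TangentSpace 𝓘(ℝ, E) x)
    (U : Set M) (lam : M → ℂ) (p : M) (hU : IsOpen U) (hp : p ∈ U) (hgL : IsCompatibleOn g L U)
    (hlam : ContinuousOn lam U)
    (hJ : ∀ x ∈ U, (lam x).im ≠ 0 ∧ IsConjToJordanAt L n x (lam x)) :
    ∃ (J : ∀ x : M, TangentSpace 𝓘(ℝ, E) x →L[ℝ] TangentSpace 𝓘(ℝ, E) x)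
      (φ : OpenPartialHomeomorph M (Fin n → ℂ)) (D : Set ℂ) (ℓ : ℂ → ℂ),
      p ∈ φ.source ∧ φ.source ⊆ U ∧ IsComplexStructureOn n J φ.source ∧
      IsComplexCoordinates J φ ∧ IsOpen D ∧ DifferentiableOn ℂ ℓ D ∧
      (∀ x ∈ φ.source, coord (φ x) n ∈ D ∧ lam x = ℓ (coord (φ x) n) ∧
        (∀ v, L x (J x v) = J x (L x v)) ∧
        (∀ v, dCoord φ x (L x v) = opOf (LC ℓ (φ x)) (dCoord φ x v)) ∧
        (∀ u v, g x u v = reFormOf (gC ℓ (φ x)) (dCoord φ x u) (dCoord φ x v)) ∧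
        (∀ b, L x (coordVec φ x b) = ∑ a, realOp (LC ℓ (φ x)) a b • coordVec φ x a) ∧
        (∀ a b, g x (coordVec φ x a) (coordVec φ x b) = realForm (gC ℓ (φ x)) a b)) := by
  set c := chartAt E p with hc
  have hpc : p ∈ c.source := mem_chart_source E p
  have hW : chartDomain E U p = c.target ∩ c.symm ⁻¹' U := chartDomain_eq U p
  have hWo : IsOpen (chartDomain E U p) := by
    rw [hW]
    exact c.symm.isOpen_inter_preimage hU
  have hpW : c p ∈ chartDomain E U p := by
    rw [hW]
    refine ⟨c.map_source hpc, ?_⟩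
    rw [mem_preimage, c.left_inv hpc]
    exact hp
  have hpt : ∀ y ∈ chartDomain E U p, ∃ x ∈ U, x ∈ c.source ∧ c x = y := by
    intro y hy
    rw [hW] at hy
    exact ⟨c.symm y, hy.2, c.map_target hy.1, c.right_inv hy.1⟩
  have hsurj : ∀ x ∈ c.source, ∀ w : E, ∃ v : TangentSpace 𝓘(ℝ, E) x,
      (mfderiv 𝓘(ℝ, E) 𝓘(ℝ, E) c x : E →L[ℝ] E) v = w := by
    intro x hx w
    obtain ⟨e, he⟩ := exists_linearEquiv_mfderiv_chartAt hx
    exact ⟨e.symm w, by rw [← he, e.apply_symm_apply]⟩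
  have hnd : ∀ y ∈ chartDomain E U p, ∀ u, (∀ v, formInChart g p y u v = 0) → u = 0 := by
    intro y hy u hu
    obtain ⟨x, hxU, hx, rfl⟩ := hpt y hy
    obtain ⟨u, rfl⟩ := hsurj x hx u
    rw [hgL.metric.nondegenerate x hxU u fun v => (formInChart_apply g hx u v).symm.trans (hu _)]
    exact map_zero _
  have hsa : ∀ y ∈ chartDomain E U p, ∀ u v, formInChart g p y (endInChart L p y u) v
      = formInChart g p y u (endInChart L p y v) := by
    intro y hy u v
    obtain ⟨x, hxU, hx, rfl⟩ := hpt y hy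
    obtain ⟨u, rfl⟩ := hsurj x hx u
    obtain ⟨v, rfl⟩ := hsurj x hx v
    rw [endInChart_apply L hx u, endInChart_apply L hx v, formInChart_apply g hx,
      formInChart_apply g hx, hgL.selfadjoint x hxU]
  have hT : ∀ y ∈ chartDomain E U p, ∃ T : E ≃ₗ[ℝ] (Fin n → ℂ),
      ∀ v, T (endInChart L p y v) = shiftN n (T v) + lam (c.symm y) • T v := by
    intro y hy
    obtain ⟨x, hxU, hx, rfl⟩ := hpt y hy
    obtain ⟨T, hT⟩ := (hJ x hxU).2
    obtain ⟨e, he⟩ := exists_linearEquiv_mfderiv_chartAt hx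
    refine ⟨e.symm.trans T, fun v => ?_⟩
    obtain ⟨v, rfl⟩ := hsurj x hx v
    rw [endInChart_apply L hx v, ← he, ← he, LinearEquiv.trans_apply, LinearEquiv.trans_apply,
      e.symm_apply_apply, e.symm_apply_apply, hT, jordanBlock_mulVec, c.left_inv hx]
  have hΛ : ContinuousOn (lam ∘ c.symm) (chartDomain E U p) := by
    rw [hW]
    exact hlam.comp (c.continuousOn_symm.mono inter_subset_left) fun y hy => hy.2
  have him : ∀ y ∈ chartDomain E U p, ((lam ∘ c.symm) y).im ≠ 0 := by
    intro y hy
    rw [hW] at hy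
    exact (hJ _ hy.2).1
  obtain ⟨ψ, D, ℓ, hpψ, hψW, hψ, hψs, hD, hℓ, hnf⟩ := exists_normal_coordinates hn hWo hpW
    (hgL.smooth p) (hgL.metric.smooth p) hnd hsa (hgL.equation p) hΛ him hT
  set φ : OpenPartialHomeomorph M (Fin n → ℂ) := c.trans ψ with hφ
  have hφs : φ.source = c.source ∩ c ⁻¹' ψ.source := c.trans_source ψ
  have hφt : φ.target = ψ.target ∩ ψ.symm ⁻¹' c.target := c.trans_target ψ
  have hsm : ContMDiffOn 𝓘(ℝ, E) 𝓘(ℝ, Fin n → ℂ) ∞ φ φ.source := by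
    rw [hφs]
    exact hψ.contMDiffOn.comp ((contMDiffOn_extChartAt (x := p)).mono inter_subset_left)
      fun x hx => hx.2
  have hsm' : ContMDiffOn 𝓘(ℝ, Fin n → ℂ) 𝓘(ℝ, E) ∞ φ.symm φ.target := by
    rw [hφt]
    refine ContMDiffOn.comp (g := c.symm) (f := ψ.symm) (t := c.target) ?_
      (hψs.contMDiffOn.mono inter_subset_left) fun x hx => hx.2
    have := contMDiffOn_extChartAt_symm (I := 𝓘(ℝ, E)) (n := ∞) p
    rw [coe_extChartAt_symm] at this
    simpa using this
  have hdφ : ∀ x ∈ φ.source, ∀ v : TangentSpace 𝓘(ℝ, E) x,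
      dCoord φ x v = fderiv ℝ ψ (c x) ((mfderiv 𝓘(ℝ, E) 𝓘(ℝ, E) c x : E →L[ℝ] E) v) := by
    intro x hx v
    rw [hφs] at hx
    have h1 : MDifferentiableAt 𝓘(ℝ, E) 𝓘(ℝ, Fin n → ℂ) ψ (c x) :=
      ((hψ.contDiffAt (ψ.open_source.mem_nhds hx.2)).differentiableAt
        (by simp)).mdifferentiableAt
    have h2 : MDifferentiableAt 𝓘(ℝ, E) 𝓘(ℝ, E) c x :=
      mdifferentiableAt_extChartAt (I := 𝓘(ℝ, E)) hx.1
    have h3 := mfderiv_comp x h1 h2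
    rw [mfderiv_eq_fderiv] at h3
    exact DFunLike.congr_fun h3 v
  have hJm := fun {x : M} (hx : x ∈ φ.source) => dCoord_chartComplexStructure hsm hsm' hx
  -- J is the pullback of multiplication by i under φ, so φ itself witnesses integrability.
  have hcc : IsComplexCoordinates (chartComplexStructure φ) φ := ⟨hsm, hsm', fun x hx => hJm hx⟩
  have hinj : ∀ x ∈ φ.source, Function.Injective (dCoord φ x : E →L[ℝ] (Fin n → ℂ)) :=
    fun x hx => Function.LeftInverse.injective
      (g := (mfderiv 𝓘(ℝ, Fin n → ℂ) 𝓘(ℝ, E) φ.symm (φ x) : (Fin n → ℂ) →L[ℝ] E))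
      fun v => mfderiv_symm_dCoord hsm hsm' hx v
  have hL : ∀ x ∈ φ.source, ∀ v, dCoord φ x (L x v) = opOf (LC ℓ (φ x)) (dCoord φ x v) := by
    intro x hx v
    have hx' := hx
    rw [hφs] at hx'
    rw [hdφ x hx, hdφ x hx, ← endInChart_apply L hx'.1 v]
    exact (hnf (c x) hx'.2).2.2.1 _
  have hg : ∀ x ∈ φ.source, ∀ u v,
      g x u v = reFormOf (gC ℓ (φ x)) (dCoord φ x u) (dCoord φ x v) := by
    intro x hx u v
    have hx' := hx
    rw [hφs] at hx'
    rw [hdφ x hx, hdφ x hx, ← formInChart_apply g hx'.1 u v]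
    exact (hnf (c x) hx'.2).2.2.2 _ _
  have hvec : ∀ x ∈ φ.source, ∀ b, dCoord φ x (coordVec φ x b)
      = Pi.single b.1 (![1, Complex.I] b.2) := fun x hx b => dCoord_mfderiv_symm hsm hsm' hx _
  refine ⟨chartComplexStructure φ, φ, D, ℓ, ?_, ?_, ⟨fun x hx v => ?_, fun x hx => ?_⟩, hcc, hD, hℓ,
    fun x hx => ⟨?_, ?_, fun v => ?_, hL x hx, hg x hx, fun b => ?_, fun a b => ?_⟩⟩
  · rw [hφs]
    exact ⟨hpc, hpψ⟩
  · intro x hx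
    rw [hφs] at hx
    have := hψW hx.2
    rw [hW] at this
    have h := this.2
    rwa [mem_preimage, c.left_inv hx.1] at h
  · refine hinj x hx ?_
    refine (hJm hx _).trans ?_
    rw [hJm hx, smul_smul, Complex.I_mul_I, neg_one_smul]
    exact (map_neg (dCoord φ x) v).symm
  · exact ⟨φ, hx, subset_rfl, hcc⟩
  · rw [hφs] at hx
    exact (hnf (c x) hx.2).1
  · rw [hφs] at hx
    have h := (hnf (c x) hx.2).2.1
    rwa [Function.comp_apply, c.left_inv hx.1] at h
  · refine hinj x hx ?_
    refine (hL x hx _).trans ?_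
    refine Eq.trans ?_ (hJm hx _).symm
    rw [hJm hx, hL x hx, opOf_apply, opOf_apply, Matrix.mulVec_smul]
  · refine hinj x hx ?_
    refine (hL x hx _).trans ?_
    rw [hvec x hx, opOf_apply, realOp_sum]
    refine Eq.trans ?_ (map_sum (dCoord φ x) _ _).symm
    refine Finset.sum_congr rfl fun a _ => ?_
    refine Eq.trans ?_ (map_smul (dCoord φ x) _ _).symm
    rw [hvec x hx]
  · rw [hg x hx, hvec x hx, hvec x hx, realForm_eq]

end ManifoldNormalForm

/-! ### The converse: degeneracy locus and compatibility of the normal form -/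

section ModelCompatibility

variable {n : ℕ} {ℓ : ℂ → ℂ} {z : Fin n → ℂ}

lemma coord_frameP_last (ℓ : ℂ → ℂ) (z v : Fin n → ℂ) : coord (frameP ℓ z v) n
    = (1 + deriv ℓ (coord z n) * coord (raiseS n z) n) * coord v n := by
  rw [frameP_apply, coord_add, coord_smul]
  ring

/-- P multiplies the last coordinate by this factor, and it is the identity on vectors with last
coordinate 0. -/
lemma frameP_injective (h : 1 + deriv ℓ (coord z n) * coord (raiseS n z) n ≠ 0) :
    Function.Injective (frameP ℓ z) := by
  rw [injective_iff_map_eq_zero]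
  intro v hv
  have h1 := coord_frameP_last ℓ z v
  rw [hv] at h1
  have h2 : coord v n = 0 := by
    have h3 : coord (0 : Fin n → ℂ) n = 0 := (coordLin n n).map_zero
    exact (mul_eq_zero.1 (h1.symm.trans h3)).resolve_left h
  rwa [frameP_apply, h2, mul_zero, zero_smul, add_zero] at hv

lemma frameP_bijective (h : 1 + deriv ℓ (coord z n) * coord (raiseS n z) n ≠ 0) :
    Function.Bijective (frameP ℓ z) :=
  ⟨frameP_injective h, LinearMap.injective_iff_surjective.1 (frameP_injective h)⟩

/-- The determinant criterion for a form given by its real matrix. -/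
lemma det_realForm_ne_zero_iff (B : Matrix (Fin n) (Fin n) ℂ) :
    (realForm B).det ≠ 0 ↔ ∀ u, (∀ v, reFormOf B u v = 0) → u = 0 := by
  set b : Module.Basis (Fin n × Fin 2) ℝ (Fin n → ℂ) :=
    (Pi.basis fun _ : Fin n => Complex.basisOneI).reindex (Equiv.sigmaEquivProd _ _) with hb
  set F : (Fin n → ℂ) →ₗ[ℝ] (Fin n → ℂ) →ₗ[ℝ] ℝ :=
    LinearMap.mk₂ ℝ (fun u v => reFormOf B u v) (by simp) (by simp) (by simp) (by simp) with hF
  have hbs : ∀ a, b a = Pi.single a.1 (![1, Complex.I] a.2) := by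
    rintro ⟨a, ε⟩
    rw [hb, Module.Basis.reindex_apply]
    refine (Pi.basis_apply _ _).trans ?_
    congr 1
    fin_cases ε <;> simp
  have hm : LinearMap.toMatrix₂ b b F = realForm B := by
    ext a c
    rw [LinearMap.toMatrix₂_apply, hbs, hbs, ← realForm_eq]
    rfl
  rw [← hm, ← LinearMap.separatingLeft_iff_det_ne_zero]
  rfl

/-- The form is the pullback of Re B by P. If λ is real then ρ = 0 and B vanishes, because N^n = 0;
if the second factor vanishes then ℓ' Sz is a nonzero vector in the kernel of P. -/
lemma reFormOf_gC_nondegenerate_iff (hn : 1 ≤ n) (ℓ : ℂ → ℂ) (z : Fin n → ℂ) :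
    (∀ u, (∀ v, reFormOf (gC ℓ z) u v = 0) → u = 0) ↔ (ℓ (coord z n)).im ≠ 0 ∧
      1 + deriv ℓ (coord z n) * coord (raiseS n z) n ≠ 0 := by
  have hz : coord (0 : Fin n → ℂ) n = 0 := (coordLin n n).map_zero
  simp only [reFormOf_apply, dotProduct_gC]
  refine ⟨fun h => ⟨fun him => ?_, fun ha => ?_⟩, fun ⟨him, ha⟩ u hu => ?_⟩
  · obtain ⟨e, he, -, -⟩ := exists_coord_last_eq_one hn
    have h1 : e = 0 := by
      refine h e fun v => ?_
      have h2 : ℓ (coord z n) - conj (ℓ (coord z n)) = 0 := by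
        rw [Complex.conj_eq_iff_im.2 him, sub_self]
      rw [h2, formB_apply, sigmaOp, zero_smul, add_zero, shiftN_pow_self]
      simp
    rw [h1, hz] at he
    exact zero_ne_one he
  · have h1 : deriv ℓ (coord z n) • raiseS n z = 0 := by
      refine h _ fun v => ?_
      have h2 : frameP ℓ z (deriv ℓ (coord z n) • raiseS n z) = 0 := by
        rw [frameP_apply, coord_smul, ← add_smul]
        have h3 : deriv ℓ (coord z n) + deriv ℓ (coord z n) *
            (deriv ℓ (coord z n) * coord (raiseS n z) n) = 0 := by
          linear_combination deriv ℓ (coord z n) * ha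
        rw [h3, zero_smul]
      rw [h2, map_zero]
      rfl
    have h2 := coord_smul (deriv ℓ (coord z n)) (raiseS n z) n
    rw [h1, hz] at h2
    rw [← h2, add_zero] at ha
    exact one_ne_zero ha
  · refine frameP_injective ha ?_
    rw [map_zero]
    refine formB_nondegenerate (m := n) (sub_conj_ne_zero him) fun w => ?_
    obtain ⟨v, rfl⟩ := (frameP_bijective ha).2 w
    exact hu v

lemma coord_raiseS_last (hn : 1 ≤ n) (z : Fin n → ℂ) :
    coord (raiseS n z) n = ((n : ℂ) - 1) * coord z (n - 1) := by
  obtain ⟨k, rfl⟩ : ∃ k, n = k + 1 := ⟨n - 1, by omega⟩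
  rw [coord_raiseS z le_rfl]
  simp

/-- The canonical coframe of the normal form, as a field of real-linear maps. -/
def frameR (ℓ : ℂ → ℂ) (z : Fin n → ℂ) : (Fin n → ℂ) →L[ℝ] (Fin n → ℂ) :=
  ((frameP ℓ z).restrictScalars ℝ).toContinuousLinearMap

lemma frameR_apply (ℓ : ℂ → ℂ) (z v : Fin n → ℂ) : frameR ℓ z v = frameP ℓ z v := rfl

section Smoothness

variable {D : Set ℂ}

lemma isOpen_coord_mem (hD : IsOpen D) (k : ℕ) : IsOpen {z : Fin n → ℂ | coord z k ∈ D} :=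
  hD.preimage (contDiff_coord k).continuous

lemma contDiffOn_comp_coord (hD : IsOpen D) (hℓ : DifferentiableOn ℂ ℓ D) (k : ℕ) :
    ContDiffOn ℝ ∞ (fun z : Fin n → ℂ => ℓ (coord z k)) {z | coord z k ∈ D} :=
  ((hℓ.contDiffOn hD (n := ∞)).restrict_scalars ℝ).comp (contDiff_coord k).contDiffOn
    fun _ hz => hz

lemma smoothOpOn_frameP (hD : IsOpen D) (hℓ : DifferentiableOn ℂ ℓ D) :
    SmoothOpOn (frameP (n := n) ℓ) {z | coord z n ∈ D} := by
  intro f hf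
  simp only [frameP_apply]
  exact hf.add (((contDiffOn_comp_coord hD (hℓ.deriv hD) n).mul
    ((contDiff_coord n).comp_contDiffOn hf)).smul (contDiff_endApply _).contDiffOn)

lemma contDiffOn_frameR (hD : IsOpen D) (hℓ : DifferentiableOn ℂ ℓ D) :
    ContDiffOn ℝ ∞ (frameR (n := n) ℓ) {z | coord z n ∈ D} :=
  contDiffOn_clm_apply.2 fun _ => smoothOpOn_frameP hD hℓ _ contDiffOn_const

lemma contDiffOn_opOf_LC (hD : IsOpen D) (hℓ : DifferentiableOn ℂ ℓ D) :
    ContDiffOn ℝ ∞ (fun z : Fin n → ℂ => opOf (LC ℓ z)) {z | coord z n ∈ D} := by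
  refine contDiffOn_clm_apply.2 fun v => ?_
  simp only [opOf_apply, LC_mulVec]
  exact ((contDiffOn_comp_coord hD hℓ n).smul contDiffOn_const).add
    ((contDiff_endApply _).comp_contDiffOn (smoothOpOn_frameP hD hℓ _ contDiffOn_const))

lemma contDiffOn_reFormOf_gC (hD : IsOpen D) (hℓ : DifferentiableOn ℂ ℓ D) :
    ContDiffOn ℝ ∞ (fun z : Fin n → ℂ => reFormOf (gC ℓ z)) {z | coord z n ∈ D} := by
  refine contDiffOn_clm_apply.2 fun u => contDiffOn_clm_apply.2 fun v => ?_
  simp only [reFormOf_apply, dotProduct_gC, formB_apply, pairK_apply]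
  have hc := contDiffOn_comp_coord (n := n) hD hℓ n
  have hρ : ContDiffOn ℝ ∞ (fun z : Fin n → ℂ => ℓ (coord z n) - conj (ℓ (coord z n)))
      {z | coord z n ∈ D} := hc.sub (Complex.conjCLE.contDiff.comp_contDiffOn hc)
  have hs : SmoothOpOn (fun z : Fin n → ℂ =>
      sigmaOp n (ℓ (coord z n) - conj (ℓ (coord z n))) ^ n) {z | coord z n ∈ D} :=
    ((SmoothOpOn.const (shiftN n)).add (SmoothOpOn.smul hρ (SmoothOpOn.const 1))).pow n
  have hu := contDiffOn_pi.1 (smoothOpOn_frameP (n := n) hD hℓ (fun _ => u) contDiffOn_const)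
  have hv := contDiffOn_pi.1 (hs _ (smoothOpOn_frameP hD hℓ (fun _ => v) contDiffOn_const))
  exact Complex.reCLM.contDiff.comp_contDiffOn
    (contDiffOn_const.mul (ContDiffOn.sum fun i _ => (hu _).mul (hv _)))

lemma isAdaptedAt_model (ℓ : ℂ → ℂ) (z : Fin n → ℂ) :
    IsAdaptedAt (fun z => reFormOf (gC ℓ z)) (fun z => opOf (LC ℓ z)) (frameR ℓ)
      (fun z => ℓ (coord z n)) z where
  map_op v := frameP_LC ℓ z v
  map_form u v := by
    rw [reFormOf_apply, dotProduct_gC]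
    rfl

lemma fderiv_comp_coord (hD : IsOpen D) (hℓ : DifferentiableOn ℂ ℓ D) {z : Fin n → ℂ} {k : ℕ}
    (hz : coord z k ∈ D) (u : Fin n → ℂ) :
    fderiv ℝ (fun z : Fin n → ℂ => ℓ (coord z k)) z u = deriv ℓ (coord z k) * coord u k := by
  have h1 : HasFDerivAt ℓ ((fderiv ℂ ℓ (coord z k)).restrictScalars ℝ) (coord z k) :=
    ((hℓ.differentiableAt (hD.mem_nhds hz)).hasFDerivAt).restrictScalars ℝ
  have h2 : HasFDerivAt (fun z : Fin n → ℂ => coord z k) (coordC n k) z := (coordC n k).hasFDerivAt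
  have h3 : HasFDerivAt (fun z : Fin n → ℂ => ℓ (coord z k)) _ z := HasFDerivAt.comp z h1 h2
  rw [h3.fderiv]
  simp [mul_comm]

/-- The term with the second derivative of ℓ is symmetric in u and v, so it drops out of the
torsion. -/
lemma fderiv_frameR (hD : IsOpen D) (hℓ : DifferentiableOn ℂ ℓ D) {z : Fin n → ℂ}
    (hz : coord z n ∈ D) (u v : Fin n → ℂ) :
    fderiv ℝ (frameR ℓ) z v u = (deriv (deriv ℓ) (coord z n) * coord v n * coord u n) • raiseS n z
      + (deriv ℓ (coord z n) * coord u n) • raiseS n v := by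
  have hopen := (isOpen_coord_mem (n := n) hD n).mem_nhds hz
  have h1 := hasDerivAt_clm_apply_const (hasDerivAt_comp_line
    (((contDiffOn_frameR hD hℓ).contDiffAt hopen).differentiableAt (by simp)).hasFDerivAt v) u
  have h2 := hasDerivAt_comp_line (((contDiffOn_comp_coord hD (hℓ.deriv hD)
    n).contDiffAt hopen).differentiableAt (by simp)).hasFDerivAt v
  rw [fderiv_comp_coord hD (hℓ.deriv hD) hz] at h2
  have h3 : HasDerivAt (fun t : ℝ => raiseS n (z + t • v)) (raiseS n v) 0 :=
    hasDerivAt_comp_line (((raiseS n).restrictScalars ℝ).toContinuousLinearMap).hasFDerivAt v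
  have h4 := ((h2.mul_const (coord u n)).smul h3).const_add u
  rw [h1.unique h4]
  simp only [zero_smul, add_zero]
  rw [add_comm]

/-- The normal form satisfies the compatibility equation. -/
lemma compatEqAt_model (hn : 1 ≤ n) (hD : IsOpen D) (hℓ : DifferentiableOn ℂ ℓ D)
    (hz : coord z n ∈ D) (him : (ℓ (coord z n)).im ≠ 0)
    (ha : 1 + deriv ℓ (coord z n) * coord (raiseS n z) n ≠ 0) :
    CompatEqAt (fun z => reFormOf (gC ℓ z)) (fun z => opOf (LC ℓ z)) z := by
  have hopen := (isOpen_coord_mem (n := n) hD n).mem_nhds hz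
  have hd := fun {F : Type} [NormedAddCommGroup F] [NormedSpace ℝ F] {f : (Fin n → ℂ) → F}
    (hf : ContDiffOn ℝ ∞ f {z | coord z n ∈ D}) =>
      (hf.contDiffAt hopen).differentiableAt (by simp)
  -- μ is forced by dλ = ℓ' dz_n and θ_n = (1 + ℓ' (Sz)_n) dz_n.
  refine compatEqAt_of_torsion (θ := frameR ℓ) (Λ := fun z => ℓ (coord z n))
    (μ := deriv ℓ (coord z n) * (1 + deriv ℓ (coord z n) * coord (raiseS n z) n)⁻¹) hn
    (isInvertible_of_nondegenerate ((reFormOf_gC_nondegenerate_iff hn ℓ z).2 ⟨him, ha⟩))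
    (hd (contDiffOn_reFormOf_gC hD hℓ)) (hd (contDiffOn_opOf_LC hD hℓ))
    (hd (contDiffOn_frameR hD hℓ)).hasFDerivAt (hd (contDiffOn_comp_coord hD hℓ n)).hasFDerivAt
    (Filter.Eventually.of_forall fun z' => isAdaptedAt_model ℓ z') ?_ (fun u => ?_) fun u v => ?_
  · have h1 : ContinuousAt (fun z : Fin n → ℂ =>
        1 + deriv ℓ (coord z n) * coord (raiseS n z) n) z :=
      continuousAt_const.add ((((contDiffOn_comp_coord hD (hℓ.deriv hD) n).contDiffAt
        hopen).continuousAt).mul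
        ((contDiff_coord n).comp (contDiff_endApply (raiseS n))).continuous.continuousAt)
    exact (h1.eventually_ne ha).mono fun z' hz' => frameP_bijective hz'
  · rw [fderiv_comp_coord hD hℓ hz, frameR_apply, coord_frameP_last]
    field_simp
  -- Expanding S ∘ P produces terms in S²z with coefficient ℓ'² u_n v_n; being symmetric, they
  -- cancel in the model torsion.
  · rw [fderiv_frameR hD hℓ hz, fderiv_frameR hD hℓ hz, modelTorsion, frameR_apply, frameR_apply,
      coord_frameP_last, coord_frameP_last, frameP_apply, frameP_apply]
    have h : ∀ c : ℂ, deriv ℓ (coord z n) * (1 + deriv ℓ (coord z n) * coord (raiseS n z) n)⁻¹ *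
        ((1 + deriv ℓ (coord z n) * coord (raiseS n z) n) * c) = deriv ℓ (coord z n) * c := by
      intro c
      field_simp
    rw [h, h]
    simp only [map_add, map_smul]
    module

end Smoothness

section ModelSpaceCharts

variable {E : Type*} [NormedAddCommGroup E] [NormedSpace ℝ E]

lemma coe_extChartAt_self (x₀ : E) : (extChartAt 𝓘(ℝ, E) x₀ : E → E) = id := rfl

lemma coe_extChartAt_symm_self (x₀ : E) : ((extChartAt 𝓘(ℝ, E) x₀).symm : E → E) = id := rfl

lemma chartDomain_self (U : Set E) (x₀ : E) : chartDomain E U x₀ = U := by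
  rw [chartDomain, coe_extChartAt_symm_self, extChartAt_model_space_eq_id]
  simp

lemma formInChart_self
    (g : ∀ x : E, TangentSpace 𝓘(ℝ, E) x →L[ℝ] TangentSpace 𝓘(ℝ, E) x →L[ℝ] ℝ) (x₀ : E) :
    formInChart g x₀ = fun y => (g y : E →L[ℝ] E →L[ℝ] ℝ) := by
  funext y
  simp only [formInChart, coe_extChartAt_symm_self, mfderiv_id]
  rfl

lemma endInChart_self
    (L : ∀ x : E, TangentSpace 𝓘(ℝ, E) x →L[ℝ] TangentSpace 𝓘(ℝ, E) x) (x₀ : E) :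
    endInChart L x₀ = fun y => (L y : E →L[ℝ] E) := by
  funext y
  simp only [endInChart, coe_extChartAt_symm_self, coe_extChartAt_self, mfderiv_id]
  rfl

end ModelSpaceCharts

lemma det_realForm_gC_ne_zero_iff (hn : 1 ≤ n) (ℓ : ℂ → ℂ) (z : Fin n → ℂ) :
    (realForm (gC ℓ z)).det ≠ 0 ↔ (ℓ (coord z n)).im ≠ 0 ∧
      1 + ((n : ℂ) - 1) * deriv ℓ (coord z n) * coord z (n - 1) ≠ 0 := by
  rw [det_realForm_ne_zero_iff, reFormOf_gC_nondegenerate_iff hn, coord_raiseS_last hn]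
  have h : deriv ℓ (coord z n) * (((n : ℂ) - 1) * coord z (n - 1))
      = ((n : ℂ) - 1) * deriv ℓ (coord z n) * coord z (n - 1) := by ring
  rw [h]

lemma opOf_LC_bijective (h0 : ℓ (coord z n) ≠ 0)
    (ha : 1 + deriv ℓ (coord z n) * coord (raiseS n z) n ≠ 0) :
    Function.Bijective (opOf (LC ℓ z)) := by
  have hinj : Function.Injective (opOf (LC ℓ z)).toLinearMap := by
    rw [injective_iff_map_eq_zero]
    intro v hv
    refine frameP_injective ha (sigmaOp_injective h0 ?_)
    rw [map_zero, map_zero, sigmaOp_apply, ← frameP_LC]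
    exact (congrArg (frameP ℓ z) hv).trans (map_zero _)
  exact ⟨hinj, LinearMap.injective_iff_surjective.1 hinj⟩

lemma reFormOf_gC_comm (ℓ : ℂ → ℂ) (z u v : Fin n → ℂ) :
    reFormOf (gC ℓ z) u v = reFormOf (gC ℓ z) v u := by
  rw [reFormOf_apply, reFormOf_apply, dotProduct_gC, dotProduct_gC, formB_comm]

lemma reFormOf_gC_opOf_LC (ℓ : ℂ → ℂ) (z u v : Fin n → ℂ) :
    reFormOf (gC ℓ z) (opOf (LC ℓ z) u) v = reFormOf (gC ℓ z) u (opOf (LC ℓ z) v) := by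
  rw [reFormOf_apply, reFormOf_apply, dotProduct_gC, dotProduct_gC, opOf_apply, opOf_apply,
    frameP_LC, frameP_LC, map_add, map_add, LinearMap.add_apply, formB_shiftN, map_smul,
    map_smul, LinearMap.smul_apply]

/-- The normal form is compatible where it is nondegenerate. -/
theorem isCompatibleOn_model (hn : 1 ≤ n) {D : Set ℂ} (hD : IsOpen D)
    (hℓ : DifferentiableOn ℂ ℓ D) :
    IsCompatibleOn (modelMetric n ℓ) (modelOp n ℓ)
      {z : Fin n → ℂ | coord z n ∈ D ∧ ℓ (coord z n) ≠ 0 ∧ (realForm (gC ℓ z)).det ≠ 0} := by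
  have hsub : {z : Fin n → ℂ | coord z n ∈ D ∧ ℓ (coord z n) ≠ 0 ∧ (realForm (gC ℓ z)).det ≠ 0}
      ⊆ {z | coord z n ∈ D} := fun z hz => hz.1
  have hreg : ∀ z : Fin n → ℂ, (realForm (gC ℓ z)).det ≠ 0 → (ℓ (coord z n)).im ≠ 0 ∧
      1 + deriv ℓ (coord z n) * coord (raiseS n z) n ≠ 0 := fun z hz =>
    (reFormOf_gC_nondegenerate_iff hn ℓ z).1 ((det_realForm_ne_zero_iff _).1 hz)
  refine ⟨⟨fun z _ u v => ?_, fun z hz => (det_realForm_ne_zero_iff _).1 hz.2.2, fun x₀ => ?_⟩,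
    fun x₀ => ?_, fun z _ u v => ?_, fun z hz => opOf_LC_bijective hz.2.1 (hreg z hz.2.2).2,
    fun x₀ z hz => ?_⟩
  · exact reFormOf_gC_comm ℓ z u v
  · rw [formInChart_self, chartDomain_self]
    exact (contDiffOn_reFormOf_gC hD hℓ).mono hsub
  · rw [endInChart_self, chartDomain_self]
    exact (contDiffOn_opOf_LC hD hℓ).mono hsub
  · exact reFormOf_gC_opOf_LC ℓ z u v
  · rw [chartDomain_self] at hz
    rw [formInChart_self, endInChart_self]
    exact compatEqAt_model hn hD hℓ hz.1 (hreg z hz.2.2).1 (hreg z hz.2.2).2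

end ModelCompatibility

end GeodEquiv

end

theorem theorem1p5 (n : ℕ) (hn : 1 ≤ n) :
    (∀ (E : Type*) [NormedAddCommGroup E] [NormedSpace ℝ E] [FiniteDimensional ℝ E]
      (M : Type*) [TopologicalSpace M] [ChartedSpace E M] [IsManifold 𝓘(ℝ, E) ∞ M]
      (g : ∀ x : M, TangentSpace 𝓘(ℝ, E) x →L[ℝ] TangentSpace 𝓘(ℝ, E) x →L[ℝ] ℝ)
      (L : ∀ x : M, TangentSpace 𝓘(ℝ, E) x →L[ℝ] TangentSpace 𝓘(ℝ, E) x)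
      (U : Set M) (lam : M → ℂ) (p : M),
      IsOpen U → p ∈ U →
      GeodEquiv.IsCompatibleOn g L U →
      ContinuousOn lam U →
      (∀ x ∈ U, (lam x).im ≠ 0 ∧ GeodEquiv.IsConjToJordanAt L n x (lam x)) →
      ∃ (J : ∀ x : M, TangentSpace 𝓘(ℝ, E) x →L[ℝ] TangentSpace 𝓘(ℝ, E) x)
        (φ : OpenPartialHomeomorph M (Fin n → ℂ)) (D : Set ℂ) (ℓ : ℂ → ℂ),
        p ∈ φ.source ∧ φ.source ⊆ U ∧
        GeodEquiv.IsComplexStructureOn n J φ.source ∧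
        GeodEquiv.IsComplexCoordinates J φ ∧
        IsOpen D ∧ DifferentiableOn ℂ ℓ D ∧
        (∀ x ∈ φ.source,
          GeodEquiv.coord (φ x) n ∈ D ∧
          lam x = ℓ (GeodEquiv.coord (φ x) n) ∧
          (∀ v, L x (J x v) = J x (L x v)) ∧
          (∀ v, GeodEquiv.dCoord φ x (L x v) =
            GeodEquiv.opOf (GeodEquiv.LC ℓ (φ x)) (GeodEquiv.dCoord φ x v)) ∧
          (∀ u v, g x u v = GeodEquiv.reFormOf (GeodEquiv.gC ℓ (φ x))
            (GeodEquiv.dCoord φ x u) (GeodEquiv.dCoord φ x v)) ∧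
          (∀ b, L x (GeodEquiv.coordVec φ x b) =
            ∑ a, GeodEquiv.realOp (GeodEquiv.LC ℓ (φ x)) a b • GeodEquiv.coordVec φ x a) ∧
          (∀ a b, g x (GeodEquiv.coordVec φ x a) (GeodEquiv.coordVec φ x b) =
            GeodEquiv.realForm (GeodEquiv.gC ℓ (φ x)) a b))) ∧
    (∀ (D : Set ℂ) (ℓ : ℂ → ℂ), IsOpen D → DifferentiableOn ℂ ℓ D →
      GeodEquiv.IsCompatibleOn (GeodEquiv.modelMetric n ℓ) (GeodEquiv.modelOp n ℓ)
        {z : Fin n → ℂ | GeodEquiv.coord z n ∈ D ∧ ℓ (GeodEquiv.coord z n) ≠ 0 ∧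
          (GeodEquiv.realForm (GeodEquiv.gC ℓ z)).det ≠ 0} ∧
      ∀ z : Fin n → ℂ, GeodEquiv.coord z n ∈ D →
        ((GeodEquiv.realForm (GeodEquiv.gC ℓ z)).det ≠ 0 ↔
          (ℓ (GeodEquiv.coord z n)).im ≠ 0 ∧
          1 + ((n : ℂ) - 1) * deriv ℓ (GeodEquiv.coord z n) * GeodEquiv.coord z (n - 1) ≠ 0)) := by
  refine ⟨?_, fun D ℓ hD hℓ => ⟨GeodEquiv.isCompatibleOn_model hn hD hℓ, fun z _ =>
    GeodEquiv.det_realForm_gC_ne_zero_iff hn ℓ z⟩⟩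
  intro E _ _ _ M _ _ _ g L U lam p hU hp hgL hlam hJ
  exact GeodEquiv.exists_complex_normal_form hn g L U lam p hU hp hgL hlam hJ
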